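/- Let $n\ge 1$, and let $\lambda$ be an integral dominant weight of $\mathfrak{sp}_{2n}$ with coordinates $(a_1,\dots,a_n)\in\mathbb Z_{\ge0}^n$ in the basis of fundamental weights. A *type C Dyck path* is a nonempty sequence $d=((i_1,j_1),\dots,(i_N,j_N))$ of pairs with $1\le i_k<j_k\le 2n+1-i_k$ such that $j_1-i_1=1$, each $(i_{k+1},j_{k+1})$ is $(i_k+1,j_k)$ or $(i_k,j_k+1)$, and either $j_N-i_N=1$ or $i_N+j_N=2n+1$. Put $M(\lambda,d)=a_{i_1}+\dots+a_{i_N}$ if $j_N-i_N=1$, and $M(\lambda,d)=a_{i_1}+\dots+a_n$ otherwise. The type C FFLV polytope $P_\lambda\subset U=\mathbb R^{n^2}$ (coordinates $x_{i,j}$, $1\le i<j\le 2n+1-i$) consists of the points $x$ with all $x_{i,j}\ge 0$ and $S(x,d):=\sum_{(i,j)\in d}x_{i,j}\le M(\lambda,d)$ for every type C Dyck path $d$. A vertex of $P_\lambda$ is *simple* if the tangent cone of $P_\lambda$ at it is simplicial and unimodular, i.e. generated by part of a $\mathbb Z$-basis of $\mathbb Z^{n^2}$. Let $U_A=\mathbb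 R^{n(2n-1)}$ have coordinates $x_{i,j}$, $1\le i<j\le 2n$, and let $\varphi:U\hookrightarrow U_A$ be the injective linear map with $\varphi(x)_{i,j}=x_{i,j}$ if $i+j<2n+1$, $\varphi(x)_{i,j}=2x_{i,j}$ if $i+j=2n+1$, and $\varphi(x)_{i,j}=x_{2n+1-j,\,2n+1-i}$ if $i+j>2n+1$. Put $(b_1,\dots,b_{2n-1})=(a_1,\dots,a_{n-1},2a_n,a_{n-1},\dots,a_1)$. Let $R$ be the set of segments $[i,j]$ with integers $1\le i<j\le 2n$. For $E\subset R$ let $x(E)\in U_A$ be the unique point with $x(E)_{i,j}=0$ for $[i,j]\notin E$ and $S(x(E),d^{i,j})=b_i+\dots+b_{j-1}$ for $[i,j]\in E$, where $d^{i,j}=((i,i+1),(i,i+2),\dots,(i,j),(i+1,j),\dots,(j-1,j))$ and $S(x,d)=\sum_{(k,l)\in d}x_{k,l}$ also for $x\in U_A$. Let $\mathbf R^C_s$ be the set of all $E\subset R$ such that (i) if two segments in $E$ have a nonempty intersection (possibly a single point), then this intersection belongs to $E$ (so it is not a single point); (ii) $E$ is symmetric, i.e. $[i,j]\in E$ implies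 $[2n+1-j,2n+1-i]\in E$; (iii) any two segments $[i,j],[k,l]\in E$ with $i+j\le 2n+1$ and $k+l\le 2n+1$ are either disjoint or one of them contains the other. **Theorem.** Suppose $\lambda$ is regular, i.e. all $a_i>0$. Then for every $E\in\mathbf R^C_s$ the point $\varphi^{-1}(x(E))$ exists and is a vertex of $P_\lambda$, and a vertex of $P_\lambda$ is simple if and only if it has the form $\varphi^{-1}(x(E))$ for some $E\in\mathbf R^C_s$. -/

import Mathlib

noncomputable section

namespace FFLV

/-- The pairs `(i, j)` with `1 ≤ i < j ≤ m`. They label the coordinates of the type A space for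
`sl_m`, and the pair `(i, j)` also encodes the segment `[i, j]`, so this is also the set `R` of
all segments of positive length in `[1, m]` with integer endpoints. -/
def pairsA (m : ℕ) : Finset (ℕ × ℕ) :=
  (Finset.Icc 1 m ×ˢ Finset.Icc 1 m).filter (fun p => p.1 < p.2)

/-- The pairs `(i, j)` with `1 ≤ i < j ≤ 2n + 1 - i`, labelling the coordinates of the type C
space `ℝ^(n²)`. -/
def pairsC (n : ℕ) : Finset (ℕ × ℕ) :=
  (Finset.Icc 1 (2 * n) ×ˢ Finset.Icc 1 (2 * n)).filter
    (fun p => p.1 < p.2 ∧ p.1 + p.2 ≤ 2 * n + 1)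

theorem mem_pairsA {m : ℕ} {p : ℕ × ℕ} :
    p ∈ pairsA m ↔ 1 ≤ p.1 ∧ p.1 < p.2 ∧ p.2 ≤ m := by
  simp only [pairsA, Finset.mem_filter, Finset.mem_product, Finset.mem_Icc]
  omega

theorem mem_pairsC {n : ℕ} {p : ℕ × ℕ} :
    p ∈ pairsC n ↔ 1 ≤ p.1 ∧ p.1 < p.2 ∧ p.1 + p.2 ≤ 2 * n + 1 := by
  simp only [pairsC, Finset.mem_filter, Finset.mem_product, Finset.mem_Icc]
  omega

/-- `S(x, d)`: the sum of the coordinates `x_{i,j}` over `(i, j) ∈ d`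
(a Dyck path never visits a pair twice). -/
def pathSum {I : Finset (ℕ × ℕ)} (x : I → ℝ) (d : List (ℕ × ℕ)) : ℝ :=
  ∑ p : I, if p.1 ∈ d then x p else 0

/-- One step of a Dyck path: `(i, j)` is followed by `(i + 1, j)` or `(i, j + 1)`. -/
def PathStep (p q : ℕ × ℕ) : Prop :=
  q = (p.1 + 1, p.2) ∨ q = (p.1, p.2 + 1)

/-- Type C Dyck paths: nonempty sequences of pairs `1 ≤ i < j ≤ 2n + 1 - i` starting in the top
row `j - i = 1`, following Dyck steps, and ending in the top row or in the column
`i + j = 2n + 1`. -/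
structure IsDyckPathC (n : ℕ) (d : List (ℕ × ℕ)) : Prop where
  ne_nil : d ≠ []
  mem_pairs : ∀ p ∈ d, p ∈ pairsC n
  chain : d.IsChain PathStep
  head_top : (d.head ne_nil).2 = (d.head ne_nil).1 + 1
  last_top_or_column : (d.getLast ne_nil).2 = (d.getLast ne_nil).1 + 1 ∨
    (d.getLast ne_nil).1 + (d.getLast ne_nil).2 = 2 * n + 1

/-- `M(λ, d)` for a type C path `d` and the `sp_{2n}`-weight `λ` with coordinates `a 1, …, a n` in
the basis of fundamental weights: `a_{i_1} + … + a_{i_N}` if `d` ends in the top row, and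
`a_{i_1} + … + a_n` otherwise. -/
def boundC (n : ℕ) (a : ℕ → ℕ) (d : List (ℕ × ℕ)) (hd : d ≠ []) : ℝ :=
  if (d.getLast hd).2 = (d.getLast hd).1 + 1 then
    ∑ k ∈ Finset.Icc (d.head hd).1 (d.getLast hd).1, (a k : ℝ)
  else
    ∑ k ∈ Finset.Icc (d.head hd).1 n, (a k : ℝ)

/-- The type C FFLV polytope `P_λ`, where `λ` has coordinates `a 1, …, a n` (the other values of
`a` play no role). -/
def polytopeC (n : ℕ) (a : ℕ → ℕ) : Set (pairsC n → ℝ) :=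
  {x | (∀ p, 0 ≤ x p) ∧
    ∀ (d : List (ℕ × ℕ)) (hd : IsDyckPathC n d), pathSum x d ≤ boundC n a d hd.ne_nil}

/-- The tangent cone of `P` at `v`, translated to the origin. -/
def tangentCone {ι : Type*} (P : Set (ι → ℝ)) (v : ι → ℝ) : Set (ι → ℝ) :=
  {y | ∃ x ∈ P, ∃ k : ℝ, 0 ≤ k ∧ y = k • (x - v)}

/-- A cone is simplicial and unimodular (with respect to the lattice `ℤ^ι`) if it is generated by
part of a `ℤ`-basis of the lattice. (For a cone of full dimension, this is then a whole basis.) -/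
def IsUnimodularSimplicialCone {ι : Type*} (C : Set (ι → ℝ)) : Prop :=
  ∃ (b : Module.Basis ι ℤ (ι → ℤ)) (s : Finset ι),
    C = {y | ∃ c : ι → ℝ, (∀ i, 0 ≤ c i) ∧ y = ∑ i ∈ s, c i • (fun t => ((b i t : ℤ) : ℝ))}

/-- `v` is a simple vertex of `P`: a vertex whose tangent cone is simplicial and unimodular. -/
def IsSimpleVertex {ι : Type*} (P : Set (ι → ℝ)) (v : ι → ℝ) : Prop :=
  v ∈ P.extremePoints ℝ ∧ IsUnimodularSimplicialCone (tangentCone P v)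

/-- The type A Dyck path `d^{i,j} = ((i,i+1), (i,i+2), …, (i,j), (i+1,j), …, (j-1,j))`. -/
def hook (i j : ℕ) : List (ℕ × ℕ) :=
  (List.range' (i + 1) (j - i)).map (fun l => (i, l)) ++
    (List.range' (i + 1) (j - i - 1)).map (fun k => (k, j))

theorem mem_hook {i j : ℕ} (hij : i < j) {q : ℕ × ℕ} :
    q ∈ hook i j ↔ (q.1 = i ∧ i < q.2 ∧ q.2 ≤ j) ∨ (q.2 = j ∧ i < q.1 ∧ q.1 < j) := by
  obtain ⟨k, l⟩ := q
  simp only [hook, List.mem_append, List.mem_map, List.mem_range'_1, Prod.mk.injEq]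
  constructor
  · rintro (⟨c, hc, h1, h2⟩ | ⟨c, hc, h1, h2⟩)
    · left; omega
    · right; omega
  · rintro (h | h)
    · exact Or.inl ⟨l, by omega, by omega, rfl⟩
    · exact Or.inr ⟨k, by omega, rfl, by omega⟩

/-- The conditions defining `x(E)` for the `sl_m`-weight with coordinates `b 1, …, b (m - 1)`:
`x_{i,j} = 0` for `[i, j] ∉ E`, and `S(x, d^{i,j}) = b_i + … + b_{j-1}` for `[i, j] ∈ E`. -/
def IsSegmentPoint (m : ℕ) (b : ℕ → ℕ) (E : Finset (ℕ × ℕ)) (x : pairsA m → ℝ) : Prop :=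
  (∀ p : pairsA m, p.1 ∉ E → x p = 0) ∧
    ∀ p : pairsA m, p.1 ∈ E → pathSum x (hook p.1.1 p.1.2) = ∑ k ∈ Finset.Ico p.1.1 p.1.2, (b k : ℝ)

theorem existsUnique_isSegmentPoint (m : ℕ) (b : ℕ → ℕ) (E : Finset (ℕ × ℕ)) :
    ∃! x, IsSegmentPoint m b E x := by
  let T : (pairsA m → ℝ) →ₗ[ℝ] (pairsA m → ℝ) :=
    { toFun := fun x p => if p.1 ∈ E then pathSum x (hook p.1.1 p.1.2) else x p
      map_add' := by
        intro x y
        funext p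
        by_cases hp : p.1 ∈ E
        · simp only [hp, if_true, Pi.add_apply, pathSum, ← Finset.sum_add_distrib]
          exact Finset.sum_congr rfl fun q _ => by split_ifs <;> simp
        · simp [hp]
      map_smul' := by
        intro r x
        funext p
        by_cases hp : p.1 ∈ E
        · simp [hp, pathSum, Finset.mul_sum]
        · simp [hp] }
  have hT : ∀ x p, T x p = if p.1 ∈ E then pathSum x (hook p.1.1 p.1.2) else x p :=
    fun _ _ => rfl
  have hinj : Function.Injective T := by
    rw [injective_iff_map_eq_zero]
    intro x hx
    have key : ∀ (r : ℕ) (p : pairsA m), p.1.2 - p.1.1 = r → x p = 0 := by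
      intro r
      induction r using Nat.strong_induction_on with
      | _ r ih =>
        intro p hp
        have h0 := congrFun hx p
        rw [hT] at h0
        split_ifs at h0 with hE
        · have hp' := mem_pairsA.1 p.2
          have hs : pathSum x (hook p.1.1 p.1.2) = x p := by
            rw [pathSum, Finset.sum_eq_single p]
            · rw [if_pos ((mem_hook hp'.2.1).2 (Or.inl ⟨rfl, hp'.2.1, le_rfl⟩))]
            · intro q _ hq
              split_ifs with hm
              · have hq' := mem_pairsA.1 q.2
                rw [mem_hook hp'.2.1] at hm
                have hne : ¬ (q.1.1 = p.1.1 ∧ q.1.2 = p.1.2) := fun h =>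
                  hq (Subtype.ext (Prod.ext h.1 h.2))
                exact ih (q.1.2 - q.1.1) (by omega) q rfl
              · rfl
            · intro h
              exact absurd (Finset.mem_univ p) h
          rw [hs] at h0
          simpa using h0
        · simpa using h0
    funext p
    exact key _ p rfl
  have hchar : ∀ x, IsSegmentPoint m b E x ↔
      T x = fun p => if p.1 ∈ E then ∑ k ∈ Finset.Ico p.1.1 p.1.2, (b k : ℝ) else 0 := by
    intro x
    constructor
    · rintro ⟨h1, h2⟩
      funext p
      rw [hT]
      split_ifs with hE
      · exact h2 p hE
      · exact h1 p hE
    · intro h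
      refine ⟨fun p hE => ?_, fun p hE => ?_⟩
      · simpa [hT, hE] using congrFun h p
      · simpa [hT, hE] using congrFun h p
  obtain ⟨x, hx⟩ := (LinearMap.injective_iff_surjective.1 hinj)
    (fun p => if p.1 ∈ E then ∑ k ∈ Finset.Ico p.1.1 p.1.2, (b k : ℝ) else 0)
  exact ⟨x, (hchar x).2 hx, fun y hy => hinj (((hchar y).1 hy).trans hx.symm)⟩

/-- The point `x(E)` of the type A space for the `sl_m`-weight with coordinates `b`. -/
def segmentPoint (m : ℕ) (b : ℕ → ℕ) (E : Finset (ℕ × ℕ)) : pairsA m → ℝ :=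
  (existsUnique_isSegmentPoint m b E).choose

theorem segmentPoint_spec (m : ℕ) (b : ℕ → ℕ) (E : Finset (ℕ × ℕ)) :
    IsSegmentPoint m b E (segmentPoint m b E) :=
  (existsUnique_isSegmentPoint m b E).choose_spec.1

/-- The `sl_{2n}`-weight with coordinates `(a_1, …, a_{n-1}, 2 a_n, a_{n-1}, …, a_1)`. -/
def barWeight (n : ℕ) (a : ℕ → ℕ) (k : ℕ) : ℕ :=
  if k < n then a k else if k = n then 2 * a n else a (2 * n - k)

/-- The linear embedding `φ` of the type C space for `sp_{2n}` into the type A space for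
`sl_{2n}`. -/
def phi (n : ℕ) (x : pairsC n → ℝ) : pairsA (2 * n) → ℝ := fun p =>
  if h : p.1.1 + p.1.2 < 2 * n + 1 then
    x ⟨p.1, mem_pairsC.2 (by have := mem_pairsA.1 p.2; omega)⟩
  else if h' : p.1.1 + p.1.2 = 2 * n + 1 then
    2 * x ⟨p.1, mem_pairsC.2 (by have := mem_pairsA.1 p.2; omega)⟩
  else
    x ⟨(2 * n + 1 - p.1.2, 2 * n + 1 - p.1.1),
      mem_pairsC.2 (by have := mem_pairsA.1 p.2; simp only; omega)⟩

/-- `φ` is injective, so `φ v = y` says precisely that `v = φ⁻¹(y)`. -/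
theorem phi_injective (n : ℕ) : Function.Injective (phi n) := by
  intro x y hxy
  funext p
  have hp := mem_pairsC.1 p.2
  have h := congrFun hxy ⟨p.1, mem_pairsA.2 (by omega)⟩
  simp only [phi] at h
  split_ifs at h with h1 h2
  · exact h
  · exact mul_left_cancel₀ two_ne_zero h
  · omega

/-- The set `R_p` of sets `E` of segments in `[1, m]` that contain, with any two segments
having a nonempty intersection (possibly a single point), that intersection. The intersection of
`[i, j]` and `[k, l]` is `[max i k, min j l]`; if it is a single point, it is not a segment of
positive length and hence not in `E`. -/
def permSets (m : ℕ) : Set (Finset (ℕ × ℕ)) :=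
  {E | E ⊆ pairsA m ∧ ∀ s ∈ E, ∀ t ∈ E, max s.1 t.1 ≤ min s.2 t.2 →
    (max s.1 t.1, min s.2 t.2) ∈ E}

/-- `E` is symmetric: it contains, with any segment `[i, j]`, also `[2n+1-j, 2n+1-i]`. -/
def IsSymmetric (n : ℕ) (E : Finset (ℕ × ℕ)) : Prop :=
  ∀ s ∈ E, (2 * n + 1 - s.2, 2 * n + 1 - s.1) ∈ E

/-- The set `R^C_s`: symmetric elements `E` of `R_p` such that any two segments `[i, j]` in `E`
with `i + j ≤ 2n + 1` are either disjoint or one of them contains the other. -/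
def simpleSetsC (n : ℕ) : Set (Finset (ℕ × ℕ)) :=
  {E | E ∈ permSets (2 * n) ∧ IsSymmetric n E ∧
    ∀ s ∈ E, ∀ t ∈ E, s.1 + s.2 ≤ 2 * n + 1 → t.1 + t.2 ≤ 2 * n + 1 →
      Disjoint (Finset.Icc s.1 s.2) (Finset.Icc t.1 t.2) ∨
        Finset.Icc s.1 s.2 ⊆ Finset.Icc t.1 t.2 ∨ Finset.Icc t.1 t.2 ⊆ Finset.Icc s.1 s.2}

end FFLV

end

namespace FFLV

open Filter Topology

/-! ### Polyhedra: tight inequalities, vertices and tangent cones. -/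

section HalfSpaces

variable {ι K : Type*} (g : K → (ι → ℝ) →ₗ[ℝ] ℝ) (c : K → ℝ)

/-- The polyhedron cut out by the inequalities `g k x ≤ c k`. -/
def polyhedron : Set (ι → ℝ) := {x | ∀ k, g k x ≤ c k}

variable {g c}

theorem exists_add_smul_mem_polyhedron [Finite K] {x y : ι → ℝ} (hx : x ∈ polyhedron g c)
    (hy : ∀ k, g k x = c k → g k y ≤ 0) : ∃ ε : ℝ, 0 < ε ∧ x + ε • y ∈ polyhedron g c := by
  have h : ∀ᶠ ε : ℝ in 𝓝[>] 0, ∀ k, g k (x + ε • y) ≤ c k := by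
    refine eventually_all.2 fun k => ?_
    rcases (hx k).eq_or_lt with hk | hk
    · filter_upwards [self_mem_nhdsWithin] with ε hε
      have := mul_nonpos_of_nonneg_of_nonpos (le_of_lt hε) (hy k hk)
      simp only [map_add, map_smul, smul_eq_mul]
      linarith
    · have ht : Tendsto (fun ε : ℝ => g k x + ε * g k y) (𝓝[>] 0) (𝓝 (g k x + 0 * g k y)) :=
        ((continuous_const.add (continuous_id.mul continuous_const)).tendsto 0).mono_left
          nhdsWithin_le_nhds
      rw [zero_mul, add_zero] at ht
      filter_upwards [ht.eventually_lt_const hk] with ε hε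
      simpa using hε.le
  obtain ⟨ε, hε, hpos⟩ := (h.and self_mem_nhdsWithin).exists
  exact ⟨ε, hpos, hε⟩

/-- Otherwise v could be moved a little both ways along u, since finitely many slack inequalities
survive a small step. In the applications u is a test vector built from the combinatorics of tight
paths. -/
theorem eq_zero_of_mem_extremePoints [Finite K] {v u : ι → ℝ}
    (hv : v ∈ (polyhedron g c).extremePoints ℝ) (hu : ∀ k, g k v = c k → g k u = 0) : u = 0 := by
  obtain ⟨ε, hε, h1⟩ := exists_add_smul_mem_polyhedron hv.1 (fun k hk => (hu k hk).le)
  obtain ⟨δ, hδ, h2⟩ := exists_add_smul_mem_polyhedron (y := -u) hv.1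
    (fun k hk => by rw [map_neg, hu k hk, neg_zero])
  have hseg : v ∈ openSegment ℝ (v + ε • u) (v + δ • -u) := by
    refine ⟨δ / (ε + δ), ε / (ε + δ), by positivity, by positivity, by field_simp; ring, ?_⟩
    funext t
    simp only [Pi.add_apply, Pi.smul_apply, smul_eq_mul, Pi.neg_apply]
    field_simp
    ring
  have := hv.2 h1 h2 hseg
  have h3 : ε • u = 0 := by simpa using this
  exact (smul_eq_zero.1 h3).resolve_left hε.ne'

theorem mem_extremePoints_polyhedron {v : ι → ℝ} (hv : v ∈ polyhedron g c)
    (h : ∀ u, (∀ k, g k v = c k → g k u = 0) → u = 0) :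
    v ∈ (polyhedron g c).extremePoints ℝ := by
  refine ⟨hv, fun x hx y hy hxy => ?_⟩
  obtain ⟨r, s, hr, hs, hrs, hv'⟩ := hxy
  refine sub_eq_zero.1 (h (x - v) fun k hk => ?_)
  have h1 : r * g k x + s * g k y = c k := by
    rw [← hk, ← hv']; simp
  have hx' := hx k
  have hy' := hy k
  have h2 : g k x = c k := by
    apply le_antisymm hx'
    by_contra hlt
    push Not at hlt
    have h3 : r * g k x < r * c k := by gcongr
    have h4 : s * g k y ≤ s * c k := by gcongr
    have h5 : r * c k + s * c k = c k := by rw [← add_mul, hrs, one_mul]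
    linarith
  rw [map_sub, h2, hk, sub_self]

theorem tangentCone_polyhedron [Finite K] {v : ι → ℝ} (hv : v ∈ polyhedron g c) :
    tangentCone (polyhedron g c) v = {y | ∀ k, g k v = c k → g k y ≤ 0} := by
  ext y
  constructor
  · rintro ⟨x, hx, r, hr, rfl⟩ k hk
    rw [map_smul, map_sub, hk, smul_eq_mul]
    exact mul_nonpos_of_nonneg_of_nonpos hr (sub_nonpos.2 (hx k))
  · intro hy
    obtain ⟨ε, hε, h⟩ := exists_add_smul_mem_polyhedron hv hy
    refine ⟨_, h, ε⁻¹, by positivity, ?_⟩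
    rw [add_sub_cancel_left, smul_smul, inv_mul_cancel₀ hε.ne', one_smul]

/-- The i-th coordinate functional of a ℤ-basis has integer coefficients in the standard basis, so
the same coefficients define it over ℝ. -/
theorem exists_dual_functional [Fintype ι] (b : Module.Basis ι ℤ (ι → ℤ)) (i : ι) :
    ∃ f : (ι → ℝ) →ₗ[ℝ] ℝ, f (fun t => ((b i t : ℤ) : ℝ)) = 1 ∧
      ∀ j, j ≠ i → f (fun t => ((b j t : ℤ) : ℝ)) = 0 := by
  classical
  have key : ∀ j, ∑ t, b j t * b.repr (Pi.single t 1) i = if j = i then 1 else 0 := by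
    intro j
    have h1 : b j = ∑ t, b j t • (Pi.single t 1 : ι → ℤ) := by
      simp [← Pi.single_smul, Finset.univ_sum_single]
    have h2 := congrArg (fun z => b.repr z i) h1
    simp only [map_sum, map_smul, Finsupp.coe_finsetSum, Finset.sum_apply, Finsupp.smul_apply,
      smul_eq_mul, Module.Basis.repr_self, Finsupp.single_apply] at h2
    exact h2.symm
  let f : (ι → ℝ) →ₗ[ℝ] ℝ := ∑ t, ((b.repr (Pi.single t 1) i : ℤ) : ℝ) • LinearMap.proj t
  have hf : ∀ j, f (fun t => ((b j t : ℤ) : ℝ)) = if j = i then 1 else 0 := by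
    intro j
    have := congrArg (fun z : ℤ => (z : ℝ)) (key j)
    simp only [f, LinearMap.sum_apply, LinearMap.smul_apply, LinearMap.proj_apply, smul_eq_mul]
    push_cast at this
    rw [← this]
    exact Finset.sum_congr rfl fun t _ => mul_comm _ _
  exact ⟨f, by simp [hf], fun j hj => by simp [hf, hj]⟩

/-- At a simple vertex of a polyhedron all of whose inequalities define different facets, four
tight inequalities cannot satisfy a relation `g₁ + g₂ = g₃ + g₄` except a trivial one. -/
theorem IsUnimodularSimplicialCone.false_of_relation [Fintype ι] [Finite K]
    (hfacet : ∀ k, ∃ w, g k w = c k ∧ ∀ k', k' ≠ k → g k' w < c k') {v : ι → ℝ}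
    (hv : v ∈ polyhedron g c)
    (hT : IsUnimodularSimplicialCone (tangentCone (polyhedron g c) v)) {k₁ k₂ k₃ k₄ : K}
    (h₁ : g k₁ v = c k₁) (h₂ : g k₂ v = c k₂) (h₃ : g k₃ v = c k₃) (h₄ : g k₄ v = c k₄)
    (hrel : g k₁ + g k₂ = g k₃ + g k₄) (h13 : k₁ ≠ k₃) (h14 : k₁ ≠ k₄) : False := by
  obtain ⟨b, s, hs⟩ := hT
  set B : ι → ι → ℝ := fun i t => ((b i t : ℤ) : ℝ) with hB
  have hcone := tangentCone_polyhedron hv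
  have hmem : ∀ k, ∃ w, w ∈ polyhedron g c ∧ g k w = c k ∧ ∀ k', k' ≠ k → g k' w < c k' := by
    intro k
    obtain ⟨w, hw, hw'⟩ := hfacet k
    refine ⟨w, fun k' => ?_, hw, hw'⟩
    by_cases h : k' = k
    · rw [h, hw]
    · exact (hw' k' h).le
  have hsub : ∀ w ∈ polyhedron g c, w - v ∈ tangentCone (polyhedron g c) v :=
    fun w hw => ⟨w, hw, 1, zero_le_one, (one_smul ℝ _).symm⟩
  have hneg : ∀ k, g k v = c k → ∀ i ∈ s, g k (B i) ≤ 0 := by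
    intro k hk i hi
    have : B i ∈ tangentCone (polyhedron g c) v := by
      classical
      rw [hs]
      refine ⟨Pi.single i 1, fun j => ?_, ?_⟩
      · by_cases h : j = i
        · subst h; simp
        · simp [h]
      · rw [Finset.sum_eq_single i]
        · simp [hB]
        · intro j _ hj; simp [hj]
        · intro h; exact absurd hi h
    rw [hcone] at this
    exact this k hk
  -- If `g k₁` vanished on all generators it would vanish on the cone, but a point in the relative
  -- interior of the facet of k₃ has slack in k₁.
  obtain ⟨i, hi, hi1⟩ : ∃ i ∈ s, g k₁ (B i) < 0 := by
    by_contra hcon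
    push Not at hcon
    obtain ⟨w, hw, -, hw'⟩ := hmem k₃
    have h := hsub w hw
    rw [hs] at h
    obtain ⟨e, he, hwe⟩ := h
    have : 0 ≤ g k₁ (w - v) := by
      rw [hwe, map_sum]
      refine Finset.sum_nonneg fun j hj => ?_
      rw [map_smul]
      exact mul_nonneg (he j) (hcon j hj)
    rw [map_sub, h₁] at this
    linarith [hw' k₁ h13]
  obtain ⟨f, hfi, hfj⟩ := exists_dual_functional b i
  have hfT : ∀ y ∈ tangentCone (polyhedron g c) v, 0 ≤ f y := by
    intro y hy
    rw [hs] at hy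
    obtain ⟨e, he, rfl⟩ := hy
    rw [map_sum]
    refine Finset.sum_nonneg fun j hj => ?_
    rw [map_smul]
    by_cases h : j = i
    · subst h; rw [hfi]; simpa using he j
    · rw [hfj j h]; simp
  -- A tight inequality that is negative on the ray of `B i` cuts out the facet opposite to that
  -- ray: around its facet point w one can move freely inside the hyperplane `g k = 0`, which forces
  -- the nonnegative functional f to vanish there. So f is a multiple of `g k`.
  have hprop : ∀ k, g k v = c k → g k (B i) < 0 → ∀ z, f z = g k z / g k (B i) := by
    intro k hk hki z
    obtain ⟨w, hw, hwk, hw'⟩ := hmem k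
    have hfw : f (w - v) = 0 := by
      have h := hsub w hw
      rw [hs] at h
      obtain ⟨e, he, hwe⟩ := h
      have h0 : ∑ j ∈ s, e j * g k (B j) = 0 := by
        have : g k (w - v) = 0 := by rw [map_sub, hwk, hk, sub_self]
        rw [hwe, map_sum] at this
        simpa using this
      have hei : e i = 0 := by
        have := (Finset.sum_eq_zero_iff_of_nonpos fun j hj =>
          mul_nonpos_of_nonneg_of_nonpos (he j) (hneg k hk j hj)).1 h0 i hi
        exact (mul_eq_zero.1 this).resolve_right hki.ne
      rw [hwe, map_sum]
      refine Finset.sum_eq_zero fun j hj => ?_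
      rw [map_smul]
      by_cases h : j = i
      · subst h; simp [hei]
      · rw [hfj j h]; simp
    have hker : ∀ y, g k y = 0 → 0 ≤ f y := by
      intro y hy
      obtain ⟨ε, hε, hmemε⟩ := exists_add_smul_mem_polyhedron (y := y) hw (fun k' hk' => by
        by_cases h : k' = k
        · rw [h, hy]
        · exact absurd hk' (hw' k' h).ne)
      have h := hfT _ (hsub _ hmemε)
      have h' : w + ε • y - v = (w - v) + ε • y := by abel
      rw [h', map_add, hfw, map_smul, zero_add, smul_eq_mul] at h
      exact nonneg_of_mul_nonneg_right h hε
    have hz : g k (z - (g k z / g k (B i)) • B i) = 0 := by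
      rw [map_sub, map_smul, smul_eq_mul, div_mul_cancel₀ _ hki.ne, sub_self]
    have h1 := hker _ hz
    have h2 := hker (-(z - (g k z / g k (B i)) • B i)) (by rw [map_neg, hz, neg_zero])
    rw [map_neg] at h2
    have h3 : f (z - (g k z / g k (B i)) • B i) = 0 := by linarith
    rw [map_sub, map_smul, hfi, smul_eq_mul, mul_one] at h3
    linarith
  -- Two inequalities proportional to the same f would define the same facet. Hence k₁ is the only
  -- tight inequality negative on `B i`, while the relation makes k₃ or k₄ negative as well.
  have hfin : ∀ k, g k v = c k → k₁ ≠ k → g k (B i) < 0 → False := by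
    intro k hk hne hki
    obtain ⟨w, hw, hwk, hw'⟩ := hmem k₁
    have e1 := hprop k₁ h₁ hi1 (w - v)
    have e2 := hprop k hk hki (w - v)
    rw [e1, map_sub, map_sub, hwk, h₁, sub_self, zero_div, hk] at e2
    have := (div_eq_zero_iff.1 e2.symm).resolve_right hki.ne
    linarith [hw' k hne.symm]
  have hr := LinearMap.congr_fun hrel (B i)
  simp only [LinearMap.add_apply] at hr
  have := hneg k₂ h₂ i hi
  rcases lt_or_ge (g k₃ (B i)) 0 with h | h
  · exact hfin k₃ h₃ h13 h
  · exact hfin k₄ h₄ h14 (by linarith)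

/-- If the inequalities tight at `v` are given by an invertible integer matrix, then the tangent
cone at `v` is simplicial and unimodular. -/
theorem isUnimodularSimplicialCone_tangentCone [Fintype ι] [Finite K] {v : ι → ℝ}
    (hv : v ∈ polyhedron g c) (κ : ι → K) (hκ : ∀ k, g k v = c k ↔ ∃ i, k = κ i)
    (A : (ι → ℤ) ≃ₗ[ℤ] (ι → ℤ))
    (hA : ∀ z i, g (κ i) (fun t => (z t : ℝ)) = -((A z i : ℤ) : ℝ))
    (hinj : ∀ y, (∀ i, g (κ i) y = 0) → y = 0) :
    IsUnimodularSimplicialCone (tangentCone (polyhedron g c) v) := by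
  classical
  -- The generators are the inverse images under A of the standard basis, on which the tight
  -- functionals take the values −δ_ij.
  refine ⟨Module.Basis.ofEquivFun A, Finset.univ, ?_⟩
  rw [tangentCone_polyhedron hv]
  have hb : ∀ i j, g (κ i) (fun t => ((Module.Basis.ofEquivFun A j t : ℤ) : ℝ)) =
      if i = j then -1 else 0 := by
    intro i j
    rw [hA, Module.Basis.coe_ofEquivFun, LinearEquiv.apply_symm_apply]
    by_cases h : i = j
    · subst h; simp
    · simp [h]
  have hsum : ∀ (e : ι → ℝ) i,
      g (κ i) (∑ j, e j • (fun t => ((Module.Basis.ofEquivFun A j t : ℤ) : ℝ))) = -e i := by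
    intro e i
    simp only [map_sum, map_smul, hb, smul_eq_mul, mul_ite, mul_neg, mul_one, mul_zero,
      Finset.sum_ite_eq, Finset.mem_univ, if_true]
  ext y
  constructor
  · intro hy
    refine ⟨fun i => -g (κ i) y, fun i => ?_, ?_⟩
    · have := hy (κ i) ((hκ _).2 ⟨i, rfl⟩)
      simpa using this
    · refine sub_eq_zero.1 (hinj _ fun i => ?_)
      rw [map_sub, hsum (fun i => -g (κ i) y)]
      simp
  · rintro ⟨e, he, rfl⟩ k hk
    obtain ⟨i, rfl⟩ := (hκ k).1 hk
    rw [hsum]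
    simpa using he i

end HalfSpaces

/-! ### Unitriangular linear systems. -/

section Triangular

variable {ι R : Type*} [Fintype ι] [CommRing R]

/-- Stated over any commutative ring because it is used twice: over ℝ for the existence and
uniqueness of points, over ℤ for unimodularity. -/
theorem existsUnique_triangular (rank : ι → ℕ) (D : ι → Finset ι)
    (hD : ∀ p, ∀ q ∈ D p, rank q < rank p) (c : ι → R) :
    ∃! x : ι → R, ∀ p, x p + ∑ q ∈ D p, x q = c p := by
  have hex : ∀ N : ℕ, ∃ x : ι → R, ∀ p, rank p < N → x p + ∑ q ∈ D p, x q = c p := by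
    intro N
    induction N with
    | zero => exact ⟨0, fun p hp => absurd hp (Nat.not_lt_zero _)⟩
    | succ N ih =>
      obtain ⟨x, hx⟩ := ih
      refine ⟨fun p => if rank p < N then x p else c p - ∑ q ∈ D p, x q, fun p hp => ?_⟩
      have hsum : ∑ q ∈ D p, (if rank q < N then x q else c q - ∑ r ∈ D q, x r) =
          ∑ q ∈ D p, x q :=
        Finset.sum_congr rfl fun q hq => by
          have := hD p q hq
          rw [if_pos (by omega)]
      dsimp only
      rw [hsum]
      split_ifs with h
      · exact hx p h
      · ring
  obtain ⟨x, hx⟩ := hex (Finset.univ.sup rank + 1)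
  have hle : ∀ p, rank p < Finset.univ.sup rank + 1 := fun p =>
    Nat.lt_succ_of_le (Finset.le_sup (Finset.mem_univ p))
  refine ⟨x, fun p => hx p (hle p), fun y hy => ?_⟩
  have key : ∀ N : ℕ, ∀ p, rank p = N → y p = x p := by
    intro N
    induction N using Nat.strong_induction_on with
    | _ N ih =>
      intro p hp
      have h1 := hy p
      rw [← hx p (hle p), Finset.sum_congr rfl fun q hq =>
        ih (rank q) (by have := hD p q hq; omega) q rfl] at h1
      exact add_right_cancel h1
  funext p
  exact key _ p rfl

end Triangular

end FFLV

/-! ### Paths, their bounds, and P_λ as a finite system of inequalities. -/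

namespace FFLV

/-- The extension of a point of the type C space by zero. -/
noncomputable def coord {n : ℕ} (x : pairsC n → ℝ) (p : ℕ × ℕ) : ℝ :=
  if h : p ∈ pairsC n then x ⟨p, h⟩ else 0

@[simp] theorem coord_coe {n : ℕ} (x : pairsC n → ℝ) (p : pairsC n) : coord x p.1 = x p := by
  simp [coord]

theorem coord_of_mem {n : ℕ} (x : pairsC n → ℝ) {p : ℕ × ℕ} (hp : p ∈ pairsC n) :
    coord x p = x ⟨p, hp⟩ := by
  simp [coord, hp]

theorem coord_of_notMem {n : ℕ} (x : pairsC n → ℝ) {p : ℕ × ℕ} (hp : p ∉ pairsC n) :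
    coord x p = 0 := by
  simp [coord, hp]

theorem coord_nonneg {n : ℕ} {x : pairsC n → ℝ} (hx : ∀ p, 0 ≤ x p) (p : ℕ × ℕ) :
    0 ≤ coord x p := by
  unfold coord; split_ifs with h
  · exact hx _
  · exact le_rfl

/-- The partial sums `a_j + … + a_n`. -/
noncomputable def lam (n : ℕ) (a : ℕ → ℕ) (j : ℕ) : ℝ := ∑ k ∈ Finset.Icc j n, (a k : ℝ)

/-- The sum of the coordinates of `x` along a list. -/
noncomputable def wt {n : ℕ} (x : pairsC n → ℝ) (d : List (ℕ × ℕ)) : ℝ := (d.map (coord x)).sum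

@[simp] theorem wt_nil {n : ℕ} (x : pairsC n → ℝ) : wt x [] = 0 := rfl

@[simp] theorem wt_cons {n : ℕ} (x : pairsC n → ℝ) (p : ℕ × ℕ) (d : List (ℕ × ℕ)) :
    wt x (p :: d) = coord x p + wt x d := by simp [wt]

@[simp] theorem wt_append {n : ℕ} (x : pairsC n → ℝ) (d e : List (ℕ × ℕ)) :
    wt x (d ++ e) = wt x d + wt x e := by simp [wt]

theorem wt_nonneg {n : ℕ} {x : pairsC n → ℝ} (hx : ∀ p, 0 ≤ x p) (d : List (ℕ × ℕ)) :
    0 ≤ wt x d :=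
  List.sum_nonneg (by simp only [List.mem_map]; rintro _ ⟨p, -, rfl⟩; exact coord_nonneg hx p)

/-- The bound `M(λ, d)`, expressed through the row of the first and the column of the last entry
of `d`. -/
noncomputable def pathBound (n : ℕ) (a : ℕ → ℕ) (d : List (ℕ × ℕ)) : ℝ :=
  lam n a (d.headD (0, 0)).1 - lam n a (d.getLastD (0, 0)).2

theorem lam_succ {n : ℕ} (a : ℕ → ℕ) {j : ℕ} (hj : j ≤ n) :
    lam n a j = a j + lam n a (j + 1) := by
  rw [lam, lam, ← Finset.insert_Icc_add_one_left_eq_Icc hj, Finset.sum_insert (by simp)]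

theorem lam_eq_zero {n : ℕ} (a : ℕ → ℕ) {j : ℕ} (hj : n < j) : lam n a j = 0 := by
  rw [lam, Finset.Icc_eq_empty (by omega), Finset.sum_empty]

theorem lam_sub_lam {n : ℕ} (a : ℕ → ℕ) {i j : ℕ} (hij : i ≤ j) (hj : j ≤ n + 1) :
    lam n a i - lam n a j = ∑ k ∈ Finset.Ico i j, (a k : ℝ) := by
  induction j, hij using Nat.le_induction with
  | base => simp
  | succ j hij ih =>
    rw [Finset.sum_Ico_succ_top hij, ← ih (by omega), lam_succ a (show j ≤ n by omega)]
    ring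

theorem lam_antitone (n : ℕ) (a : ℕ → ℕ) : Antitone (lam n a) := by
  intro i j hij
  exact Finset.sum_le_sum_of_subset_of_nonneg (Finset.Icc_subset_Icc_left hij)
    (fun _ _ _ => Nat.cast_nonneg _)

theorem lam_nonneg (n : ℕ) (a : ℕ → ℕ) (j : ℕ) : 0 ≤ lam n a j :=
  Finset.sum_nonneg fun _ _ => Nat.cast_nonneg _

theorem lam_lt {n : ℕ} {a : ℕ → ℕ} (hreg : ∀ i, 1 ≤ i → i ≤ n → 0 < a i) {i j : ℕ} (hi : 1 ≤ i)
    (hin : i ≤ n) (hij : i < j) : lam n a j < lam n a i := by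
  rw [lam_succ a hin]
  have h1 : (0 : ℝ) < a i := by exact_mod_cast hreg i hi hin
  have h2 := lam_antitone n a (Nat.succ_le_of_lt hij)
  linarith

/-- The relation between an earlier and a later entry of a path. -/
def Precedes (p q : ℕ × ℕ) : Prop := p.1 ≤ q.1 ∧ p.2 ≤ q.2 ∧ p.1 + p.2 < q.1 + q.2

instance : Trans Precedes Precedes Precedes :=
  ⟨fun {p q r} h h' => by unfold Precedes at *; omega⟩

theorem PathStep.precedes {p q : ℕ × ℕ} (h : PathStep p q) : Precedes p q := by
  rcases h with rfl | rfl <;> simp [Precedes]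

theorem pairwise_precedes {d : List (ℕ × ℕ)} (h : d.IsChain PathStep) : d.Pairwise Precedes :=
  List.isChain_iff_pairwise.1 (h.imp fun _ _ => PathStep.precedes)

theorem nodup_of_isChain {d : List (ℕ × ℕ)} (h : d.IsChain PathStep) : d.Nodup :=
  (pairwise_precedes h).imp fun {p q} hpq => by
    rintro rfl; exact absurd hpq.2.2 (lt_irrefl _)

theorem pathSum_eq_wt {n : ℕ} (x : pairsC n → ℝ) {d : List (ℕ × ℕ)} (hd : d.Nodup) :
    pathSum x d = wt x d := by
  rw [wt, ← List.sum_toFinset _ hd, pathSum]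
  have h1 : ∑ p : pairsC n, (if p.1 ∈ d then x p else 0) =
      ∑ p ∈ pairsC n, (if p ∈ d then coord x p else 0) := by
    rw [← Finset.sum_coe_sort (pairsC n)]
    exact Finset.sum_congr rfl fun p _ => by rw [coord_coe]
  rw [h1, ← Finset.sum_filter]
  refine Finset.sum_subset (fun p hp => by simpa using (Finset.mem_filter.1 hp).2) ?_
  intro p hp hp'
  rw [Finset.mem_filter] at hp'
  exact coord_of_notMem x fun h => hp' ⟨h, by simpa using hp⟩

/-- `s` is the list of the entries before `q` of some path through `q`. -/
structure IsPre (n : ℕ) (q : ℕ × ℕ) (s : List (ℕ × ℕ)) : Prop where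
  mem : ∀ p ∈ s ++ [q], p ∈ pairsC n
  chain : (s ++ [q]).IsChain PathStep
  top : (s.headD q).2 = (s.headD q).1 + 1

/-- `t` is the list of the entries after `q` of some path through `q`. -/
structure IsPost (n : ℕ) (q : ℕ × ℕ) (t : List (ℕ × ℕ)) : Prop where
  mem : ∀ p ∈ q :: t, p ∈ pairsC n
  chain : (q :: t).IsChain PathStep
  last : (t.getLastD q).2 = (t.getLastD q).1 + 1 ∨ (t.getLastD q).1 + (t.getLastD q).2 = 2 * n + 1

theorem headD_append_cons (s t : List (ℕ × ℕ)) (q r : ℕ × ℕ) :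
    (s ++ q :: t).headD r = s.headD q := by cases s <;> simp

theorem getLastD_append_cons (s t : List (ℕ × ℕ)) (q r : ℕ × ℕ) :
    (s ++ q :: t).getLastD r = t.getLastD q := by
  induction s generalizing r with
  | nil => exact List.getLastD_cons
  | cons b s ih => rw [List.cons_append, List.getLastD_cons, ih]

theorem head_eq_headD {d : List (ℕ × ℕ)} (hd : d ≠ []) : d.head hd = d.headD (0, 0) := by
  cases d with
  | nil => exact absurd rfl hd
  | cons b s => simp

theorem getLast_eq_getLastD' {d : List (ℕ × ℕ)} (hd : d ≠ []) :
    d.getLast hd = d.getLastD (0, 0) := by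
  cases d with
  | nil => exact absurd rfl hd
  | cons b s => rw [List.getLast_eq_getLastD, List.getLastD_cons]

theorem isDyckPathC_iff {n : ℕ} {s t : List (ℕ × ℕ)} {q : ℕ × ℕ} :
    IsDyckPathC n (s ++ q :: t) ↔ IsPre n q s ∧ IsPost n q t := by
  constructor
  · intro h
    have h1 := h.head_top
    have h2 := h.last_top_or_column
    rw [head_eq_headD, headD_append_cons] at h1
    rw [getLast_eq_getLastD', getLastD_append_cons] at h2
    have h3 := List.isChain_split.1 h.chain
    refine ⟨⟨fun p hp => h.mem_pairs p ?_, h3.1, h1⟩, ⟨fun p hp => h.mem_pairs p ?_, h3.2, h2⟩⟩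
    · simp only [List.mem_append, List.mem_cons, List.not_mem_nil, or_false] at hp ⊢; tauto
    · simp only [List.mem_append, List.mem_cons] at hp ⊢; tauto
  · rintro ⟨h, h'⟩
    refine ⟨by simp, fun p hp => ?_, List.isChain_split.2 ⟨h.chain, h'.chain⟩, ?_, ?_⟩
    · rcases List.mem_append.1 hp with hp | hp
      · exact h.mem p (by simp [hp])
      · exact h'.mem p hp
    · rw [head_eq_headD, headD_append_cons]; exact h.top
    · rw [getLast_eq_getLastD', getLastD_append_cons]; exact h'.last

theorem pathBound_append_cons (n : ℕ) (a : ℕ → ℕ) (s t : List (ℕ × ℕ)) (q : ℕ × ℕ) :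
    pathBound n a (s ++ q :: t) = lam n a (s.headD q).1 - lam n a (t.getLastD q).2 := by
  rw [pathBound, headD_append_cons, getLastD_append_cons]

namespace IsPre

variable {n : ℕ} {q q' : ℕ × ℕ} {s : List (ℕ × ℕ)}

theorem mem_self (h : IsPre n q s) : q ∈ pairsC n := h.mem q (by simp)

theorem nil (hq : q ∈ pairsC n) (h : q.2 = q.1 + 1) : IsPre n q [] :=
  ⟨by simpa using hq, by simp, h⟩

theorem snoc_iff : IsPre n q' (s ++ [q]) ↔ IsPre n q s ∧ PathStep q q' ∧ q' ∈ pairsC n := by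
  constructor
  · intro h
    have h1 := h.chain
    rw [List.append_assoc, List.singleton_append, List.isChain_append_cons_cons] at h1
    have h2 := h.top
    rw [headD_append_cons] at h2
    exact ⟨⟨fun p hp => h.mem p (List.mem_append_left _ hp), h1.1, h2⟩, h1.2.1, h.mem_self⟩
  · rintro ⟨h, h1, h2⟩
    refine ⟨fun p hp => ?_, ?_, ?_⟩
    · rcases List.mem_append.1 hp with hp | hp
      · exact h.mem p hp
      · rw [List.mem_singleton] at hp; exact hp ▸ h2
    · rw [List.append_assoc, List.singleton_append, List.isChain_append_cons_cons]
      exact ⟨h.chain, h1, by simp⟩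
    · rw [headD_append_cons]; exact h.top

theorem precedes (h : IsPre n q s) : ∀ p ∈ s, Precedes p q := fun p hp =>
  (List.pairwise_append.1 (pairwise_precedes h.chain)).2.2 p hp q (by simp)

theorem headD_le (h : IsPre n q s) : ∀ p ∈ s ++ [q], (s.headD q).1 ≤ p.1 := by
  have h1 := pairwise_precedes h.chain
  cases s with
  | nil => intro p hp; simp at hp; simp [hp]
  | cons b s =>
    intro p hp
    rw [List.cons_append] at h1 hp
    rcases List.mem_cons.1 hp with rfl | hp
    · exact le_rfl
    · exact ((List.pairwise_cons.1 h1).1 p hp).1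

theorem headD_mem (h : IsPre n q s) : s.headD q ∈ pairsC n := by
  cases s with
  | nil => exact h.mem_self
  | cons b s => exact h.mem b (by simp)

end IsPre

namespace IsPost

variable {n : ℕ} {q q' : ℕ × ℕ} {t : List (ℕ × ℕ)}

theorem mem_self (h : IsPost n q t) : q ∈ pairsC n := h.mem q (by simp)

theorem nil (hq : q ∈ pairsC n) (h : q.2 = q.1 + 1 ∨ q.1 + q.2 = 2 * n + 1) : IsPost n q [] :=
  ⟨by simpa using hq, by simp, h⟩

theorem cons_iff : IsPost n q (q' :: t) ↔ IsPost n q' t ∧ PathStep q q' ∧ q ∈ pairsC n := by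
  constructor
  · intro h
    have h1 := List.isChain_cons_cons.1 h.chain
    have h2 := h.last
    rw [List.getLastD_cons] at h2
    exact ⟨⟨fun p hp => h.mem p (List.mem_cons_of_mem _ hp), h1.2, h2⟩, h1.1, h.mem_self⟩
  · rintro ⟨h, h1, h2⟩
    refine ⟨fun p hp => ?_, List.isChain_cons_cons.2 ⟨h1, h.chain⟩, ?_⟩
    · rcases List.mem_cons.1 hp with rfl | hp
      · exact h2
      · exact h.mem p hp
    · rw [List.getLastD_cons]; exact h.last

theorem precedes (h : IsPost n q t) : ∀ p ∈ t, Precedes q p :=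
  (List.pairwise_cons.1 (pairwise_precedes h.chain)).1

theorem le_getLastD (h : IsPost n q t) : ∀ p ∈ q :: t, p.2 ≤ (t.getLastD q).2 := by
  induction t generalizing q with
  | nil => intro p hp; simp at hp; simp [hp]
  | cons b t ih =>
    intro p hp
    rw [List.getLastD_cons]
    have hb := (cons_iff.1 h).1
    rcases List.mem_cons.1 hp with rfl | hp
    · exact (h.precedes b (by simp)).2.1.trans (ih hb b (by simp))
    · exact ih hb p hp

theorem getLastD_mem (h : IsPost n q t) : t.getLastD q ∈ q :: t := by
  induction t generalizing q with
  | nil => simp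
  | cons b t ih =>
    rw [List.getLastD_cons]
    exact List.mem_cons_of_mem _ (ih (cons_iff.1 h).1)

end IsPost

theorem boundC_eq_pathBound {n : ℕ} (a : ℕ → ℕ) {d : List (ℕ × ℕ)} (hd : IsDyckPathC n d) :
    boundC n a d hd.ne_nil = pathBound n a d := by
  have h1 := hd.last_top_or_column
  have h2 : (d.head hd.ne_nil).1 ≤ (d.getLast hd.ne_nil).1 := by
    cases d with
    | nil => exact absurd rfl hd.ne_nil
    | cons b s =>
      have h := (isDyckPathC_iff (s := []).1 hd).2
      rw [List.head_cons, List.getLast_eq_getLastD]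
      rcases List.mem_cons.1 h.getLastD_mem with h3 | h3
      · rw [h3]
      · exact (h.precedes _ h3).1
  have h3 := mem_pairsC.1 (hd.mem_pairs _ (d.getLast_mem hd.ne_nil))
  rw [boundC, pathBound, ← head_eq_headD hd.ne_nil, ← getLast_eq_getLastD' hd.ne_nil]
  split_ifs with h
  · rw [h, lam_sub_lam a (by omega) (by omega)]
    rfl
  · rw [lam_eq_zero a (j := (d.getLast hd.ne_nil).2) (by omega), sub_zero, lam]

theorem mem_polytopeC {n : ℕ} {a : ℕ → ℕ} {x : pairsC n → ℝ} :
    x ∈ polytopeC n a ↔ (∀ p, 0 ≤ x p) ∧ ∀ d, IsDyckPathC n d → wt x d ≤ pathBound n a d := by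
  unfold polytopeC
  refine and_congr Iff.rfl (forall_congr' fun d => forall_congr' fun hd => ?_)
  rw [pathSum_eq_wt x (nodup_of_isChain hd.chain), boundC_eq_pathBound a hd]

theorem finite_isDyckPathC (n : ℕ) : {d | IsDyckPathC n d}.Finite := by
  refine ((List.finite_length_le (pairsC n) (pairsC n).card).image
    (List.map Subtype.val)).subset ?_
  intro d hd
  obtain ⟨d', rfl⟩ : ∃ d' : List (pairsC n), d'.map Subtype.val = d :=
    ⟨d.attachWith (· ∈ pairsC n) hd.mem_pairs, List.attachWith_map_subtype_val hd.mem_pairs⟩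
  refine ⟨d', ?_, rfl⟩
  have h : d'.Nodup := List.Nodup.of_map _ (nodup_of_isChain hd.chain)
  have := h.length_le_card
  simpa using this

instance (n : ℕ) : Finite {d // IsDyckPathC n d} := finite_isDyckPathC n

/-- The linear functionals of the inequalities defining `P_λ`: the negated coordinates and the
sums along paths. -/
noncomputable def ineq (n : ℕ) : pairsC n ⊕ {d // IsDyckPathC n d} → (pairsC n → ℝ) →ₗ[ℝ] ℝ
  | .inl p => -LinearMap.proj p
  | .inr d =>
    { toFun := fun x => wt x d.1
      map_add' := fun x y => by
        obtain ⟨d, hd⟩ := d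
        simp only [← pathSum_eq_wt _ (nodup_of_isChain hd.chain), pathSum,
          ← Finset.sum_add_distrib]
        exact Finset.sum_congr rfl fun q _ => by split_ifs <;> simp
      map_smul' := fun r x => by
        obtain ⟨d, hd⟩ := d
        simp only [← pathSum_eq_wt _ (nodup_of_isChain hd.chain), pathSum, RingHom.id_apply,
          smul_eq_mul, Finset.mul_sum]
        exact Finset.sum_congr rfl fun q _ => by split_ifs <;> simp }

/-- The right hand sides of the inequalities defining `P_λ`. -/
noncomputable def ineqBound (n : ℕ) (a : ℕ → ℕ) : pairsC n ⊕ {d // IsDyckPathC n d} → ℝ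
  | .inl _ => 0
  | .inr d => pathBound n a d.1

@[simp] theorem ineq_inl (n : ℕ) (p : pairsC n) (x : pairsC n → ℝ) :
    ineq n (.inl p) x = -x p := rfl

@[simp] theorem ineq_inr (n : ℕ) (d : {d // IsDyckPathC n d}) (x : pairsC n → ℝ) :
    ineq n (.inr d) x = wt x d.1 := rfl

theorem polytopeC_eq_polyhedron (n : ℕ) (a : ℕ → ℕ) :
    polytopeC n a = polyhedron (ineq n) (ineqBound n a) := by
  ext x
  rw [mem_polytopeC, polyhedron]
  simp [ineqBound, Sum.forall]

end FFLV

/-! ### Every defining inequality is a facet. -/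

namespace FFLV

/-- Pushing w slightly along z makes the other tight inequalities strict; half of an admissible step
also keeps the inequalities strict that were strict at w. -/
theorem exists_facet_point {ι K : Type*} [Finite K] {g : K → (ι → ℝ) →ₗ[ℝ] ℝ} {c : K → ℝ}
    {w z : ι → ℝ} {k₀ : K} (hw : w ∈ polyhedron g c) (hk₀ : g k₀ w = c k₀) (hz₀ : g k₀ z = 0)
    (hz : ∀ k, k ≠ k₀ → g k w = c k → g k z < 0) :
    ∃ w, g k₀ w = c k₀ ∧ ∀ k, k ≠ k₀ → g k w < c k := by
  obtain ⟨ε, hε, h⟩ := exists_add_smul_mem_polyhedron (y := z) hw (fun k hk => by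
    by_cases hkk : k = k₀
    · rw [hkk, hz₀]
    · exact (hz k hkk hk).le)
  refine ⟨w + (ε / 2) • z, by simp [hk₀, hz₀], fun k hk => ?_⟩
  have h1 := h k
  rw [map_add, map_smul, smul_eq_mul] at h1 ⊢
  rcases (hw k).eq_or_lt with h2 | h2
  · have := mul_neg_of_pos_of_neg (half_pos hε) (hz k hk h2)
    linarith
  · linarith

theorem exists_crossing {α : Type*} {R : α → α → Prop} (f : α → ℕ) {m : ℕ} {b : α} {d : List α}
    (hd : (b :: d).IsChain R) (hb : f b ≤ m) (hl : m < f (d.getLastD b)) :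
    ∃ p ∈ b :: d, ∃ q ∈ b :: d, R p q ∧ f p ≤ m ∧ m < f q := by
  induction d generalizing b with
  | nil => exact absurd hl (by simpa using hb)
  | cons b' d ih =>
    rw [List.getLastD_cons] at hl
    have h := List.isChain_cons_cons.1 hd
    rcases le_or_gt (f b') m with h1 | h1
    · obtain ⟨p, hp, q, hq, h2⟩ := ih h.2 h1 hl
      exact ⟨p, List.mem_cons_of_mem _ hp, q, List.mem_cons_of_mem _ hq, h2⟩
    · exact ⟨b, by simp, b', by simp, h.1, hb, h1⟩

/-- Each step raises i + j by exactly one, so a path contains at most one entry with given i + j,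
and an entry of d in e must occur at the same position. -/
theorem eq_of_subset_of_isChain {b : ℕ × ℕ} {d e : List (ℕ × ℕ)} (hd : (b :: d).IsChain PathStep)
    (he : (b :: e).IsChain PathStep) (hsub : ∀ p ∈ d, p ∈ e)
    (hl : d.getLastD b = e.getLastD b) : d = e := by
  induction d generalizing b e with
  | nil =>
    cases e with
    | nil => rfl
    | cons c e =>
      exfalso
      have h1 : (c :: e).getLastD b ∈ c :: e := by
        rw [List.getLastD_cons, ← List.getLast_eq_getLastD (by simp)]; exact List.getLast_mem _
      have := (List.pairwise_cons.1 (pairwise_precedes he)).1 _ h1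
      rw [← hl] at this
      exact absurd this.2.2 (lt_irrefl _)
  | cons c d ih =>
    have hc := hsub c (by simp)
    cases e with
    | nil => simp at hc
    | cons c' e =>
      have h1 := List.isChain_cons_cons.1 hd
      have h2 := List.isChain_cons_cons.1 he
      have hcc : c = c' := by
        rcases List.mem_cons.1 hc with h | h
        · exact h
        · have h3 := (List.pairwise_cons.1 (pairwise_precedes h2.2)).1 c h
          have h4 := h2.1.precedes
          have h5 := h1.1
          unfold Precedes at h3 h4
          unfold PathStep at h5
          rcases h5 with h5 | h5 <;> rw [h5] at h3 <;> simp only at h3 <;> omega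
      subst hcc
      rw [List.getLastD_cons, List.getLastD_cons] at hl
      rw [ih h1.2 h2.2 (fun p hp => ?_) hl]
      rcases List.mem_cons.1 (hsub p (List.mem_cons_of_mem _ hp)) with h | h
      · subst h
        exact absurd ((List.pairwise_cons.1 (pairwise_precedes h1.2)).1 _ hp).2.2 (lt_irrefl _)
      · exact h

namespace IsDyckPathC

variable {n : ℕ} {d e : List (ℕ × ℕ)}

/-- The row in which a path starts. -/
def _root_.FFLV.source (d : List (ℕ × ℕ)) : ℕ := (d.headD (0, 0)).1

/-- The column in which a path ends. -/
def _root_.FFLV.sink (d : List (ℕ × ℕ)) : ℕ := (d.getLastD (0, 0)).2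

theorem exists_eq_cons (hd : IsDyckPathC n d) : ∃ b t, d = b :: t ∧ b.2 = b.1 + 1 ∧
    IsPost n b t := by
  cases d with
  | nil => exact absurd rfl hd.ne_nil
  | cons b t =>
    have h := (isDyckPathC_iff (s := []).1 hd)
    exact ⟨b, t, rfl, h.1.top, h.2⟩

theorem source_le (hd : IsDyckPathC n d) {p : ℕ × ℕ} (hp : p ∈ d) : source d ≤ p.1 := by
  obtain ⟨b, t, rfl, h, h'⟩ := hd.exists_eq_cons
  rw [source, List.headD_cons]
  rcases List.mem_cons.1 hp with rfl | hp
  · exact le_rfl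
  · exact (h'.precedes p hp).1

theorem le_sink (hd : IsDyckPathC n d) {p : ℕ × ℕ} (hp : p ∈ d) : p.2 ≤ sink d := by
  obtain ⟨b, t, rfl, h, h'⟩ := hd.exists_eq_cons
  rw [sink, List.getLastD_cons]
  exact h'.le_getLastD p hp

theorem source_pos (hd : IsDyckPathC n d) : 1 ≤ source d := by
  obtain ⟨b, t, rfl, h, h'⟩ := hd.exists_eq_cons
  exact (mem_pairsC.1 h'.mem_self).1

theorem source_le_n (hd : IsDyckPathC n d) : source d ≤ n := by
  obtain ⟨b, t, rfl, h, h'⟩ := hd.exists_eq_cons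
  have := mem_pairsC.1 h'.mem_self
  simp only [source, List.headD_cons]; omega

theorem source_lt_sink (hd : IsDyckPathC n d) : source d < sink d := by
  obtain ⟨b, t, rfl, h, h'⟩ := hd.exists_eq_cons
  have := hd.le_sink (p := b) (by simp)
  simp only [source, List.headD_cons]; omega

theorem exists_mem_column (hd : IsDyckPathC n d) {m : ℕ} (h1 : source d < m) (h2 : m < sink d) :
    ∃ q ∈ d, q.2 = m + 1 ∧ q.1 < m := by
  obtain ⟨b, t, rfl, h, h'⟩ := hd.exists_eq_cons
  rw [sink, List.getLastD_cons] at h2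
  rw [source, List.headD_cons] at h1
  obtain ⟨p, hp, q, hq, h3, h4, h5⟩ := exists_crossing Prod.snd h'.chain (by omega) h2
  have h6 := mem_pairsC.1 (hd.mem_pairs p hp)
  rcases h3 with rfl | rfl
  · simp only at h5; omega
  · simp only at h5
    exact ⟨_, hq, by simp only; omega, by simp only; omega⟩

theorem exists_mem_source_row (hd : IsDyckPathC n d) : (source d, source d + 1) ∈ d := by
  obtain ⟨b, t, rfl, h, h'⟩ := hd.exists_eq_cons
  rw [source, List.headD_cons, ← h]
  simp

theorem exists_mem_spanning (hd : IsDyckPathC n d) {m : ℕ} (h1 : source d ≤ m) (h2 : m < sink d) :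
    ∃ q ∈ d, q.1 ≤ m ∧ m < q.2 := by
  rcases h1.eq_or_lt with h | h
  · exact ⟨_, hd.exists_mem_source_row, h.le, by simp only; omega⟩
  · obtain ⟨q, hq, h3, h4⟩ := hd.exists_mem_column h h2
    exact ⟨q, hq, h4.le, by omega⟩

/-- This splits the bound into contributions of the unit gaps [m, m+1] with m ≤ n, which is what
allows a comparison with `facetPoint` gap by gap. -/
theorem pathBound_eq_sum (hd : IsDyckPathC n d) (a : ℕ → ℕ) : pathBound n a d =
    ∑ m ∈ Finset.Icc 1 n, if source d ≤ m ∧ m < sink d then (a m : ℝ) else 0 := by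
  have hlam : ∀ i, 1 ≤ i → lam n a i = ∑ m ∈ Finset.Icc 1 n, if i ≤ m then (a m : ℝ) else 0 := by
    intro i hi
    rw [← Finset.sum_filter, lam]
    refine Finset.sum_congr ?_ fun _ _ => rfl
    ext m; simp only [Finset.mem_Icc, Finset.mem_filter]; omega
  have h := hd.source_lt_sink
  have h' := hd.source_pos
  change lam n a (source d) - lam n a (sink d) = _
  rw [hlam _ h', hlam _ (by omega), ← Finset.sum_sub_distrib]
  refine Finset.sum_congr rfl fun m _ => ?_
  have h3 : m < sink d ↔ ¬ sink d ≤ m := not_le.symm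
  simp only [h3]
  by_cases h1 : source d ≤ m <;> by_cases h2 : sink d ≤ m
  · simp [h1, h2]
  · simp [h1, h2]
  · omega
  · simp [h1, h2]

/-- The last entry of a path. -/
theorem getLastD_spec (hd : IsDyckPathC n d) : d.getLastD (0, 0) ∈ d ∧
    ((d.getLastD (0, 0)).2 = (d.getLastD (0, 0)).1 + 1 ∨
      (d.getLastD (0, 0)).1 + (d.getLastD (0, 0)).2 = 2 * n + 1) := by
  obtain ⟨b, t, rfl, h, h'⟩ := hd.exists_eq_cons
  rw [List.getLastD_cons]
  exact ⟨h'.getLastD_mem, h'.last⟩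

/-- A path that spans the same gaps as another one through common entries only is equal to it. -/
theorem eq_of_spanning_subset (hd : IsDyckPathC n d) (he : IsDyckPathC n e)
    (h : ∀ m, source e ≤ m → m < sink e → m ≤ n → (∃ q ∈ d, q.1 ≤ m ∧ m < q.2) ∧
      ∀ q ∈ d, q.1 ≤ m → m < q.2 → q ∈ e) : d = e := by
  have e1 := he.source_lt_sink
  have e2 := he.source_le_n
  have hsrc : source d = source e := by
    obtain ⟨⟨q, hq, h1, h2⟩, h3⟩ := h _ le_rfl e1 e2
    have h4 := hd.source_le hq
    have h5 := hd.le_sink hq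
    by_contra hne
    obtain ⟨r, hr, h6, h7⟩ := hd.exists_mem_column (m := source e) (by omega) (by omega)
    have := he.source_le (h3 r hr h7.le (by omega))
    omega
  -- Gaps beyond n carry no weight, so the final column is seen by the gaps only if it is at most n.
  -- For paths ending on i + j = 2n+1 the end is recovered below from the inclusion d ⊆ e.
  have hsink : sink e ≤ n → sink d = sink e := by
    intro hn
    obtain ⟨⟨q, hq, h1, h2⟩, -⟩ := h (sink e - 1) (by omega) (by omega) (by omega)
    have h5 := hd.le_sink hq
    by_contra hne
    obtain ⟨r, hr, h6, h7⟩ := hd.exists_mem_column (m := sink e) (by omega) (by omega)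
    have := he.le_sink ((h (sink e - 1) (by omega) (by omega) (by omega)).2 r hr (by omega)
      (by omega))
    omega
  have hsub : ∀ q ∈ d, q ∈ e := by
    intro q hq
    have h1 := mem_pairsC.1 (hd.mem_pairs q hq)
    have h2 := hd.source_le hq
    have h3 := hd.le_sink hq
    rcases le_or_gt (sink e) n with hn | hn
    · exact (h q.1 (by omega) (by have := hsink hn; omega) (by omega)).2 q hq le_rfl h1.2.1
    · exact (h q.1 (by omega) (by omega) (by omega)).2 q hq le_rfl h1.2.1
  obtain ⟨h1, h2⟩ := hd.getLastD_spec
  have h3 := hsub _ h1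
  have h4 := mem_pairsC.1 (hd.mem_pairs _ h1)
  have hlast : d.getLastD (0, 0) = e.getLastD (0, 0) := by
    obtain ⟨s, t, hst⟩ := List.append_of_mem h3
    cases t with
    | nil => rw [hst, getLastD_append_cons]; simp
    | cons r t =>
      exfalso
      rw [hst] at he
      have h5 := (isDyckPathC_iff.1 he).2
      have h6 := (IsPost.cons_iff.1 h5).2.1
      have h7 := mem_pairsC.1 (h5.mem r (by simp))
      have h8 := he.le_sink (p := r) (by simp)
      rw [← hst] at h8
      rcases le_or_gt (sink e) n with hn | hn
      · have h9 : (d.getLastD (0, 0)).2 = sink e := hsink hn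
        rcases h6 with rfl | rfl <;> simp only at h7 h8 <;> omega
      · obtain ⟨⟨q, hq, h9, h10⟩, -⟩ := h n e2 hn le_rfl
        have h11 := hd.le_sink hq
        unfold sink at h11
        rcases h6 with rfl | rfl <;> simp only at h7 <;> omega
  obtain ⟨b, t, rfl, hb, hbt⟩ := hd.exists_eq_cons
  obtain ⟨b', t', rfl, hb', hbt'⟩ := he.exists_eq_cons
  have hbb : b = b' := by
    simp only [source, List.headD_cons] at hsrc
    exact Prod.ext hsrc (by omega)
  subst hbb
  rw [List.getLastD_cons, List.getLastD_cons] at hlast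
  rw [eq_of_subset_of_isChain hbt.chain hbt'.chain (fun p hp => ?_) hlast]
  rcases List.mem_cons.1 (hsub p (List.mem_cons_of_mem _ hp)) with h | h
  · subst h
    exact absurd (hbt.precedes _ hp).2.2 (lt_irrefl _)
  · exact h

end IsDyckPathC

theorem pathBound_pos {n : ℕ} {a : ℕ → ℕ} (hreg : ∀ i, 1 ≤ i → i ≤ n → 0 < a i)
    {d : List (ℕ × ℕ)} (hd : IsDyckPathC n d) : 0 < pathBound n a d :=
  sub_pos.2 (lam_lt hreg hd.source_pos hd.source_le_n hd.source_lt_sink)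

/-- The entries of a path whose segments contain `[m, m + 1]`. -/
def spanning (d : List (ℕ × ℕ)) (m : ℕ) : Finset (ℕ × ℕ) :=
  d.toFinset.filter (fun q => q.1 ≤ m ∧ m < q.2)

theorem mem_spanning {d : List (ℕ × ℕ)} {m : ℕ} {q : ℕ × ℕ} :
    q ∈ spanning d m ↔ q ∈ d ∧ q.1 ≤ m ∧ m < q.2 := by simp [spanning]

/-- A point in the facet of `P_λ` defined by the path `d`: each `a m` is distributed evenly among
the entries of `d` whose segments contain `[m, m + 1]`. -/
noncomputable def facetPoint (n : ℕ) (a : ℕ → ℕ) (d : List (ℕ × ℕ)) (p : pairsC n) : ℝ :=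
  ∑ m ∈ Finset.Icc 1 n, if p.1 ∈ spanning d m then (a m : ℝ) / (spanning d m).card else 0

theorem facetPoint_nonneg (n : ℕ) (a : ℕ → ℕ) (d : List (ℕ × ℕ)) (p : pairsC n) :
    0 ≤ facetPoint n a d p :=
  Finset.sum_nonneg fun m _ => by split_ifs <;> positivity

theorem facetPoint_pos {n : ℕ} {a : ℕ → ℕ} (hreg : ∀ i, 1 ≤ i → i ≤ n → 0 < a i)
    {d : List (ℕ × ℕ)} {p : pairsC n} (hp : p.1 ∈ d) : 0 < facetPoint n a d p := by
  have h := mem_pairsC.1 p.2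
  have hmem : p.1 ∈ spanning d p.1.1 := mem_spanning.2 ⟨hp, le_rfl, h.2.1⟩
  refine Finset.sum_pos' (fun m _ => by split_ifs <;> positivity)
    ⟨p.1.1, Finset.mem_Icc.2 ⟨h.1, by omega⟩, ?_⟩
  rw [if_pos hmem]
  have h1 : (0 : ℝ) < a p.1.1 := by exact_mod_cast hreg _ h.1 (by omega)
  have h2 : (0 : ℝ) < (spanning d p.1.1).card := by exact_mod_cast Finset.card_pos.2 ⟨_, hmem⟩
  positivity

theorem wt_facetPoint {n : ℕ} {a : ℕ → ℕ} {d e : List (ℕ × ℕ)} (he : IsDyckPathC n e) :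
    wt (facetPoint n a d) e = ∑ m ∈ Finset.Icc 1 n,
      ((spanning e m ∩ spanning d m).card : ℝ) * ((a m : ℝ) / (spanning d m).card) := by
  rw [wt, ← List.sum_toFinset _ (nodup_of_isChain he.chain)]
  have h1 : ∀ q ∈ e.toFinset, coord (facetPoint n a d) q = ∑ m ∈ Finset.Icc 1 n,
      if q ∈ spanning d m then (a m : ℝ) / (spanning d m).card else 0 := by
    intro q hq
    rw [coord_of_mem _ (he.mem_pairs q (by simpa using hq))]
    rfl
  rw [Finset.sum_congr rfl h1, Finset.sum_comm]
  refine Finset.sum_congr rfl fun m _ => ?_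
  rw [← Finset.sum_filter, Finset.sum_const, nsmul_eq_mul]
  congr 3
  ext q
  simp only [Finset.mem_filter, Finset.mem_inter, mem_spanning, List.mem_toFinset]
  tauto

/-- For a coordinate, the origin works after a push, since all path bounds are positive. For a path
d, start from `facetPoint`: along a path e it collects at most a_m for each gap m that e spans, with
equality throughout only if e contains all entries of d over these gaps, which forces e = d. -/
theorem exists_facet_point_ineq {n : ℕ} {a : ℕ → ℕ} (hreg : ∀ i, 1 ≤ i → i ≤ n → 0 < a i)
    (k₀ : pairsC n ⊕ {d // IsDyckPathC n d}) :
    ∃ w, ineq n k₀ w = ineqBound n a k₀ ∧ ∀ k, k ≠ k₀ → ineq n k w < ineqBound n a k := by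
  classical
  rcases k₀ with p | ⟨d, hd⟩
  · refine exists_facet_point (w := 0) (z := fun q => if q = p then 0 else 1) ?_
      (by simp [ineqBound]) (by simp) ?_
    · rintro (q | e)
      · simp [ineqBound]
      · rw [map_zero]; exact (pathBound_pos hreg e.2).le
    · rintro (q | e) hk h
      · have : q ≠ p := fun h => hk (by rw [h])
        simp [this]
      · rw [map_zero] at h
        exact absurd h (pathBound_pos hreg e.2).ne
  · have hterm : ∀ e, IsDyckPathC n e → ∀ m ∈ Finset.Icc 1 n,
        ((spanning e m ∩ spanning d m).card : ℝ) * ((a m : ℝ) / (spanning d m).card) ≤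
          if source e ≤ m ∧ m < sink e then (a m : ℝ) else 0 := by
      intro e he m _
      split_ifs with h
      · have h1 : ((spanning e m ∩ spanning d m).card : ℝ) ≤ (spanning d m).card := by
          exact_mod_cast Finset.card_le_card Finset.inter_subset_right
        rw [mul_div_assoc', mul_comm, mul_div_assoc]
        exact mul_le_of_le_one_right (Nat.cast_nonneg _) (div_le_one_of_le₀ h1 (Nat.cast_nonneg _))
      · have : spanning e m = ∅ := by
          refine Finset.eq_empty_of_forall_notMem fun q hq => h ?_
          rw [mem_spanning] at hq
          have := he.source_le hq.1
          have := he.le_sink hq.1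
          omega
        simp [this]
    have hmem : facetPoint n a d ∈ polyhedron (ineq n) (ineqBound n a) := by
      rw [← polytopeC_eq_polyhedron, mem_polytopeC]
      refine ⟨facetPoint_nonneg n a d, fun e he => ?_⟩
      rw [wt_facetPoint he, he.pathBound_eq_sum]
      exact Finset.sum_le_sum (hterm e he)
    -- Raising the coordinates off d leaves the sum along d unchanged and makes all coordinate
    -- inequalities strict.
    refine exists_facet_point (z := fun q => if q.1 ∈ d then 0 else 1) hmem ?_ ?_ ?_
    · rw [ineq_inr, ineqBound, wt_facetPoint hd, hd.pathBound_eq_sum]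
      refine Finset.sum_congr rfl fun m _ => ?_
      rw [Finset.inter_self]
      split_ifs with h
      · obtain ⟨q, hq, hq'⟩ := hd.exists_mem_spanning h.1 h.2
        have : (0 : ℝ) < (spanning d m).card := by
          exact_mod_cast Finset.card_pos.2 ⟨q, mem_spanning.2 ⟨hq, hq'⟩⟩
        field_simp
      · have : spanning d m = ∅ := by
          refine Finset.eq_empty_of_forall_notMem fun q hq => h ?_
          rw [mem_spanning] at hq
          have := hd.source_le hq.1
          have := hd.le_sink hq.1
          omega
        simp [this]
    · rw [ineq_inr, wt]
      refine List.sum_eq_zero fun r hr => ?_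
      obtain ⟨q, hq, rfl⟩ := List.mem_map.1 hr
      rw [coord_of_mem _ (hd.mem_pairs q hq)]
      simp [hq]
    · rintro (q | ⟨e, he⟩) hk h
      · have : q.1 ∉ d := fun hq => by
          have := facetPoint_pos hreg hq
          rw [ineq_inl, ineqBound] at h
          linarith
        simp [this]
      · exfalso
        refine hk (congrArg Sum.inr (Subtype.ext (hd.eq_of_spanning_subset he ?_).symm))
        intro m h1 h2 h3
        rw [ineq_inr, ineqBound, wt_facetPoint he, he.pathBound_eq_sum] at h
        have h4 := he.source_pos
        have h5 := (Finset.sum_eq_sum_iff_of_le (hterm e he)).1 h m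
          (Finset.mem_Icc.2 ⟨by omega, h3⟩)
        rw [if_pos ⟨h1, h2⟩] at h5
        have ha : (0 : ℝ) < a m := by exact_mod_cast hreg m (by omega) h3
        have hN : (spanning d m).card ≠ 0 := by
          intro h0
          rw [h0] at h5
          simp at h5
          linarith
        have hN' : (0 : ℝ) < (spanning d m).card := by exact_mod_cast Nat.pos_of_ne_zero hN
        have h6 : ((spanning e m ∩ spanning d m).card : ℝ) = (spanning d m).card := by
          field_simp at h5
          nlinarith
        have h7 : spanning e m ∩ spanning d m = spanning d m :=
          Finset.eq_of_subset_of_card_le Finset.inter_subset_right (by exact_mod_cast h6.ge)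
        constructor
        · obtain ⟨q, hq⟩ := Finset.card_pos.1 (Nat.pos_of_ne_zero hN)
          exact ⟨q, mem_spanning.1 hq⟩
        · intro q hq hq1 hq2
          have : q ∈ spanning e m ∩ spanning d m := by
            rw [h7, mem_spanning]; exact ⟨hq, hq1, hq2⟩
          exact (mem_spanning.1 (Finset.mem_inter.1 this).1).1

end FFLV

/-! ### Hooks, admissible supports and hook points. -/

namespace FFLV

/-- The type C path `(i, i+1), …, (i, j), (i+1, j), …`, continued along the column `j` for as long
as possible. -/
def hookC (n i j : ℕ) : List (ℕ × ℕ) :=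
  (List.range' (i + 1) (j - i)).map (fun l => (i, l)) ++
    (List.range' (i + 1) (min (j - 1) (2 * n + 1 - j) - i)).map (fun k => (k, j))

theorem mem_hookC {n i j : ℕ} {q : ℕ × ℕ} :
    q ∈ hookC n i j ↔ (q.1 = i ∧ i < q.2 ∧ q.2 ≤ j) ∨
      (q.2 = j ∧ i < q.1 ∧ q.1 < j ∧ q.1 + j ≤ 2 * n + 1) := by
  obtain ⟨k, l⟩ := q
  simp only [hookC, List.mem_append, List.mem_map, List.mem_range'_1, Prod.mk.injEq]
  constructor
  · rintro (⟨c, hc, h1, h2⟩ | ⟨c, hc, h1, h2⟩)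
    · left; omega
    · right; omega
  · rintro (h | h)
    · exact Or.inl ⟨l, by omega, by omega, rfl⟩
    · exact Or.inr ⟨k, by omega, rfl, by omega⟩

theorem self_mem_hookC {n : ℕ} {p : ℕ × ℕ} (hp : p ∈ pairsC n) : p ∈ hookC n p.1 p.2 := by
  have := mem_pairsC.1 hp
  exact mem_hookC.2 (Or.inl ⟨rfl, this.2.1, le_rfl⟩)

theorem isChain_hookC {n i j : ℕ} : (hookC n i j).IsChain PathStep := by
  rw [hookC, List.isChain_append]
  refine ⟨?_, ?_, ?_⟩
  · rw [List.isChain_map]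
    exact (List.isChain_range' _ _ _).imp fun a b h => Or.inr (by rw [h])
  · rw [List.isChain_map]
    exact (List.isChain_range' _ _ _).imp fun a b h => Or.inl (by rw [h])
  · intro x hx y hy
    rw [List.head?_map, List.head?_range'] at hy
    rw [List.getLast?_map, List.getLast?_range'] at hx
    split_ifs at hx hy with h1 h2
    · simp at hx
    · simp at hx
    · simp at hy
    · simp only [Option.map_some, Option.mem_def, Option.some.injEq] at hx hy
      subst hx; subst hy
      left
      simp only [Prod.mk.injEq, true_and]
      omega

theorem headD_hookC {n i j : ℕ} (hij : i < j) : (hookC n i j).headD (0, 0) = (i, i + 1) := by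
  obtain ⟨m, hm⟩ : ∃ m, j - i = m + 1 := ⟨j - i - 1, by omega⟩
  rw [hookC, hm, List.range'_succ]
  simp

theorem getLastD_hookC {n i j : ℕ} (hij : i < j) (hj : i + j ≤ 2 * n + 1) :
    (hookC n i j).getLastD (0, 0) = (min (j - 1) (2 * n + 1 - j), j) := by
  rcases Nat.eq_zero_or_pos (min (j - 1) (2 * n + 1 - j) - i) with h | h
  · obtain ⟨m, hm⟩ : ∃ m, j - i = m + 1 := ⟨j - i - 1, by omega⟩
    rw [hookC, h, hm, List.range'_concat]
    simp only [List.map_append, List.map_cons, List.map_nil, List.range'_zero, List.append_nil,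
      getLastD_append_cons, List.getLastD_nil, Prod.mk.injEq]
    omega
  · obtain ⟨m, hm⟩ : ∃ m, min (j - 1) (2 * n + 1 - j) - i = m + 1 :=
      ⟨min (j - 1) (2 * n + 1 - j) - i - 1, by omega⟩
    rw [hookC, hm, List.range'_concat]
    simp only [List.map_append, List.map_cons, List.map_nil, ← List.append_assoc,
      getLastD_append_cons, List.getLastD_nil, Prod.mk.injEq, and_true]
    omega

theorem isDyckPathC_hookC {n : ℕ} {p : ℕ × ℕ} (hp : p ∈ pairsC n) :
    IsDyckPathC n (hookC n p.1 p.2) := by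
  have h := mem_pairsC.1 hp
  have hne : hookC n p.1 p.2 ≠ [] := List.ne_nil_of_mem (self_mem_hookC hp)
  refine ⟨hne, fun q hq => ?_, isChain_hookC, ?_, ?_⟩
  · rw [mem_pairsC]; rw [mem_hookC] at hq; omega
  · rw [head_eq_headD, headD_hookC h.2.1]
  · rw [getLast_eq_getLastD', getLastD_hookC h.2.1 h.2.2]
    simp only; omega

theorem source_hookC {n : ℕ} {p : ℕ × ℕ} (hp : p ∈ pairsC n) :
    source (hookC n p.1 p.2) = p.1 := by
  rw [source, headD_hookC (mem_pairsC.1 hp).2.1]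

theorem sink_hookC {n : ℕ} {p : ℕ × ℕ} (hp : p ∈ pairsC n) :
    sink (hookC n p.1 p.2) = p.2 := by
  rw [sink, getLastD_hookC (mem_pairsC.1 hp).2.1 (mem_pairsC.1 hp).2.2]

theorem pathBound_hookC {n : ℕ} (a : ℕ → ℕ) {p : ℕ × ℕ} (hp : p ∈ pairsC n) :
    pathBound n a (hookC n p.1 p.2) = lam n a p.1 - lam n a p.2 := by
  change lam n a (source _) - lam n a (sink _) = _
  rw [source_hookC hp, sink_hookC hp]

theorem IsDyckPathC.trichotomy {n : ℕ} {d : List (ℕ × ℕ)} (hd : IsDyckPathC n d) {p q : ℕ × ℕ}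
    (hp : p ∈ d) (hq : q ∈ d) : p = q ∨ Precedes p q ∨ Precedes q p := by
  obtain ⟨s, t, rfl⟩ := List.append_of_mem hp
  obtain ⟨h1, h2⟩ := isDyckPathC_iff.1 hd
  rcases List.mem_append.1 hq with h | h
  · exact Or.inr (Or.inr (h1.precedes q h))
  · rcases List.mem_cons.1 h with h | h
    · exact Or.inl h.symm
    · exact Or.inr (Or.inl (h2.precedes q h))

/-- Any two entries of a path are comparable. Entries comparable with the pair of first row and last
column, inside that range of rows and columns, lie in that row or that column. -/
theorem IsDyckPathC.eq_hookC {n : ℕ} {d : List (ℕ × ℕ)} (hd : IsDyckPathC n d)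
    (h : (source d, sink d) ∈ d) : d = hookC n (source d) (sink d) := by
  have hp := hd.mem_pairs _ h
  have hsub : ∀ q ∈ d, q ∈ hookC n (source d) (sink d) := by
    intro q hq
    have h1 := hd.source_le hq
    have h2 := hd.le_sink hq
    have h3 := mem_pairsC.1 (hd.mem_pairs q hq)
    rw [mem_hookC]
    rcases hd.trichotomy h hq with h4 | h4 | h4
    · subst h4; exact Or.inl ⟨rfl, h3.2.1, le_rfl⟩
    · obtain ⟨h5, h6, h7⟩ := h4
      simp only at h5 h6 h7; omega
    · obtain ⟨h5, h6, h7⟩ := h4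
      simp only at h5 h6 h7; omega
  refine hd.eq_of_spanning_subset (isDyckPathC_hookC hp) fun m h1 h2 _ => ?_
  have e1 := source_hookC hp
  have e2 := sink_hookC hp
  simp only at e1 e2
  rw [e1] at h1
  rw [e2] at h2
  exact ⟨hd.exists_mem_spanning h1 h2, fun q hq _ _ => hsub q hq⟩

/-- The sum of the entries `x_{i,l}` with `l ≤ j`. -/
noncomputable def rowSum {n : ℕ} (x : pairsC n → ℝ) (i j : ℕ) : ℝ :=
  ∑ l ∈ Finset.Ioc i j, coord x (i, l)

/-- The sum of the entries `x_{k,j}` with `i < k`. -/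
noncomputable def colSum {n : ℕ} (x : pairsC n → ℝ) (i j : ℕ) : ℝ :=
  ∑ k ∈ Finset.Ioo i j, coord x (k, j)

theorem wt_hookC {n : ℕ} (x : pairsC n → ℝ) (i j : ℕ) :
    wt x (hookC n i j) = rowSum x i j + colSum x i j := by
  rw [wt, ← List.sum_toFinset _ (nodup_of_isChain isChain_hookC), hookC, List.toFinset_append,
    Finset.sum_union, rowSum, colSum]
  · congr 1
    · refine (Finset.sum_bij (fun l _ => (i, l)) ?_ ?_ ?_ ?_).symm
      · intro l hl
        simp only [List.mem_toFinset, List.mem_map, List.mem_range'_1, Finset.mem_Ioc] at hl ⊢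
        exact ⟨l, by omega, rfl⟩
      · intro _ _ _ _ h; simpa using h
      · intro q hq
        simp only [List.mem_toFinset, List.mem_map, List.mem_range'_1] at hq
        obtain ⟨l, hl, rfl⟩ := hq
        exact ⟨l, by rw [Finset.mem_Ioc]; omega, rfl⟩
      · intro _ _; rfl
    · refine (Finset.sum_bij_ne_zero (fun k _ _ => (k, j)) ?_ ?_ ?_ ?_).symm
      · intro k hk h0
        have h : (k, j) ∈ pairsC n := by
          by_contra hc; exact h0 (coord_of_notMem x hc)
        rw [mem_pairsC] at h
        simp only [List.mem_toFinset, List.mem_map, List.mem_range'_1, Finset.mem_Ioo] at hk h ⊢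
        exact ⟨k, by omega, rfl⟩
      · intro _ _ _ _ _ _ h; simpa using h
      · intro q hq h0
        simp only [List.mem_toFinset, List.mem_map, List.mem_range'_1] at hq
        obtain ⟨k, hk, rfl⟩ := hq
        exact ⟨k, by rw [Finset.mem_Ioo]; omega, h0, rfl⟩
      · intro _ _ _; rfl
  · rw [Finset.disjoint_left]
    intro q hq hq'
    simp only [List.mem_toFinset, List.mem_map, List.mem_range'_1] at hq hq'
    obtain ⟨l, hl, rfl⟩ := hq
    obtain ⟨k, hk, h⟩ := hq'
    rw [Prod.mk.injEq] at h
    omega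

/-- The supports of the simple vertices of `P_λ`. -/
structure IsAdmissible (n : ℕ) (F : Finset (ℕ × ℕ)) : Prop where
  subset : F ⊆ pairsC n
  nested : ∀ p ∈ F, ∀ r ∈ F, p.1 < r.1 → r.1 ≤ p.2 → r.2 ≤ p.2
  diagonal : ∀ p ∈ F, n < p.2 → (2 * n + 1 - p.2, p.2) ∈ F

/-- The point `x` is supported on `F` and the inequalities of the hooks with corners in `F` are
tight at `x`. -/
structure IsHookPoint (n : ℕ) (a : ℕ → ℕ) (F : Finset (ℕ × ℕ)) (x : pairsC n → ℝ) : Prop where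
  zero : ∀ p, p ∉ F → coord x p = 0
  hook : ∀ p ∈ F, rowSum x p.1 p.2 + colSum x p.1 p.2 = lam n a p.1 - lam n a p.2

/-- The entries of the hook with corner `p`, apart from `p`, if `p ∈ F`. -/
def hookRest (n : ℕ) (F : Finset (ℕ × ℕ)) (p : pairsC n) : Finset (pairsC n) :=
  if p.1 ∈ F then Finset.univ.filter (fun q => q.1 ∈ hookC n p.1.1 p.1.2 ∧ q ≠ p) else ∅

theorem rank_lt_of_mem_hookRest {n : ℕ} (F : Finset (ℕ × ℕ)) (p q : pairsC n)
    (hq : q ∈ hookRest n F p) : q.1.2 - q.1.1 < p.1.2 - p.1.1 := by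
  unfold hookRest at hq
  split_ifs at hq with h
  · obtain ⟨h1, h2⟩ := (Finset.mem_filter.1 hq).2
    have h3 := mem_pairsC.1 p.2
    have h4 := mem_pairsC.1 q.2
    rw [mem_hookC] at h1
    have h5 : ¬ (q.1.1 = p.1.1 ∧ q.1.2 = p.1.2) := fun h => h2 (Subtype.ext (Prod.ext h.1 h.2))
    omega
  · simp at hq

theorem sum_hookRest {n : ℕ} {F : Finset (ℕ × ℕ)} (x : pairsC n → ℝ) {p : pairsC n}
    (hp : p.1 ∈ F) : x p + ∑ q ∈ hookRest n F p, x q = wt x (hookC n p.1.1 p.1.2) := by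
  rw [← pathSum_eq_wt x (nodup_of_isChain isChain_hookC), pathSum, ← Finset.sum_filter,
    hookRest, if_pos hp]
  have hmem : p ∈ Finset.univ.filter (fun q : pairsC n => q.1 ∈ hookC n p.1.1 p.1.2) := by
    simpa using self_mem_hookC p.2
  rw [← Finset.add_sum_erase _ _ hmem]
  congr 1
  refine Finset.sum_congr ?_ fun _ _ => rfl
  ext q
  simp only [Finset.mem_filter, Finset.mem_univ, true_and, Finset.mem_erase]
  tauto

/-- The entries of a hook other than its corner have smaller j − i, so the system is triangular for
any F, admissible or not. -/
theorem existsUnique_wt_hookC {n : ℕ} (F : Finset (ℕ × ℕ)) (c : pairsC n → ℝ) :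
    ∃! x : pairsC n → ℝ, ∀ p : pairsC n,
      (p.1 ∉ F → x p = 0) ∧ (p.1 ∈ F → wt x (hookC n p.1.1 p.1.2) = c p) := by
  have hiff : ∀ x : pairsC n → ℝ, (∀ p : pairsC n,
      (p.1 ∉ F → x p = 0) ∧ (p.1 ∈ F → wt x (hookC n p.1.1 p.1.2) = c p)) ↔
      ∀ p, x p + ∑ q ∈ hookRest n F p, x q = if p.1 ∈ F then c p else 0 := by
    intro x
    refine forall_congr' fun p => ?_
    by_cases hp : p.1 ∈ F
    · rw [sum_hookRest x hp, if_pos hp]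
      exact ⟨fun h => h.2 hp, fun h => ⟨fun h' => absurd hp h', fun _ => h⟩⟩
    · rw [if_neg hp, hookRest, if_neg hp, Finset.sum_empty, add_zero]
      exact ⟨fun h => h.1 hp, fun h => ⟨fun _ => h, fun h' => absurd h' hp⟩⟩
  obtain ⟨x, hx, hu⟩ := existsUnique_triangular (fun p : pairsC n => p.1.2 - p.1.1)
    (hookRest n F) (rank_lt_of_mem_hookRest F) (fun p => if p.1 ∈ F then c p else 0)
  exact ⟨x, (hiff x).2 hx, fun y hy => hu y ((hiff y).1 hy)⟩

theorem exists_isHookPoint {n : ℕ} (a : ℕ → ℕ) {F : Finset (ℕ × ℕ)} (hF : F ⊆ pairsC n) :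
    ∃ x, IsHookPoint n a F x := by
  obtain ⟨x, hx, -⟩ := existsUnique_wt_hookC (n := n) F (fun p => lam n a p.1.1 - lam n a p.1.2)
  refine ⟨x, fun p hp => ?_, fun p hp => ?_⟩
  · by_cases h : p ∈ pairsC n
    · rw [coord_of_mem x h]; exact (hx ⟨p, h⟩).1 hp
    · exact coord_of_notMem x h
  · rw [← wt_hookC]; exact (hx ⟨p, hF hp⟩).2 hp

end FFLV

/-! ### Hook points with admissible support are simple vertices. -/

namespace FFLV

variable {n : ℕ} {a : ℕ → ℕ} {F : Finset (ℕ × ℕ)} {x : pairsC n → ℝ}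

theorem rowSum_eq_of_forall_eq_zero {i j m : ℕ} (hm : m ≤ j)
    (h : ∀ l, m < l → l ≤ j → i < l → coord x (i, l) = 0) : rowSum x i j = rowSum x i m := by
  refine (Finset.sum_subset (Finset.Ioc_subset_Ioc_right hm) fun l hl hl' => ?_).symm
  rw [Finset.mem_Ioc] at hl hl'
  exact h l (by omega) hl.2 hl.1

theorem colSum_eq_of_forall_eq_zero {i k j : ℕ} (hik : i < k) (hkj : k < j)
    (h : ∀ l, i < l → l < k → coord x (l, j) = 0) :
    colSum x i j = coord x (k, j) + colSum x k j := by
  have h1 : colSum x i j = ∑ l ∈ Finset.Ico k j, coord x (l, j) := by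
    refine (Finset.sum_subset (fun l hl => ?_) fun l hl hl' => ?_).symm
    · rw [Finset.mem_Ico] at hl; rw [Finset.mem_Ioo]; omega
    · rw [Finset.mem_Ico] at hl'; rw [Finset.mem_Ioo] at hl
      exact h l hl.1 (by omega)
  rw [h1, colSum, Finset.sum_eq_sum_Ico_succ_bot hkj]
  rfl

theorem rowSum_succ {i j : ℕ} (hij : i ≤ j) :
    rowSum x i (j + 1) = rowSum x i j + coord x (i, j + 1) := by
  rw [rowSum, rowSum, ← Finset.insert_Ioc_right_eq_Ioc_add_one hij,
    Finset.sum_insert (by simp), add_comm]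

theorem colSum_nonneg (hx : ∀ p, 0 ≤ x p) (i j : ℕ) : 0 ≤ colSum x i j :=
  Finset.sum_nonneg fun _ _ => coord_nonneg hx _

theorem coord_le_colSum (hx : ∀ p, 0 ≤ x p) {i k j : ℕ} (hik : i < k) (hkj : k < j) :
    coord x (k, j) ≤ colSum x i j :=
  Finset.single_le_sum (f := fun k => coord x (k, j)) (fun _ _ => coord_nonneg hx _)
    (Finset.mem_Ioo.2 ⟨hik, hkj⟩)

theorem add_colSum_le_colSum (hx : ∀ p, 0 ≤ x p) {i k j : ℕ} (hik : i < k) (hkj : k < j) :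
    coord x (k, j) + colSum x k j ≤ colSum x i j := by
  rw [colSum, ← Finset.sum_insert (f := fun k => coord x (k, j)) (by simp)]
  refine Finset.sum_le_sum_of_subset_of_nonneg (fun l hl => ?_) fun _ _ _ => coord_nonneg hx _
  rw [Finset.mem_insert, Finset.mem_Ioo] at hl
  rw [Finset.mem_Ioo]; omega

theorem rowSum_add_le_rowSum (hx : ∀ p, 0 ≤ x p) {i l j : ℕ} (hil : i < j) (hlj : l < j) :
    rowSum x i l + coord x (i, j) ≤ rowSum x i j := by
  rw [rowSum, add_comm, ← Finset.sum_insert (f := fun l => coord x (i, l)) (by simp [hlj])]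
  refine Finset.sum_le_sum_of_subset_of_nonneg (fun k hk => ?_) fun _ _ _ => coord_nonneg hx _
  rw [Finset.mem_insert, Finset.mem_Ioc] at hk
  rw [Finset.mem_Ioc]; omega

namespace IsHookPoint

/-- Induction on j − i. The hook equation expresses x_{i,j} as Λ_i − Λ_j minus the rest of row i and
column j. The hook of the last (i,l) in F with l < j bounds the row by Λ_i − Λ_l, the hook of the
first (k,j) in F with k > i bounds the column by Λ_k − Λ_j. Nestedness gives l < k, leaving at least
Λ_l − Λ_k > 0. -/
theorem pos (hreg : ∀ i, 1 ≤ i → i ≤ n → 0 < a i) (hF : IsAdmissible n F)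
    (hx : IsHookPoint n a F x) : ∀ p ∈ F, 0 < coord x p := by
  have key : ∀ N : ℕ, ∀ p ∈ F, p.2 - p.1 = N → 0 < coord x p := by
    intro N
    induction N using Nat.strong_induction_on with
    | _ N ih =>
      rintro ⟨i, j⟩ hp hN
      simp only at hN
      have hpC := mem_pairsC.1 (hF.subset hp)
      simp only at hpC
      have hnn : ∀ q : ℕ × ℕ, i ≤ q.1 → q.2 ≤ j → q.2 - q.1 < N → 0 ≤ coord x q := by
        intro q _ _ hq
        by_cases h : q ∈ F
        · exact (ih _ hq q h rfl).le
        · rw [hx.zero q h]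
      have hhook := hx.hook _ hp
      simp only at hhook
      obtain ⟨j', rfl⟩ : ∃ j', j = j' + 1 := ⟨j - 1, by omega⟩
      rw [rowSum_succ (by omega)] at hhook
      -- The strict bound for l > n is needed because Λ_l and Λ_j are then both 0; it comes from the
      -- positive entry (2n+1−l, l) in column l.
      have hrow : rowSum x i j' = 0 ∧ (∀ l, i < l → l ≤ j' → (i, l) ∉ F) ∨
          ∃ l, i < l ∧ l ≤ j' ∧ (i, l) ∈ F ∧ rowSum x i j' ≤ lam n a i - lam n a l ∧
            (n < l → rowSum x i j' < lam n a i - lam n a l) := by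
        by_cases hex : ∃ l, i < l ∧ l ≤ j' ∧ (i, l) ∈ F
        · right
          obtain ⟨l, ⟨hl1, hl2, hl3⟩, hmax⟩ : ∃ l, (i < l ∧ l ≤ j' ∧ (i, l) ∈ F) ∧
              ∀ m, i < m → m ≤ j' → (i, m) ∈ F → m ≤ l := by
            classical
            have hne : ((Finset.Ioc i j').filter (fun l => (i, l) ∈ F)).Nonempty := by
              obtain ⟨l, h1, h2, h3⟩ := hex
              exact ⟨l, by simp [h1, h2, h3]⟩
            have hmx := Finset.max'_mem _ hne
            rw [Finset.mem_filter, Finset.mem_Ioc] at hmx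
            exact ⟨_, ⟨hmx.1.1, hmx.1.2, hmx.2⟩, fun m h1 h2 h3 => Finset.le_max' _ m
              (Finset.mem_filter.2 ⟨Finset.mem_Ioc.2 ⟨h1, h2⟩, h3⟩)⟩
          refine ⟨l, hl1, hl2, hl3, ?_⟩
          have h1 : rowSum x i j' = rowSum x i l :=
            rowSum_eq_of_forall_eq_zero hl2 fun m hm hm' hm'' =>
              hx.zero _ fun h => absurd (hmax m hm'' hm' h) (by omega)
          have h2 := hx.hook _ hl3
          simp only at h2
          have h3 : ∀ k ∈ Finset.Ioo i l, 0 ≤ coord x (k, l) := by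
            intro k hk
            rw [Finset.mem_Ioo] at hk
            exact hnn _ hk.1.le (by simp only; omega) (by simp only; omega)
          have h4 : 0 ≤ colSum x i l := Finset.sum_nonneg h3
          refine ⟨by linarith, fun hn => ?_⟩
          have h5 := hF.diagonal _ hl3 hn
          have h6 := ih _ (by simp only; omega) _ h5 rfl
          have h7 : coord x (2 * n + 1 - l, l) ≤ colSum x i l :=
            Finset.single_le_sum (f := fun k => coord x (k, l)) h3
              (Finset.mem_Ioo.2 ⟨by omega, by omega⟩)
          linarith
        · left
          push Not at hex
          exact ⟨Finset.sum_eq_zero fun l hl => hx.zero _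
            (hex l (Finset.mem_Ioc.1 hl).1 (Finset.mem_Ioc.1 hl).2), hex⟩
      have hcol : colSum x i (j' + 1) = 0 ∧ (∀ k, i < k → (k, j' + 1) ∉ F) ∨
          ∃ k, i < k ∧ (k, j' + 1) ∈ F ∧ colSum x i (j' + 1) ≤
            lam n a k - lam n a (j' + 1) := by
        by_cases hex : ∃ k, i < k ∧ (k, j' + 1) ∈ F
        · right
          classical
          have hk := Nat.find_spec hex
          have hmin := fun m (hm : m < Nat.find hex) => Nat.find_min hex hm
          generalize Nat.find hex = k at hk hmin
          have hkC := mem_pairsC.1 (hF.subset hk.2)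
          simp only at hkC
          refine ⟨k, hk.1, hk.2, ?_⟩
          have h1 : colSum x i (j' + 1) = coord x (k, j' + 1) + colSum x k (j' + 1) :=
            colSum_eq_of_forall_eq_zero hk.1 (by omega) fun m hm hm' =>
              hx.zero _ fun h => hmin m hm' ⟨hm, h⟩
          have h2 := hx.hook _ hk.2
          simp only at h2
          have h3 : coord x (k, j' + 1) ≤ rowSum x k (j' + 1) := by
            refine Finset.single_le_sum (f := fun l => coord x (k, l)) (fun l hl => ?_)
              (Finset.mem_Ioc.2 ⟨by omega, le_rfl⟩)
            rw [Finset.mem_Ioc] at hl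
            exact hnn _ hk.1.le hl.2 (by simp only; omega)
          linarith
        · left
          push Not at hex
          exact ⟨Finset.sum_eq_zero fun k hk => hx.zero _ (hex k (Finset.mem_Ioo.1 hk).1), hex⟩
      rcases hrow with ⟨h1, h1'⟩ | ⟨l, h1, h2, h3, h4, h5⟩ <;>
        rcases hcol with ⟨g1, g1'⟩ | ⟨k, g1, g2, g3⟩
      · have := lam_lt hreg hpC.1 (by omega) hpC.2.1
        linarith
      · have := lam_lt hreg hpC.1 (by omega) g1
        linarith
      · rcases le_or_gt l n with hl | hl
        · have := lam_lt hreg (i := l) (j := j' + 1) (by omega) hl (by omega)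
          linarith
        · have := h5 hl
          rw [lam_eq_zero a hl] at this
          rw [lam_eq_zero a (show n < j' + 1 by omega)] at hhook
          linarith
      · have hkC := mem_pairsC.1 (hF.subset g2)
        simp only at hkC
        -- Otherwise (i,l) and (k,j) in F have i < k ≤ l < j, against nestedness.
        have hlk : l < k := by
          by_contra hc
          have := hF.nested _ h3 _ g2 g1 (by simp only; omega)
          simp only at this; omega
        have := lam_lt hreg (i := l) (j := k) (by omega) (by omega) hlk
        linarith
  exact fun p hp => key _ p hp rfl

theorem nonneg (hreg : ∀ i, 1 ≤ i → i ≤ n → 0 < a i) (hF : IsAdmissible n F)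
    (hx : IsHookPoint n a F x) (p : pairsC n) : 0 ≤ x p := by
  rw [← coord_coe x p]
  by_cases h : p.1 ∈ F
  · exact (hx.pos hreg hF _ h).le
  · rw [hx.zero _ h]

/-- A bound for the sum of the coordinates along an initial part of a path, in terms of its last
entry `p` in the support. -/
theorem wt_prefix (hreg : ∀ i, 1 ≤ i → i ≤ n → 0 < a i) (hF : IsAdmissible n F)
    (hx : IsHookPoint n a F x) {q : ℕ × ℕ} {s : List (ℕ × ℕ)} (hs : IsPre n q s) :
    wt x (s ++ [q]) = 0 ∨ ∃ p ∈ s ++ [q], p ∈ F ∧ p.1 ≤ q.1 ∧ p.2 ≤ q.2 ∧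
      wt x (s ++ [q]) ≤ lam n a (s.headD q).1 - (lam n a p.2 + colSum x p.1 p.2) ∧
      (wt x (s ++ [q]) = lam n a (s.headD q).1 - (lam n a p.2 + colSum x p.1 p.2) →
        ((s.headD q).1, p.2) ∈ s ++ [q] ∧ ((s.headD q).1, p.2) ∈ F) := by
  have hnn := hx.nonneg hreg hF
  induction s using List.reverseRecOn generalizing q with
  | nil =>
    by_cases hq : q ∈ F
    · right
      have hqC := mem_pairsC.1 (hF.subset hq)
      refine ⟨q, by simp, hq, le_rfl, le_rfl, ?_, fun _ => ⟨by simp, by simpa using hq⟩⟩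
      have h1 := hx.hook q hq
      have h2 := rowSum_add_le_rowSum hnn (i := q.1) (l := q.1) hqC.2.1 hqC.2.1
      have h3 : rowSum x q.1 q.1 = 0 := by simp [rowSum]
      simp only [List.nil_append, wt_cons, wt_nil, List.headD_nil]
      rw [Prod.mk.eta] at h2
      linarith
    · left; simp [hx.zero q hq]
  | append_singleton s q₀ ih =>
    obtain ⟨h0, hstep, hqC⟩ := IsPre.snoc_iff.1 hs
    have hle := hstep.precedes
    rw [wt_append, wt_cons, wt_nil, add_zero, headD_append_cons]
    have hsrc : (s.headD q₀).1 ≤ q.1 := (h0.headD_le q₀ (by simp)).trans hle.1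
    have hsrcC := mem_pairsC.1 h0.headD_mem
    rw [mem_pairsC] at hqC
    by_cases hq : q ∈ F
    · right
      have hqX := hx.hook q hq
      rcases ih h0 with h1 | ⟨p, hp, hpF, hp1, hp2, hpS, hpE⟩
      · refine ⟨q, by simp, hq, le_rfl, le_rfl, ?_⟩
        have h2 := rowSum_add_le_rowSum hnn (i := q.1) (l := q.1) hqC.2.1 hqC.2.1
        have h3 : rowSum x q.1 q.1 = 0 := by simp [rowSum]
        rw [Prod.mk.eta] at h2
        have h4 := lam_antitone n a hsrc
        refine ⟨by linarith, fun h => ?_⟩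
        have h5 : (s.headD q₀).1 = q.1 := by
          rcases hsrc.eq_or_lt with h5 | h5
          · exact h5
          · have := lam_lt hreg hsrcC.1 (by omega) h5
            linarith
        rw [h5, Prod.mk.eta]
        exact ⟨by simp, hq⟩
      · have hpC := mem_pairsC.1 (hF.subset hpF)
        have hpX := hx.hook p hpF
        have hpc := colSum_nonneg hnn p.1 p.2
        refine ⟨q, by simp, hq, le_rfl, le_rfl, ?_⟩
        have hpq : p.1 + p.2 < q.1 + q.2 := (hs.precedes p hp).2.2
        -- By the hook equation at p, the level Λ_{p.2} + `colSum` at p equals Λ_{p.1} − `rowSum` at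
        -- p. The previous support entry p is either disjoint from q, with a strict gain since
        -- Λ_{p.2} > Λ_{q.1}; or in the row of q; or, by nestedness, in the column of q. In the last
        -- two cases the partial row or column sums of the two hooks are compared.
        rcases lt_or_ge p.2 q.1 with hlt | hge
        · have h2 := rowSum_add_le_rowSum hnn (i := q.1) (l := q.1) hqC.2.1 hqC.2.1
          have h3 : rowSum x q.1 q.1 = 0 := by simp [rowSum]
          rw [Prod.mk.eta] at h2
          have h4 := lam_lt hreg (i := p.2) (j := q.1) (by omega) (by omega) hlt
          exact ⟨by linarith, fun h => by linarith⟩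
        · rcases (hp1.trans hle.1).eq_or_lt with heq | hlt
          · have hl : p.2 < q.2 := by omega
            have h2 := rowSum_add_le_rowSum hnn (i := q.1) (l := p.2) hqC.2.1 hl
            rw [Prod.mk.eta] at h2
            rw [heq] at hpX hpS hpE hpc
            refine ⟨by linarith, fun h => ?_⟩
            obtain ⟨g1, g2⟩ := hpE (by linarith)
            rcases hsrc.eq_or_lt with g3 | g3
            · rw [g3, Prod.mk.eta]; exact ⟨by simp, hq⟩
            · have := hF.nested _ g2 _ hq g3 hge
              simp only at this; omega
          · have hl : p.2 = q.2 := by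
              have := hF.nested p hpF q hq hlt hge
              have := hle.2.1
              omega
            have h2 := add_colSum_le_colSum hnn (j := q.2) hlt hqC.2.1
            rw [Prod.mk.eta] at h2
            rw [hl] at hpX hpS hpE
            refine ⟨by linarith, fun h => ?_⟩
            obtain ⟨g1, g2⟩ := hpE (by linarith)
            exact ⟨List.mem_append_left _ g1, g2⟩
    · rw [hx.zero q hq, add_zero]
      rcases ih h0 with h1 | ⟨p, hp, hpF, hp1, hp2, hpS, hpE⟩
      · exact Or.inl h1
      · exact Or.inr ⟨p, List.mem_append_left _ hp, hpF, hp1.trans hle.1, hp2.trans hle.2.1, hpS,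
          fun h => ⟨List.mem_append_left _ (hpE h).1, (hpE h).2⟩⟩

/-- Here `wt_prefix` is applied to the whole path. Equality forces the last support entry p to lie
in the final column: by strictness of Λ if p.2 ≤ n, and otherwise because a positive diagonal entry
strictly below p in its column would spoil equality, so that p itself is on i + j = 2n+1. The
equality clause of `wt_prefix` then puts the corner on the path. -/
theorem wt_le (hreg : ∀ i, 1 ≤ i → i ≤ n → 0 < a i) (hF : IsAdmissible n F)
    (hx : IsHookPoint n a F x) {d : List (ℕ × ℕ)} (hd : IsDyckPathC n d) :
    wt x d ≤ pathBound n a d ∧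
      (wt x d = pathBound n a d → ∃ p ∈ F, d = hookC n p.1 p.2) := by
  have hnn := hx.nonneg hreg hF
  obtain ⟨s, q, rfl⟩ : ∃ s q, d = s ++ [q] :=
    ⟨d.dropLast, d.getLast hd.ne_nil, (List.dropLast_append_getLast hd.ne_nil).symm⟩
  have hpos := pathBound_pos hreg hd
  obtain ⟨h1, h2⟩ := isDyckPathC_iff.1 hd
  have hsrc : source (s ++ [q]) = (s.headD q).1 := by rw [source, headD_append_cons]
  have hsink : sink (s ++ [q]) = q.2 := by rw [sink, getLastD_append_cons]; simp
  have hb : pathBound n a (s ++ [q]) = lam n a (s.headD q).1 - lam n a q.2 := by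
    rw [← hsrc, ← hsink]; rfl
  rcases hx.wt_prefix hreg hF h1 with h3 | ⟨p, hp, hpF, hp1, hp2, hpS, hpE⟩
  · exact ⟨by linarith, fun h => by linarith⟩
  · have hpc := colSum_nonneg hnn p.1 p.2
    have hl := lam_antitone n a hp2
    rw [hb]
    refine ⟨by linarith, fun h => ?_⟩
    have hpC := mem_pairsC.1 (hF.subset hpF)
    have hqC := mem_pairsC.1 h1.mem_self
    have hpq : p.2 = q.2 := by
      rcases le_or_gt p.2 n with hn | hn
      · rcases hp2.eq_or_lt with g | g
        · exact g
        · have := lam_lt hreg (by omega) hn g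
          linarith
      · rcases hpC.2.2.eq_or_lt with g | g
        · omega
        · have g1 := hx.pos hreg hF _ (hF.diagonal p hpF hn)
          have g2 := coord_le_colSum hnn (i := p.1) (k := 2 * n + 1 - p.2) (j := p.2)
            (by omega) (by omega)
          linarith
    obtain ⟨g1, g2⟩ := hpE (by linarith)
    rw [hpq] at g1 g2
    refine ⟨_, g2, ?_⟩
    have := hd.eq_hookC (by rw [hsrc, hsink]; exact g1)
    rw [hsrc, hsink] at this
    exact this

theorem mem_polytopeC (hreg : ∀ i, 1 ≤ i → i ≤ n → 0 < a i) (hF : IsAdmissible n F)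
    (hx : IsHookPoint n a F x) : x ∈ polytopeC n a :=
  FFLV.mem_polytopeC.2 ⟨hx.nonneg hreg hF, fun _ hd => (hx.wt_le hreg hF hd).1⟩

/-- The inequality, tight at the hook point with support `F`, that belongs to the pair `p`. -/
noncomputable def _root_.FFLV.tightIneq (n : ℕ) (F : Finset (ℕ × ℕ)) (p : pairsC n) :
    pairsC n ⊕ {d // IsDyckPathC n d} :=
  if p.1 ∈ F then .inr ⟨hookC n p.1.1 p.1.2, isDyckPathC_hookC p.2⟩ else .inl p

theorem tight_iff (hreg : ∀ i, 1 ≤ i → i ≤ n → 0 < a i) (hF : IsAdmissible n F)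
    (hx : IsHookPoint n a F x) (k : pairsC n ⊕ {d // IsDyckPathC n d}) :
    ineq n k x = ineqBound n a k ↔ ∃ p, k = tightIneq n F p := by
  constructor
  · intro h
    rcases k with p | ⟨d, hd⟩
    · refine ⟨p, ?_⟩
      rw [tightIneq, if_neg]
      intro hp
      have := hx.pos hreg hF _ hp
      rw [coord_coe] at this
      rw [ineq_inl, ineqBound] at h
      linarith
    · obtain ⟨p, hp, rfl⟩ := (hx.wt_le hreg hF hd).2 h
      exact ⟨⟨p, hF.subset hp⟩, by rw [tightIneq, if_pos hp]⟩
  · rintro ⟨p, rfl⟩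
    unfold tightIneq
    split_ifs with hp
    · rw [ineq_inr, ineqBound, wt_hookC, hx.hook _ hp, pathBound_hookC a p.2]
    · rw [ineq_inl, ineqBound, ← coord_coe x p, hx.zero _ hp, neg_zero]

theorem _root_.FFLV.ineq_tightIneq (y : pairsC n → ℝ) (p : pairsC n) :
    ineq n (tightIneq n F p) y =
      (if p.1 ∈ F then 1 else -1) * (y p + ∑ q ∈ hookRest n F p, y q) := by
  unfold tightIneq
  split_ifs with hp
  · rw [ineq_inr, sum_hookRest y hp, one_mul]
  · simp [hookRest, hp]

theorem _root_.FFLV.eq_zero_of_ineq_tightIneq (y : pairsC n → ℝ)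
    (h : ∀ p, ineq n (tightIneq n F p) y = 0) : y = 0 := by
  refine (existsUnique_triangular (fun p : pairsC n => p.1.2 - p.1.1) (hookRest n F)
    (rank_lt_of_mem_hookRest F) (0 : pairsC n → ℝ)).unique (fun p => ?_) (fun p => by simp)
  have := h p
  rw [ineq_tightIneq] at this
  refine (mul_eq_zero.1 this).resolve_left ?_
  split_ifs <;> norm_num

/-- A hook point with admissible support is a simple vertex. -/
theorem isSimpleVertex (hreg : ∀ i, 1 ≤ i → i ≤ n → 0 < a i) (hF : IsAdmissible n F)
    (hx : IsHookPoint n a F x) : IsSimpleVertex (polytopeC n a) x := by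
  have hmem := hx.mem_polytopeC hreg hF
  rw [IsSimpleVertex, polytopeC_eq_polyhedron] at *
  constructor
  · refine mem_extremePoints_polyhedron hmem fun u hu => ?_
    exact eq_zero_of_ineq_tightIneq u fun p => hu _ ((hx.tight_iff hreg hF _).2 ⟨p, rfl⟩)
  · let A : (pairsC n → ℤ) →ₗ[ℤ] (pairsC n → ℤ) :=
      { toFun := fun z p => (if p.1 ∈ F then -1 else 1) * (z p + ∑ q ∈ hookRest n F p, z q)
        map_add' := fun z w => by
          funext p; simp only [Pi.add_apply, Finset.sum_add_distrib]; ring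
        map_smul' := fun r z => by
          funext p
          simp only [Pi.smul_apply, smul_eq_mul, ← Finset.mul_sum, RingHom.id_apply]; ring }
    have hA : ∀ z p, A z p =
        (if p.1 ∈ F then -1 else 1) * (z p + ∑ q ∈ hookRest n F p, z q) := fun _ _ => rfl
    have hbij : Function.Bijective A := by
      rw [Function.bijective_iff_existsUnique]
      intro c
      have hiff : ∀ z, A z = c ↔ ∀ p, z p + ∑ q ∈ hookRest n F p, z q =
          (if p.1 ∈ F then -1 else 1) * c p := by
        intro z
        rw [funext_iff]
        refine forall_congr' fun p => ?_
        rw [hA]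
        split_ifs <;> constructor <;> intro h <;> linarith
      simp only [hiff]
      exact existsUnique_triangular (fun p : pairsC n => p.1.2 - p.1.1) (hookRest n F)
        (rank_lt_of_mem_hookRest F) _
    refine isUnimodularSimplicialCone_tangentCone hmem (tightIneq n F) (hx.tight_iff hreg hF)
      (LinearEquiv.ofBijective A hbij) (fun z p => ?_) eq_zero_of_ineq_tightIneq
    rw [ineq_tightIneq, LinearEquiv.ofBijective_apply, hA]
    push_cast
    split_ifs <;> ring

end IsHookPoint

end FFLV

/-! ### Tight paths at a simple vertex have no valleys. -/

namespace FFLV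

variable {n : ℕ} {a : ℕ → ℕ} {v : pairsC n → ℝ}

/-- The path `d` defines an inequality that is tight at `v`. -/
def IsTight (n : ℕ) (a : ℕ → ℕ) (v : pairsC n → ℝ) (d : List (ℕ × ℕ)) : Prop :=
  IsDyckPathC n d ∧ wt v d = pathBound n a d

theorem isTight_of_le (hv : v ∈ polytopeC n a) {d : List (ℕ × ℕ)} (hd : IsDyckPathC n d)
    (h : pathBound n a d ≤ wt v d) : IsTight n a v d :=
  ⟨hd, le_antisymm ((mem_polytopeC.1 hv).2 d hd) h⟩

theorem IsTight.eq {s t : List (ℕ × ℕ)} {q : ℕ × ℕ} (h : IsTight n a v (s ++ q :: t)) :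
    wt v s + (coord v q + wt v t) = lam n a (s.headD q).1 - lam n a (t.getLastD q).2 := by
  rw [← pathBound_append_cons, ← h.2, wt_append, wt_cons]

theorem IsTight.isPre {s t : List (ℕ × ℕ)} {q : ℕ × ℕ} (h : IsTight n a v (s ++ q :: t)) :
    IsPre n q s := (isDyckPathC_iff.1 h.1).1

theorem IsTight.isPost {s t : List (ℕ × ℕ)} {q : ℕ × ℕ} (h : IsTight n a v (s ++ q :: t)) :
    IsPost n q t := (isDyckPathC_iff.1 h.1).2

theorem wt_le_of_isPre_of_isPost (hv : v ∈ polytopeC n a) {s t : List (ℕ × ℕ)} {q : ℕ × ℕ}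
    (hs : IsPre n q s) (ht : IsPost n q t) :
    wt v s + (coord v q + wt v t) ≤ lam n a (s.headD q).1 - lam n a (t.getLastD q).2 := by
  have := (mem_polytopeC.1 hv).2 _ (isDyckPathC_iff.2 ⟨hs, ht⟩)
  rwa [wt_append, wt_cons, pathBound_append_cons] at this

theorem isTight_append_cons (hv : v ∈ polytopeC n a) {s t : List (ℕ × ℕ)} {q : ℕ × ℕ}
    (hs : IsPre n q s) (ht : IsPost n q t)
    (h : lam n a (s.headD q).1 - lam n a (t.getLastD q).2 ≤ wt v s + (coord v q + wt v t)) :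
    IsTight n a v (s ++ q :: t) :=
  isTight_of_le hv (isDyckPathC_iff.2 ⟨hs, ht⟩)
    (by rwa [wt_append, wt_cons, pathBound_append_cons])

/-- Exchanging the tails of two tight paths at q gives two paths with the same total weight and the
same total bound, so neither inequality can be slack. The level at q (Λ of the starting row minus
the weight so far) therefore depends on q only. -/
theorem IsTight.level_eq (hv : v ∈ polytopeC n a) {s t s' t' : List (ℕ × ℕ)} {q : ℕ × ℕ}
    (h : IsTight n a v (s ++ q :: t)) (h' : IsTight n a v (s' ++ q :: t')) :
    lam n a (s.headD q).1 - wt v s = lam n a (s'.headD q).1 - wt v s' := by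
  have h1 := wt_le_of_isPre_of_isPost hv h.isPre h'.isPost
  have h2 := wt_le_of_isPre_of_isPost hv h'.isPre h.isPost
  have h3 := h.eq
  have h4 := h'.eq
  linarith

theorem IsTight.swap (hv : v ∈ polytopeC n a) {s t s' t' : List (ℕ × ℕ)} {q : ℕ × ℕ}
    (h : IsTight n a v (s ++ q :: t)) (h' : IsTight n a v (s' ++ q :: t')) :
    IsTight n a v (s ++ q :: t') := by
  refine isTight_append_cons hv h.isPre h'.isPost ?_
  have h1 := h.level_eq hv h'
  have h4 := h'.eq
  linarith

open Classical in
/-- The common value, at the entrance of `q`, of the level of all tight paths through `q`. -/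
noncomputable def levelIn (n : ℕ) (a : ℕ → ℕ) (v : pairsC n → ℝ) (q : ℕ × ℕ) : ℝ :=
  if h : ∃ s t, IsTight n a v (s ++ q :: t) then lam n a (h.choose.headD q).1 - wt v h.choose
  else 0

/-- The common value, at the exit of `q`, of the level of all tight paths through `q`. -/
noncomputable def levelOut (n : ℕ) (a : ℕ → ℕ) (v : pairsC n → ℝ) (q : ℕ × ℕ) : ℝ :=
  levelIn n a v q - coord v q

theorem IsTight.levelIn_eq (hv : v ∈ polytopeC n a) {s t : List (ℕ × ℕ)} {q : ℕ × ℕ}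
    (h : IsTight n a v (s ++ q :: t)) :
    levelIn n a v q = lam n a (s.headD q).1 - wt v s := by
  have hex : ∃ s t, IsTight n a v (s ++ q :: t) := ⟨s, t, h⟩
  rw [levelIn, dif_pos hex]
  obtain ⟨t', ht'⟩ := hex.choose_spec
  exact ht'.level_eq hv h

theorem IsTight.levelOut_eq (hv : v ∈ polytopeC n a) {s t : List (ℕ × ℕ)} {q : ℕ × ℕ}
    (h : IsTight n a v (s ++ q :: t)) :
    levelOut n a v q = lam n a (t.getLastD q).2 + wt v t := by
  rw [levelOut, h.levelIn_eq hv]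
  have := h.eq
  linarith

theorem IsTight.assoc {s t : List (ℕ × ℕ)} {q q' : ℕ × ℕ}
    (h : IsTight n a v (s ++ q :: q' :: t)) : IsTight n a v ((s ++ [q]) ++ q' :: t) := by
  rwa [List.append_assoc, List.singleton_append]

theorem IsTight.levelIn_next (hv : v ∈ polytopeC n a) {s t : List (ℕ × ℕ)} {q q' : ℕ × ℕ}
    (h : IsTight n a v (s ++ q :: q' :: t)) : levelIn n a v q' = levelOut n a v q := by
  rw [h.assoc.levelIn_eq hv, levelOut, h.levelIn_eq hv, headD_append_cons, wt_append, wt_cons,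
    wt_nil]
  ring

/-- The vector u = [In] − [Out] telescopes to 0 along every tight path and vanishes where v does, so
extremality gives u = 0. It will be applied to sets cut out by one fixed level. -/
theorem levelIn_iff_levelOut (hv : v ∈ (polytopeC n a).extremePoints ℝ) (In Out : ℕ × ℕ → Prop)
    (hzero : ∀ x ∈ pairsC n, coord v x = 0 → (In x ↔ Out x))
    (hstart : ∀ q t, IsTight n a v (q :: t) → ¬ In q)
    (hend : ∀ s q, IsTight n a v (s ++ [q]) → ¬ Out q)
    (hstep : ∀ s x x' t, IsTight n a v (s ++ x :: x' :: t) → (Out x ↔ In x')) :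
    ∀ x ∈ pairsC n, In x ↔ Out x := by
  classical
  let u : pairsC n → ℝ := fun p => (if In p.1 then 1 else 0) - (if Out p.1 then 1 else 0)
  have hcoord : ∀ x ∈ pairsC n, coord u x = (if In x then 1 else 0) - (if Out x then 1 else 0) :=
    fun x hx => coord_of_mem u hx
  have hwt : ∀ t s x, IsTight n a v (s ++ x :: t) → wt u (x :: t) = if In x then 1 else 0 := by
    intro t
    induction t with
    | nil =>
      intro s x h
      rw [wt_cons, wt_nil, hcoord x h.isPre.mem_self, if_neg (hend s x h)]
      ring
    | cons x' t ih =>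
      intro s x h
      rw [wt_cons, ih _ _ h.assoc, hcoord x h.isPre.mem_self]
      simp only [hstep s x x' t h]
      ring
  have hu : u = 0 := by
    rw [polytopeC_eq_polyhedron] at hv
    refine eq_zero_of_mem_extremePoints hv ?_
    rintro (p | ⟨d, hd⟩) hk
    · have h0 : coord v p.1 = 0 := by
        rw [coord_coe]; rw [ineq_inl, ineqBound] at hk; linarith
      have := hzero p.1 p.2 h0
      simp only [ineq_inl, u, this]
      ring
    · obtain ⟨b, t, rfl, -⟩ := hd.exists_eq_cons
      have ht : IsTight n a v (b :: t) := ⟨hd, hk⟩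
      rw [ineq_inr, hwt t [] b ht, if_neg (hstart b t ht)]
  intro x hx
  have h1 := hcoord x hx
  rw [hu, coord_of_mem _ hx] at h1
  by_cases h2 : In x <;> by_cases h3 : Out x <;> simp_all

theorem exists_isPre_row (hv : v ∈ polytopeC n a) {k c : ℕ} {s : List (ℕ × ℕ)}
    (hs : IsPre n (k, c) s) (m : ℕ) (hm : (k, c + m) ∈ pairsC n) :
    ∃ s', IsPre n (k, c + m) s' ∧ (s'.headD (k, c + m)).1 = (s.headD (k, c)).1 ∧
      wt v s + coord v (k, c) ≤ wt v s' + coord v (k, c + m) ∧ ∀ p ∈ s', p ∈ s ∨ p.1 = k := by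
  have hnn := coord_nonneg (mem_polytopeC.1 hv).1
  induction m with
  | zero => exact ⟨s, hs, rfl, le_rfl, fun p hp => Or.inl hp⟩
  | succ m ih =>
    have hc := mem_pairsC.1 hs.mem_self
    rw [mem_pairsC] at hm
    simp only at hc hm
    obtain ⟨s', h1, h2, h3, h4⟩ := ih (mem_pairsC.2 (by simp only; omega))
    refine ⟨s' ++ [(k, c + m)], IsPre.snoc_iff.2 ⟨h1, Or.inr rfl, mem_pairsC.2 hm⟩, ?_, ?_, ?_⟩
    · rw [headD_append_cons, h2]
    · rw [wt_append, wt_cons, wt_nil]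
      linarith [hnn (k, c + (m + 1))]
    · intro p hp
      rcases List.mem_append.1 hp with hp | hp
      · exact h4 p hp
      · rw [List.mem_singleton] at hp; right; rw [hp]

theorem exists_isPost_col (hv : v ∈ polytopeC n a) {r l m : ℕ} {t : List (ℕ × ℕ)}
    (ht : IsPost n (r + m, l) t) (hr : 1 ≤ r) :
    ∃ t', IsPost n (r, l) t' ∧ (t'.getLastD (r, l)).2 = (t.getLastD (r + m, l)).2 ∧
      coord v (r + m, l) + wt v t ≤ coord v (r, l) + wt v t' ∧ ∀ p ∈ t', p ∈ t ∨ p.2 = l := by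
  have hnn := coord_nonneg (mem_polytopeC.1 hv).1
  induction m generalizing t with
  | zero => exact ⟨t, ht, rfl, le_rfl, fun p hp => Or.inl hp⟩
  | succ m ih =>
    have hc := mem_pairsC.1 ht.mem_self
    simp only at hc
    obtain ⟨t', h1, h2, h3, h4⟩ := ih (t := (r + (m + 1), l) :: t)
      (IsPost.cons_iff.2 ⟨ht, Or.inl rfl, mem_pairsC.2 (by simp only; omega)⟩)
    refine ⟨t', h1, by rw [h2, List.getLastD_cons], ?_, fun p hp => ?_⟩
    · rw [wt_cons] at h3
      linarith [hnn (r + m, l)]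
    · rcases h4 p hp with h | h
      · rcases List.mem_cons.1 h with h | h
        · right; rw [h]
        · exact Or.inl h
      · exact Or.inr h

section Simple

variable (hreg : ∀ i, 1 ≤ i → i ≤ n → 0 < a i)
  (hv : IsSimpleVertex (polytopeC n a) v)
include hreg hv

theorem false_of_relation {k₁ k₂ k₃ k₄ : pairsC n ⊕ {d // IsDyckPathC n d}}
    (h₁ : ineq n k₁ v = ineqBound n a k₁) (h₂ : ineq n k₂ v = ineqBound n a k₂)
    (h₃ : ineq n k₃ v = ineqBound n a k₃) (h₄ : ineq n k₄ v = ineqBound n a k₄)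
    (hrel : ∀ u, ineq n k₁ u + ineq n k₂ u = ineq n k₃ u + ineq n k₄ u) (h13 : k₁ ≠ k₃)
    (h14 : k₁ ≠ k₄) : False := by
  rw [IsSimpleVertex, polytopeC_eq_polyhedron] at hv
  exact hv.2.false_of_relation (exists_facet_point_ineq hreg) hv.1.1 h₁ h₂ h₃ h₄
    (LinearMap.ext hrel) h13 h14

/-- Replacing c by c′ in a path yields −x_c + S(d) = −x_{c′} + S(e), a forbidden relation between
four tight inequalities. -/
theorem IsTight.false_of_flip {d e : List (ℕ × ℕ)} {c c' : ℕ × ℕ} (hd : IsTight n a v d)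
    (he : IsTight n a v e) (hc : c ∈ pairsC n) (hc' : c' ∈ pairsC n) (h0 : coord v c = 0)
    (h0' : coord v c' = 0) (hne : c ≠ c')
    (hrel : ∀ u : pairsC n → ℝ, wt u d - coord u c = wt u e - coord u c') : False := by
  refine false_of_relation hreg hv (k₁ := .inl ⟨c, hc⟩) (k₂ := .inr ⟨d, hd.1⟩)
    (k₃ := .inl ⟨c', hc'⟩) (k₄ := .inr ⟨e, he.1⟩) ?_ hd.2 ?_ he.2 (fun u => ?_) ?_ (by simp)
  · rw [ineq_inl, ineqBound, ← coord_of_mem v hc, h0, neg_zero]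
  · rw [ineq_inl, ineqBound, ← coord_of_mem v hc', h0', neg_zero]
  · have := hrel u
    rw [coord_of_mem u hc, coord_of_mem u hc'] at this
    simp only [ineq_inl, ineq_inr]
    linarith
  · simpa using hne

/-- If x_c = 0, the path through the opposite corner c′ of the unit square weighs at least as much;
it is therefore tight with x_{c′} = 0, and the flip is forbidden. -/
theorem IsTight.corner_pos {s t : List (ℕ × ℕ)} {p c p' : ℕ × ℕ}
    (h : IsTight n a v (s ++ p :: c :: p' :: t)) (h1 : p'.1 = p.1 + 1) (h2 : p'.2 = p.2 + 1) :
    0 < coord v c := by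
  have hP := hv.1.1
  have hnn := coord_nonneg (mem_polytopeC.1 hP).1
  refine lt_of_le_of_ne (hnn c) fun h0 => ?_
  have hpost := IsPost.cons_iff.1 h.isPost
  have hpost' := IsPost.cons_iff.1 hpost.1
  have hp := mem_pairsC.1 hpost.2.2
  have hc := mem_pairsC.1 hpost'.2.2
  have hp' := mem_pairsC.1 hpost'.1.mem_self
  have hflip : ∀ c' ∈ pairsC n, c' ≠ c → PathStep p c' → PathStep c' p' → False := by
    intro c' hc' hne hs1 hs2
    have hpost2 : IsPost n p (c' :: p' :: t) := IsPost.cons_iff.2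
      ⟨IsPost.cons_iff.2 ⟨hpost'.1, hs2, hc'⟩, hs1, hpost.2.2⟩
    have he := h.eq
    have hle := wt_le_of_isPre_of_isPost hP h.isPre hpost2
    simp only [wt_cons, List.getLastD_cons] at he hle
    have h0' : coord v c' = 0 := by linarith [hnn c']
    have ht : IsTight n a v (s ++ p :: c' :: p' :: t) :=
      isTight_append_cons hP h.isPre hpost2 (by
        simp only [wt_cons, List.getLastD_cons]; linarith)
    refine h.false_of_flip hreg hv ht hpost'.2.2 hc' h0.symm h0' hne.symm fun u => ?_
    simp only [wt_append, wt_cons]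
    ring
  obtain ⟨k, l⟩ := p
  obtain ⟨k', l'⟩ := p'
  simp only at h1 h2 hp hp'
  subst h1; subst h2
  rcases hpost.2.1 with rfl | rfl
  · exact hflip (k, l + 1) (mem_pairsC.2 (by simp only; omega)) (by simp) (Or.inr rfl) (Or.inl rfl)
  · rcases Nat.lt_or_ge (k + 1) l with hkl | hkl
    · exact hflip (k + 1, l) (mem_pairsC.2 (by simp only; omega)) (by simp) (Or.inl rfl)
        (Or.inr rfl)
    -- Here the opposite corner falls outside the triangle. Instead the path breaks into two tight
    -- paths at the top row, giving the relation −x_c + S(d) = S(d₁) + S(d₂).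
    · obtain rfl : l = k + 1 := by omega
      have hpre2 : IsPre n (k + 1, k + 1 + 1) [] := IsPre.nil hpost'.1.mem_self rfl
      have hpost2 : IsPost n (k, k + 1) [] := IsPost.nil hpost.2.2 (Or.inl rfl)
      have he := h.eq
      have hle1 := wt_le_of_isPre_of_isPost hP h.isPre hpost2
      have hle2 := wt_le_of_isPre_of_isPost hP hpre2 hpost'.1
      simp only [wt_cons, wt_nil, List.getLastD_cons, List.getLastD_nil, List.headD_nil]
        at he hle1 hle2
      have ht1 : IsTight n a v (s ++ [(k, k + 1)]) :=
        isTight_append_cons hP h.isPre hpost2 (by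
          simp only [wt_nil, List.getLastD_nil]; linarith)
      have ht2 : IsTight n a v ([] ++ (k + 1, k + 1 + 1) :: t) :=
        isTight_append_cons hP hpre2 hpost'.1 (by
          simp only [wt_nil, List.headD_nil]; linarith)
      refine false_of_relation hreg hv (k₁ := .inl ⟨_, hpost'.2.2⟩) (k₂ := .inr ⟨_, h.1⟩)
        (k₃ := .inr ⟨_, ht1.1⟩) (k₄ := .inr ⟨_, ht2.1⟩) ?_ h.2 ht1.2 ht2.2 (fun u => ?_)
        (by simp) (by simp)
      · rw [ineq_inl, ineqBound, ← coord_of_mem v hpost'.2.2, ← h0, neg_zero]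
      · simp only [ineq_inl, ineq_inr, wt_append, wt_cons, wt_nil, ← coord_of_mem u hpost'.2.2]
        ring

/-- The flip now exchanges the two possible end points on i + j = 2n+1 after p; the bound is the
same since Λ vanishes in both final columns. -/
theorem IsTight.last_pos {s : List (ℕ × ℕ)} {p c : ℕ × ℕ} (h : IsTight n a v (s ++ [p, c]))
    (h1 : c.1 + c.2 = 2 * n + 1) : 0 < coord v c := by
  have hP := hv.1.1
  have hnn := coord_nonneg (mem_polytopeC.1 hP).1
  refine lt_of_le_of_ne (hnn c) fun h0 => ?_
  have hpost := IsPost.cons_iff.1 h.isPost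
  have hp := mem_pairsC.1 hpost.2.2
  have hc := mem_pairsC.1 hpost.1.mem_self
  have hflip : ∀ c' ∈ pairsC n, c' ≠ c → c'.1 + c'.2 = 2 * n + 1 → PathStep p c' → False := by
    intro c' hc' hne hd hs1
    have hpost2 : IsPost n p [c'] := IsPost.cons_iff.2
      ⟨IsPost.nil hc' (Or.inr hd), hs1, hpost.2.2⟩
    have he := h.eq
    have hle := wt_le_of_isPre_of_isPost hP h.isPre hpost2
    rw [mem_pairsC] at hc'
    simp only [wt_cons, wt_nil, List.getLastD_cons, List.getLastD_nil,
      lam_eq_zero a (show n < c.2 by omega), lam_eq_zero a (show n < c'.2 by omega)] at he hle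
    have h0' : coord v c' = 0 := by linarith [hnn c']
    have ht : IsTight n a v (s ++ p :: [c']) :=
      isTight_append_cons hP h.isPre hpost2 (by
        simp only [wt_cons, wt_nil, List.getLastD_cons, List.getLastD_nil,
          lam_eq_zero a (show n < c'.2 by omega)]
        linarith)
    refine h.false_of_flip hreg hv ht hpost.1.mem_self (mem_pairsC.2 hc') h0.symm h0' hne.symm
      fun u => ?_
    simp only [wt_append, wt_cons]
    ring
  obtain ⟨k, l⟩ := p
  simp only at hp
  rcases hpost.2.1 with rfl | rfl <;> simp only at h1
  · exact hflip (k, l + 1) (mem_pairsC.2 (by simp only; omega)) (by simp) (by simp only; omega)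
      (Or.inr rfl)
  · exact hflip (k + 1, l) (mem_pairsC.2 (by simp only; omega)) (by simp) (by simp only; omega)
      (Or.inl rfl)

/-- Follow the first path into row k, continue along the row to column c₂ and leave with the second
path. Equal levels make this path tight with zero coordinate at its corner (k, c₂), against
`IsTight.corner_pos`. -/
theorem false_of_row_crossings {k c₁ c₂ : ℕ} {s₁ t₁ s₂ t₂ : List (ℕ × ℕ)}
    (h₁ : IsTight n a v (s₁ ++ (k, c₁) :: (k + 1, c₁) :: t₁))
    (h₂ : IsTight n a v (s₂ ++ (k, c₂) :: (k + 1, c₂) :: t₂)) (hc : c₁ < c₂)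
    (hl : levelOut n a v (k, c₁) = levelOut n a v (k, c₂)) : False := by
  have hP := hv.1.1
  have hC1 := mem_pairsC.1 h₁.isPre.mem_self
  have hC2 := mem_pairsC.1 h₂.isPre.mem_self
  simp only at hC1 hC2
  obtain ⟨m, rfl⟩ : ∃ m, c₂ = c₁ + m + 1 := ⟨c₂ - c₁ - 1, by omega⟩
  obtain ⟨s, g1, g2, g3, -⟩ := exists_isPre_row hP h₁.isPre m (mem_pairsC.2 (by simp only; omega))
  have hpost : IsPost n (k, c₁ + m) ((k, c₁ + m + 1) :: (k + 1, c₁ + m + 1) :: t₂) :=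
    IsPost.cons_iff.2 ⟨h₂.isPost, Or.inr rfl, g1.mem_self⟩
  rw [h₂.levelOut_eq hP, levelOut, h₁.levelIn_eq hP] at hl
  have hle := wt_le_of_isPre_of_isPost hP g1 hpost
  have hnn := coord_nonneg (mem_polytopeC.1 hP).1 (k, c₁ + m + 1)
  simp only [wt_cons, List.getLastD_cons, g2] at hle hl
  have ht := isTight_append_cons hP g1 hpost (by
    simp only [wt_cons, List.getLastD_cons, g2]; linarith)
  have := ht.corner_pos hreg hv rfl rfl
  linarith

theorem false_of_col_crossings {l r₁ r₂ : ℕ} {s₁ t₁ s₂ t₂ : List (ℕ × ℕ)}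
    (h₁ : IsTight n a v (s₁ ++ (r₁, l) :: (r₁, l + 1) :: t₁))
    (h₂ : IsTight n a v (s₂ ++ (r₂, l) :: (r₂, l + 1) :: t₂)) (hr : r₁ < r₂)
    (hl : levelOut n a v (r₁, l) = levelOut n a v (r₂, l)) : False := by
  have hP := hv.1.1
  obtain ⟨m, rfl⟩ : ∃ m, r₂ = r₁ + 1 + m := ⟨r₂ - r₁ - 1, by omega⟩
  obtain ⟨t, g1, g2, g3, -⟩ := exists_isPost_col hP h₂.assoc.isPost (by omega)
  have hmem := (IsPost.cons_iff.1 h₁.isPost).1.mem_self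
  have hpost : IsPost n (r₁, l) ((r₁, l + 1) :: (r₁ + 1, l + 1) :: t) :=
    IsPost.cons_iff.2 ⟨IsPost.cons_iff.2 ⟨g1, Or.inl rfl, hmem⟩, Or.inr rfl, h₁.isPre.mem_self⟩
  rw [h₂.levelOut_eq hP, levelOut, h₁.levelIn_eq hP] at hl
  have hle := wt_le_of_isPre_of_isPost hP h₁.isPre hpost
  have hnn := coord_nonneg (mem_polytopeC.1 hP).1 (r₁, l + 1)
  simp only [wt_cons, List.getLastD_cons, g2] at hle hl
  have ht := isTight_append_cons hP h₁.isPre hpost (by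
    simp only [wt_cons, List.getLastD_cons, g2]; linarith)
  have := ht.corner_pos hreg hv rfl rfl
  linarith

/-- Suppose all tight paths through (k+1,l) come from (k,l), and let τ be their level on entering
(k+1,l). By `false_of_row_crossings`, tight paths at level τ pass from row k to row k+1 only there.
Then `levelIn_iff_levelOut` applies to the pairs at level τ in rows ≤ k, with (k+1,l) added on the
In side only; at (k+1,l) itself this is absurd. -/
theorem IsTight.exists_other_entrance {k l : ℕ} {s₀ t₀ : List (ℕ × ℕ)}
    (h₀ : IsTight n a v (s₀ ++ (k, l) :: (k + 1, l) :: t₀)) (hpos : 0 < coord v (k + 1, l)) :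
    ∃ s t, IsTight n a v (s ++ (k + 1, l) :: t) ∧ (k, l) ∉ s := by
  have hP := hv.1.1
  have hnn := (mem_polytopeC.1 hP).1
  by_contra hcon
  push Not at hcon
  set τ := levelIn n a v (k + 1, l) with hτ
  have hq := h₀.assoc.isPre.mem_self
  have hqC := mem_pairsC.1 hq
  have hkC := mem_pairsC.1 h₀.isPre.mem_self
  simp only at hqC hkC
  have hτ0 : 0 < τ := by
    have h1 := h₀.assoc.levelOut_eq hP
    have h2 := lam_nonneg n a (t₀.getLastD (k + 1, l)).2
    have h3 := wt_nonneg hnn t₀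
    rw [levelOut, ← hτ] at h1
    linarith
  -- Tested with the path that starts in row k+1 and runs along it to (k+1,l): if τ were Λ_{k+1},
  -- this path would be tight and avoid (k,l). With 0 < τ, the strict bound keeps the level sets
  -- away from starts and ends of tight paths in rows ≤ k.
  have hτk : τ < lam n a (k + 1) := by
    obtain ⟨m, hm⟩ : ∃ m, l = k + 1 + 1 + m := ⟨l - (k + 1 + 1), by omega⟩
    obtain ⟨s, g1, g2, -, g4⟩ := exists_isPre_row hP (c := k + 1 + 1) (s := [])
      (IsPre.nil (q := (k + 1, k + 1 + 1)) (mem_pairsC.2 (by simp only; omega)) rfl) m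
      (by rw [← hm]; exact hq)
    rw [← hm] at g1 g2
    rw [List.headD_nil] at g2
    have hle := wt_le_of_isPre_of_isPost hP g1 h₀.assoc.isPost
    have h1 := h₀.assoc.levelOut_eq hP
    have h2 := wt_nonneg hnn s
    rw [levelOut, ← hτ] at h1
    rw [g2] at hle
    refine lt_of_le_of_ne (by linarith) fun heq => ?_
    have ht := isTight_append_cons hP g1 h₀.assoc.isPost (by rw [g2]; linarith)
    rcases g4 _ (hcon _ _ ht) with h | h
    · simp at h
    · simp only at h; omega
  have key := levelIn_iff_levelOut hv.1
    (fun x => levelIn n a v x = τ ∧ (x.1 ≤ k ∨ x = (k + 1, l)))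
    (fun x => levelOut n a v x = τ ∧ x.1 ≤ k) ?_ ?_ ?_ ?_ _ hq
  · have h1 := (key.1 ⟨rfl, Or.inr rfl⟩).2
    simp only at h1
    omega
  · intro x _ hx
    have hne : x ≠ (k + 1, l) := by rintro rfl; exact hpos.ne' hx
    simp only [levelOut, hx, sub_zero, hne, or_false]
  · rintro q t ht ⟨h1, h2⟩
    have h3 := IsTight.levelIn_eq (s := []) hP ht
    rcases h2 with h2 | rfl
    · simp only [List.headD_nil, wt_nil, sub_zero] at h3
      have := lam_antitone n a (show q.1 ≤ k + 1 by omega)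
      linarith
    · exact absurd (hcon [] t ht) (by simp)
  · rintro s q ht ⟨h1, h2⟩
    have h3 := ht.levelOut_eq hP
    simp only [wt_nil, List.getLastD_nil, add_zero] at h3
    have h4 := ht.isPost.last
    rw [List.getLastD_nil] at h4
    have h5 := mem_pairsC.1 ht.isPre.mem_self
    rcases h4 with h4 | h4
    · have := lam_antitone n a (show q.2 ≤ k + 1 by omega)
      linarith
    · rw [lam_eq_zero a (show n < q.2 by omega)] at h3
      linarith
  · intro s x x' t ht
    have hstep := (IsPost.cons_iff.1 ht.isPost).2.1
    rw [← ht.levelIn_next hP]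
    refine and_congr_right fun hlev => ⟨fun h => ?_, fun h => ?_⟩
    · by_cases hx' : x'.1 ≤ k
      · exact Or.inl hx'
      · right
        rcases hstep with rfl | rfl
        · obtain ⟨r, c⟩ := x
          simp only at h hx' ⊢
          obtain rfl : r = k := by omega
          have h3 : levelOut n a v (r, c) = levelOut n a v (r, l) := by
            rw [← ht.levelIn_next hP, hlev, hτ, h₀.levelIn_next hP]
          rcases lt_trichotomy c l with hcl | hcl | hcl
          · exact (false_of_row_crossings hreg hv ht h₀ hcl h3).elim
          · rw [hcl]
          · exact (false_of_row_crossings hreg hv h₀ ht hcl h3.symm).elim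
        · exact absurd h hx'
    · rcases h with h | rfl
      · exact hstep.precedes.1.trans h
      · rcases List.mem_append.1 (hcon _ _ ht.assoc) with h4 | h4
        · have := (ht.isPre.precedes _ h4).2.2
          simp only at this
          rcases hstep with h5 | h5 <;> simp only [Prod.mk.injEq] at h5 <;> omega
        · rw [List.mem_singleton] at h4; rw [← h4]

/-- The mirror image of `IsTight.exists_other_entrance`, with columns > l in place of rows ≤ k. The
test path for Λ_l < τ descends column l as far as possible, so only this one bound on τ is required.
-/
theorem IsTight.exists_other_exit {r l : ℕ} {s₀ t₀ : List (ℕ × ℕ)}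
    (h₀ : IsTight n a v (s₀ ++ (r, l) :: (r, l + 1) :: t₀)) (hpos : 0 < coord v (r, l)) :
    ∃ s t, IsTight n a v (s ++ (r, l) :: t) ∧ (r, l + 1) ∉ t := by
  have hP := hv.1.1
  have hnn := (mem_polytopeC.1 hP).1
  by_contra hcon
  push Not at hcon
  set τ := levelOut n a v (r, l) with hτ
  have hq := h₀.isPre.mem_self
  have hqC := mem_pairsC.1 hq
  simp only at hqC
  have hτl : lam n a l < τ := by
    obtain ⟨m, hm⟩ : ∃ m, min (l - 1) (2 * n + 1 - l) = r + m :=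
      ⟨min (l - 1) (2 * n + 1 - l) - r, by omega⟩
    obtain ⟨t, g1, g2, -, g4⟩ := exists_isPost_col hP (r := r) (l := l) (m := m) (t := [])
      (IsPost.nil (mem_pairsC.2 (by simp only; omega)) (by simp only; omega)) hqC.1
    rw [List.getLastD_nil] at g2
    have hle := wt_le_of_isPre_of_isPost hP h₀.isPre g1
    have h1 := h₀.levelIn_eq hP
    have h2 := wt_nonneg hnn t
    have h3 : τ = levelIn n a v (r, l) - coord v (r, l) := rfl
    rw [g2] at hle
    refine lt_of_le_of_ne (by linarith) fun heq => ?_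
    have ht := isTight_append_cons hP h₀.isPre g1 (by rw [g2]; linarith)
    rcases g4 _ (hcon _ _ ht) with h | h
    · simp at h
    · simp only at h; omega
  have key := levelIn_iff_levelOut hv.1
    (fun x => levelIn n a v x = τ ∧ l + 1 ≤ x.2)
    (fun x => levelOut n a v x = τ ∧ (l + 1 ≤ x.2 ∨ x = (r, l))) ?_ ?_ ?_ ?_ _ hq
  · have h1 := (key.2 ⟨rfl, Or.inr rfl⟩).2
    simp only at h1
    omega
  · intro x _ hx
    have hne : x ≠ (r, l) := by rintro rfl; exact hpos.ne' hx
    simp only [levelOut, hx, sub_zero, hne, or_false]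
  · rintro q t ht ⟨h1, h2⟩
    have h3 := IsTight.levelIn_eq (s := []) hP ht
    have h4 := (IsTight.isPre (s := []) ht).top
    simp only [List.headD_nil, wt_nil, sub_zero] at h3 h4
    have := lam_antitone n a (show l ≤ q.1 by omega)
    linarith
  · rintro s q ht ⟨h1, h2⟩
    have h3 := ht.levelOut_eq hP
    simp only [wt_nil, List.getLastD_nil, add_zero] at h3
    rcases h2 with h2 | rfl
    · have := lam_antitone n a (show l ≤ q.2 by omega)
      linarith
    · exact absurd (hcon s [] ht) (by simp)
  · intro s x x' t ht
    have hstep := (IsPost.cons_iff.1 ht.isPost).2.1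
    rw [← ht.levelIn_next hP]
    refine and_congr_right fun hlev => ⟨fun h => ?_, fun h => ?_⟩
    · rcases h with h | rfl
      · exact h.trans hstep.precedes.2.1
      · rcases List.mem_cons.1 (hcon _ _ ht) with h4 | h4
        · rw [← h4]
        · have := (ht.assoc.isPost.precedes _ h4).2.2
          simp only at this
          rcases hstep with rfl | rfl <;> simp only at this <;> omega
    · by_cases hx : l + 1 ≤ x.2
      · exact Or.inl hx
      · right
        rcases hstep with rfl | rfl
        · exact absurd h hx
        · obtain ⟨c, l'⟩ := x
          simp only at h hx ⊢
          obtain rfl : l' = l := by omega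
          have h3 : levelOut n a v (c, l') = levelOut n a v (r, l') := by
            rw [← ht.levelIn_next hP, hlev, hτ]
          rcases lt_trichotomy c r with hcl | hcl | hcl
          · exact (false_of_col_crossings hreg hv ht h₀ hcl h3).elim
          · rw [hcl]
          · exact (false_of_col_crossings hreg hv h₀ ht hcl h3.symm).elim

/-- Tight paths at a simple vertex have no valleys. -/
theorem IsTight.no_valley {k l : ℕ} {s t : List (ℕ × ℕ)}
    (h : IsTight n a v (s ++ (k, l) :: (k + 1, l) :: (k + 1, l + 1) :: t)) : False := by
  have hP := hv.1.1
  have hpos := h.corner_pos hreg hv rfl rfl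
  obtain ⟨s₁, t₁, h₁, hs₁⟩ := h.exists_other_entrance hreg hv hpos
  obtain ⟨s₂, t₂, h₂, ht₂⟩ := h.assoc.exists_other_exit hreg hv hpos
  have hX := h.assoc.swap hP h₂
  have hY := h₁.swap hP h.assoc
  have hW := h₁.swap hP h₂
  -- Two prefixes and two suffixes at the same entry give four tight paths; the sums over opposite
  -- pairs agree.
  refine false_of_relation hreg hv (k₁ := .inr ⟨_, h.assoc.1⟩) (k₂ := .inr ⟨_, hW.1⟩)
    (k₃ := .inr ⟨_, hX.1⟩) (k₄ := .inr ⟨_, hY.1⟩) h.assoc.2 hW.2 hX.2 hY.2 (fun u => ?_) ?_ ?_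
  · simp only [ineq_inr, wt_append, wt_cons]
    ring
  · intro heq
    simp only [Sum.inr.injEq, Subtype.mk.injEq, List.append_cancel_left_eq,
      List.cons.injEq, true_and] at heq
    rw [← heq] at ht₂
    simp at ht₂
  · intro heq
    simp only [Sum.inr.injEq, Subtype.mk.injEq, List.append_cancel_right_eq] at heq
    rw [← heq] at hs₁
    simp at hs₁

end Simple

end FFLV

/-! ### The support of a simple vertex is admissible. -/

namespace FFLV

variable {n : ℕ} {a : ℕ → ℕ} {v : pairsC n → ℝ}

theorem getLastD_snd_eq_of_no_valley {b c : ℕ × ℕ} {t : List (ℕ × ℕ)}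
    (h : (b :: c :: t).IsChain PathStep) (hbc : c = (b.1 + 1, b.2))
    (hno : ∀ s k l t', b :: c :: t ≠ s ++ (k, l) :: (k + 1, l) :: (k + 1, l + 1) :: t') :
    ((c :: t).getLastD b).2 = b.2 := by
  induction t generalizing b c with
  | nil => simp [hbc]
  | cons c' t ih =>
    have h1 := List.isChain_cons_cons.1 h
    rw [List.getLastD_cons]
    rcases (List.isChain_cons_cons.1 h1.2).1 with h2 | h2
    · rw [ih h1.2 h2 fun s k l t' he => hno (b :: s) k l t' (by rw [he]; rfl), hbc]
    · exfalso
      refine hno [] b.1 b.2 t ?_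
      rw [h2, hbc]
      rfl

theorem mem_of_no_valley {b : ℕ × ℕ} {t : List (ℕ × ℕ)} (h : (b :: t).IsChain PathStep)
    (hno : ∀ s k l t', b :: t ≠ s ++ (k, l) :: (k + 1, l) :: (k + 1, l + 1) :: t') :
    (b.1, (t.getLastD b).2) ∈ b :: t := by
  induction t generalizing b with
  | nil => simp
  | cons c t ih =>
    have h1 := List.isChain_cons_cons.1 h
    rcases h1.1 with h2 | h2
    · rw [getLastD_snd_eq_of_no_valley h h2 hno]; simp
    · have h3 := ih h1.2 fun s k l t' he => hno (b :: s) k l t' (by rw [he]; rfl)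
      rw [List.getLastD_cons]
      rw [h2] at h3 ⊢
      exact List.mem_cons_of_mem _ h3

section Simple

variable (hreg : ∀ i, 1 ≤ i → i ≤ n → 0 < a i)
  (hv : IsSimpleVertex (polytopeC n a) v)
include hreg hv

theorem IsTight.corner_mem {d : List (ℕ × ℕ)} (h : IsTight n a v d) :
    (source d, sink d) ∈ d := by
  obtain ⟨b, t, rfl, -, hpost⟩ := h.1.exists_eq_cons
  rw [source, sink, List.headD_cons, List.getLastD_cons]
  refine mem_of_no_valley hpost.chain fun s k l t' he => ?_
  rw [he] at h
  exact h.no_valley hreg hv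

/-- The corner is either the whole path, whose bound is positive, or the last entry on i + j = 2n+1,
or a genuine turn; the last two are `IsTight.last_pos` and `IsTight.corner_pos`. -/
theorem IsTight.corner_coord_pos {d : List (ℕ × ℕ)} (h : IsTight n a v d) :
    0 < coord v (source d, sink d) := by
  have hmem := h.corner_mem hreg hv
  obtain ⟨p, hp⟩ : ∃ p, p = (source d, sink d) := ⟨_, rfl⟩
  rw [← hp] at hmem ⊢
  have hpC := mem_pairsC.1 (h.1.mem_pairs p hmem)
  have hp1 : p.1 = source d := by rw [hp]
  have hp2 : p.2 = sink d := by rw [hp]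
  have hsrc : ∀ q ∈ d, p.1 ≤ q.1 := fun q hq => hp1 ▸ h.1.source_le hq
  have hsnk : ∀ q ∈ d, q.2 ≤ p.2 := fun q hq => hp2 ▸ h.1.le_sink hq
  obtain ⟨s, t, rfl⟩ := List.append_of_mem hmem
  have hnext : ∀ y ∈ t, PathStep p y → y = (p.1 + 1, p.2) := by
    intro y hy hs
    rcases hs with hs | hs
    · exact hs
    · have := hsnk y (by simp [hy])
      rw [hs] at this; simp only at this; omega
  rcases List.eq_nil_or_concat' s with rfl | ⟨s, x, rfl⟩
  · have htop := h.isPre.top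
    rw [List.headD_nil] at htop
    cases t with
    | nil =>
      have h1 := h.2
      have h2 := pathBound_pos hreg h.1
      simp only [List.nil_append, wt_cons, wt_nil, add_zero] at h1 h2
      rw [h1]; exact h2
    | cons y t =>
      exfalso
      have h1 := (IsPost.cons_iff.1 h.isPost)
      have h2 := mem_pairsC.1 h1.1.mem_self
      rw [hnext y (by simp) h1.2.1] at h2
      simp only at h2; omega
  · simp only [List.append_assoc, List.singleton_append] at h hsrc hsnk
    have hstep := (IsPost.cons_iff.1 h.isPost).2.1
    have hxC := mem_pairsC.1 h.isPre.mem_self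
    have hx := hsrc x (by simp)
    have hxp : p = (x.1, x.2 + 1) := by
      rcases hstep with h1 | h1
      · rw [h1] at hx; simp only at hx; omega
      · exact h1
    cases t with
    | nil =>
      refine h.last_pos hreg hv ?_
      have := h.assoc.isPost.last
      rw [List.getLastD_nil] at this
      rcases this with h1 | h1
      · rw [hxp] at h1; simp only at h1; omega
      · exact h1
    | cons y t =>
      have h1 := (IsPost.cons_iff.1 h.assoc.isPost).2.1
      have h2 := hnext y (by simp) h1
      exact h.corner_pos hreg hv (by rw [h2, hxp]) (by rw [h2, hxp])

/-- The support of `v`, as a set of pairs. -/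
noncomputable def _root_.FFLV.support (v : pairsC n → ℝ) : Finset (ℕ × ℕ) := by
  classical exact (pairsC n).filter (fun p => 0 < coord v p)

omit hreg hv in
theorem mem_support {p : ℕ × ℕ} : p ∈ support v ↔ 0 < coord v p := by
  classical
  rw [support, Finset.mem_filter, and_iff_right_iff_imp]
  intro h
  by_contra hp
  rw [coord_of_notMem v hp] at h
  exact lt_irrefl _ h

omit hreg hv in
theorem support_subset : support v ⊆ pairsC n := by
  classical
  exact Finset.filter_subset _ _

theorem IsTight.eq_hookC_of_support {d : List (ℕ × ℕ)} (h : IsTight n a v d) :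
    ∃ p ∈ support v, d = hookC n p.1 p.2 :=
  ⟨_, mem_support.2 (h.corner_coord_pos hreg hv), h.1.eq_hookC (h.corner_mem hreg hv)⟩

theorem isTight_hookC {p : ℕ × ℕ} (hp : p ∈ support v) : IsTight n a v (hookC n p.1 p.2) := by
  classical
  by_contra hcon
  have hpC := support_subset hp
  -- If the hook at p is not tight, the vector u supported on the support of v, with hook sum 1 at p
  -- and 0 at its other pairs, satisfies all tight equations homogeneously. Extremality gives u = 0,
  -- a contradiction.
  obtain ⟨u, hu, -⟩ := existsUnique_wt_hookC (n := n) (support v)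
    (fun r => if r.1 = p then 1 else 0)
  have hv' := hv.1
  rw [polytopeC_eq_polyhedron] at hv'
  have h0 : u = 0 := by
    refine eq_zero_of_mem_extremePoints hv' ?_
    rintro (q | ⟨d, hd⟩) hk
    · rw [ineq_inl, (hu q).1, neg_zero]
      rw [mem_support, coord_coe]
      rw [ineq_inl, ineqBound] at hk
      linarith
    · have ht : IsTight n a v d := ⟨hd, hk⟩
      obtain ⟨r, hr, rfl⟩ := ht.eq_hookC_of_support hreg hv
      have hne : r ≠ p := by rintro rfl; exact hcon ht
      rw [ineq_inr, (hu ⟨r, support_subset hr⟩).2 hr, if_neg hne]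
  have h1 := (hu ⟨p, hpC⟩).2 hp
  rw [if_pos rfl, h0, wt_hookC] at h1
  simp [rowSum, colSum, coord] at h1

/-- The support of a simple vertex is admissible. -/
theorem isAdmissible_support : IsAdmissible n (support v) := by
  have hP := hv.1.1
  refine ⟨support_subset, ?_, ?_⟩
  · rintro ⟨i, j⟩ hp ⟨k, l⟩ hr hik hkj
    simp only at hik hkj ⊢
    by_contra hlj
    push Not at hlj
    have hpC := support_subset hp
    have hrC := support_subset hr
    have h1 := isTight_hookC hreg hv hp
    have h2 := isTight_hookC hreg hv hr
    simp only at h1 h2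
    have e1 := source_hookC hpC
    have e2 := sink_hookC hrC
    simp only at e1 e2
    have e3 := getLastD_hookC (mem_pairsC.1 hpC).2.1 (mem_pairsC.1 hpC).2.2
    have e4 := headD_hookC (n := n) (mem_pairsC.1 hrC).2.1
    rw [mem_pairsC] at hpC hrC
    simp only at hpC hrC e3 e4
    rcases hkj.eq_or_lt with rfl | hkj
    -- The segments touch in the point k. The first hook ends at (k−1,k), the second starts at
    -- (k,k+1), and joining them through (k−1,k+1) gives a tight path with zero coordinate at a
    -- corner.
    · obtain ⟨b, t, h3, -, -⟩ := h2.1.exists_eq_cons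
      rw [h3, List.headD_cons] at e4
      have h4 : hookC n i k = (hookC n i k).dropLast ++ [(k - 1, k)] := by
        have := (List.dropLast_append_getLast h1.1.ne_nil).symm
        rw [getLast_eq_getLastD', e3, min_eq_left (by omega)] at this
        exact this
      generalize (hookC n i k).dropLast = s at h4
      subst e4
      rw [h4] at h1
      rw [h3] at h2
      obtain ⟨m, rfl⟩ : ∃ m, k = m + 1 := ⟨k - 1, by omega⟩
      rw [Nat.add_sub_cancel] at h1
      have h2' : IsTight n a v ([] ++ (m + 1, m + 1 + 1) :: t) := h2
      have hc : (m, m + 1 + 1) ∈ pairsC n := mem_pairsC.2 (by simp only; omega)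
      have hpost : IsPost n (m, m + 1) ((m, m + 1 + 1) :: (m + 1, m + 1 + 1) :: t) :=
        IsPost.cons_iff.2 ⟨IsPost.cons_iff.2 ⟨h2'.isPost, Or.inl rfl, hc⟩, Or.inr rfl,
          h1.isPre.mem_self⟩
      have hle := wt_le_of_isPre_of_isPost hP h1.isPre hpost
      have hnn := coord_nonneg (mem_polytopeC.1 hP).1 (m, m + 1 + 1)
      have g1 := h1.eq
      have g2 := h2'.eq
      simp only [wt_cons, wt_nil, List.getLastD_cons, List.getLastD_nil, List.headD_nil]
        at hle g1 g2
      have ht := isTight_append_cons hP h1.isPre hpost (by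
        simp only [wt_cons, List.getLastD_cons]; linarith)
      have := ht.corner_pos hreg hv rfl rfl
      linarith
    · have m1 : (k, j) ∈ hookC n i j := mem_hookC.2 (Or.inr ⟨rfl, hik, hkj, by omega⟩)
      have m2 : (k, j) ∈ hookC n k l := mem_hookC.2 (Or.inl ⟨rfl, hkj, hlj.le⟩)
      obtain ⟨s, t, h3⟩ := List.append_of_mem m1
      obtain ⟨s', t', h4⟩ := List.append_of_mem m2
      rw [h3] at h1 e1
      rw [h4] at h2 e2
      -- The hooks cross at (k,j). Switching there from the first to the second gives a tight path
      -- from row i to column l, which must contain (i,l); but (i,l) and (k,j) are incomparable.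
      have h5 := h1.swap hP h2
      have h6 := h5.corner_mem hreg hv
      rw [source, headD_append_cons] at e1 h6
      rw [sink, getLastD_append_cons] at e2 h6
      rw [e1, e2] at h6
      have h7 := h5.1.trichotomy h6 (show (k, j) ∈ s ++ (k, j) :: t' by simp)
      simp only [Precedes, Prod.mk.injEq] at h7
      omega
  · rintro ⟨i, j⟩ hp hj
    simp only at hj ⊢
    have hpC := support_subset hp
    have h1 := isTight_hookC hreg hv hp
    simp only at h1
    have e3 := getLastD_hookC (mem_pairsC.1 hpC).2.1 (mem_pairsC.1 hpC).2.2
    have hmem := self_mem_hookC hpC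
    rw [mem_pairsC] at hpC
    simp only at hpC e3 hmem
    rw [min_eq_right (by omega)] at e3
    have h4 : hookC n i j = (hookC n i j).dropLast ++ [(2 * n + 1 - j, j)] := by
      have := (List.dropLast_append_getLast h1.1.ne_nil).symm
      rw [getLast_eq_getLastD', e3] at this
      exact this
    generalize (hookC n i j).dropLast = s at h4
    rw [h4] at h1 hmem
    rcases List.eq_nil_or_concat' s with rfl | ⟨s, x, rfl⟩
    · simp only [List.nil_append, List.mem_singleton, Prod.mk.injEq, and_true] at hmem
      rwa [← hmem]
    · rw [List.append_assoc, List.singleton_append] at h1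
      exact mem_support.2 (h1.last_pos hreg hv (by simp only; omega))

theorem isHookPoint_support : IsHookPoint n a (support v) v := by
  have hnn := coord_nonneg (mem_polytopeC.1 hv.1.1).1
  refine ⟨fun p hp => ?_, fun p hp => ?_⟩
  · rw [mem_support] at hp
    exact le_antisymm (not_lt.1 hp) (hnn p)
  · rw [← wt_hookC, (isTight_hookC hreg hv hp).2, pathBound_hookC a (support_subset hp)]

end Simple

end FFLV

/-! ### Symmetric sets of segments and the comparison with type A through φ. -/

namespace FFLV

variable {n : ℕ} {a : ℕ → ℕ} {E F : Finset (ℕ × ℕ)}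

/-- The segments `[i, j]` in `E` with `i + j ≤ 2n + 1`. -/
def lowerHalf (n : ℕ) (E : Finset (ℕ × ℕ)) : Finset (ℕ × ℕ) :=
  E.filter (fun p => p.1 + p.2 ≤ 2 * n + 1)

theorem mem_lowerHalf {p : ℕ × ℕ} : p ∈ lowerHalf n E ↔ p ∈ E ∧ p.1 + p.2 ≤ 2 * n + 1 := by
  simp [lowerHalf]

/-- The symmetric set of segments with the lower half `F`. -/
def symmetrization (n : ℕ) (F : Finset (ℕ × ℕ)) : Finset (ℕ × ℕ) :=
  F ∪ F.image (fun p => (2 * n + 1 - p.2, 2 * n + 1 - p.1))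

theorem isAdmissible_lowerHalf (hE : E ∈ simpleSetsC n) : IsAdmissible n (lowerHalf n E) := by
  obtain ⟨⟨hsub, hcap⟩, hsymm, hlam⟩ := hE
  refine ⟨fun p hp => ?_, fun p hp r hr h1 h2 => ?_, fun p hp h1 => ?_⟩
  · rw [mem_lowerHalf] at hp
    have := mem_pairsA.1 (hsub hp.1)
    exact mem_pairsC.2 ⟨this.1, this.2.1, hp.2⟩
  · rw [mem_lowerHalf] at hp hr
    have hpA := mem_pairsA.1 (hsub hp.1)
    have hrA := mem_pairsA.1 (hsub hr.1)
    rcases hlam p hp.1 r hr.1 hp.2 hr.2 with h | h | h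
    · exact absurd (Finset.mem_Icc.2 ⟨le_rfl, hrA.2.1.le⟩)
        (Finset.disjoint_left.1 h (Finset.mem_Icc.2 ⟨h1.le, h2⟩))
    · have := Finset.mem_Icc.1 (h (Finset.mem_Icc.2 ⟨le_rfl, hpA.2.1.le⟩))
      omega
    · exact (Finset.mem_Icc.1 (h (Finset.mem_Icc.2 ⟨hrA.2.1.le, le_rfl⟩))).2
  · rw [mem_lowerHalf] at hp
    have hpA := mem_pairsA.1 (hsub hp.1)
    -- The diagonal segment [2n+1−j, j] is the intersection of [i,j] with its own reflection.
    have h2 := hcap p hp.1 _ (hsymm p hp.1) (by simp only; omega)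
    simp only at h2
    rw [max_eq_right (by omega), min_eq_left (by omega)] at h2
    rw [mem_lowerHalf]
    exact ⟨h2, by simp only; omega⟩

theorem mem_symmetrization {p : ℕ × ℕ} (hF : F ⊆ pairsC n) : p ∈ symmetrization n F ↔
    p ∈ F ∨ (1 ≤ p.1 ∧ p.1 < p.2 ∧ p.2 ≤ 2 * n ∧ (2 * n + 1 - p.2, 2 * n + 1 - p.1) ∈ F) := by
  simp only [symmetrization, Finset.mem_union, Finset.mem_image]
  refine or_congr Iff.rfl ⟨?_, fun h => ⟨_, h.2.2.2, ?_⟩⟩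
  · rintro ⟨q, hq, rfl⟩
    have := mem_pairsC.1 (hF hq)
    simp only
    have h1 : 2 * n + 1 - (2 * n + 1 - q.1) = q.1 := by omega
    have h2 : 2 * n + 1 - (2 * n + 1 - q.2) = q.2 := by omega
    rw [h1, h2]
    exact ⟨by omega, by omega, by omega, hq⟩
  · ext <;> simp only <;> omega

theorem lowerHalf_symmetrization (hF : F ⊆ pairsC n) : lowerHalf n (symmetrization n F) = F := by
  ext p
  rw [mem_lowerHalf, mem_symmetrization hF]
  constructor
  · rintro ⟨h | ⟨h1, h2, h3, h4⟩, h5⟩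
    · exact h
    · have := mem_pairsC.1 (hF h4)
      simp only at this
      have e : (2 * n + 1 - p.2, 2 * n + 1 - p.1) = p := by ext <;> simp only <;> omega
      rwa [e] at h4
  · intro h
    exact ⟨Or.inl h, (mem_pairsC.1 (hF h)).2.2⟩

theorem isSymmetric_symmetrization (hF : F ⊆ pairsC n) : IsSymmetric n (symmetrization n F) := by
  intro s hs
  rw [mem_symmetrization hF] at hs ⊢
  rcases hs with h | h
  · right
    have := mem_pairsC.1 (hF h)
    have e : (2 * n + 1 - (2 * n + 1 - s.1), 2 * n + 1 - (2 * n + 1 - s.2)) = s := by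
      ext <;> simp only <;> omega
    simp only
    rw [e]
    exact ⟨by omega, by omega, by omega, h⟩
  · exact Or.inl h.2.2.2

theorem IsAdmissible.inter_mem (hF : IsAdmissible n F) {s t : ℕ × ℕ} (hs : s ∈ F) (ht : t ∈ F)
    (h : max s.1 t.1 ≤ min s.2 t.2) : (max s.1 t.1, min s.2 t.2) ∈ F := by
  have key : ∀ s ∈ F, ∀ t ∈ F, s.1 ≤ t.1 → t.1 ≤ s.2 →
      (max s.1 t.1, min s.2 t.2) ∈ F := by
    intro s hs t ht h1 h2
    rw [max_eq_right h1]
    rcases h1.eq_or_lt with h3 | h3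
    · rcases le_total s.2 t.2 with h4 | h4
      · rw [min_eq_left h4, ← h3]; exact hs
      · rw [min_eq_right h4]; exact ht
    · rw [min_eq_right (hF.nested s hs t ht h3 h2)]; exact ht
  have h1 := (le_max_left s.1 t.1).trans (h.trans (min_le_right _ _))
  have h2 := (le_max_right s.1 t.1).trans (h.trans (min_le_left _ _))
  rcases le_total s.1 t.1 with h3 | h3
  · exact key s hs t ht h3 h2
  · rw [max_comm, min_comm]
    exact key t ht s hs h3 h1

/-- The intersection of a segment in `F` with the reflection of another one. -/
theorem IsAdmissible.inter_reflection_mem (hF : IsAdmissible n F) {s t : ℕ × ℕ} (hs : s ∈ F)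
    (ht : t ∈ F) (h : max s.1 (2 * n + 1 - t.2) ≤ min s.2 (2 * n + 1 - t.1)) :
    (max s.1 (2 * n + 1 - t.2), min s.2 (2 * n + 1 - t.1)) ∈ symmetrization n F := by
  rw [mem_symmetrization hF.subset]
  obtain ⟨i, j⟩ := s
  obtain ⟨k, l⟩ := t
  have hsC := mem_pairsC.1 (hF.subset hs)
  have htC := mem_pairsC.1 (hF.subset ht)
  simp only at *
  have hleft : ∀ x y, x = i → y = j → (x, y) ∈ F := by rintro _ _ rfl rfl; exact hs
  have hright : ∀ x y, x = 2 * n + 1 - l → y = 2 * n + 1 - k →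
      1 ≤ x ∧ x < y ∧ y ≤ 2 * n ∧ (2 * n + 1 - y, 2 * n + 1 - x) ∈ F := by
    rintro _ _ rfl rfl
    have h1 : 2 * n + 1 - (2 * n + 1 - k) = k := by omega
    have h2 : 2 * n + 1 - (2 * n + 1 - l) = l := by omega
    rw [h1, h2]
    exact ⟨by omega, by omega, by omega, ht⟩
  -- In all cases the intersection is s, the reflection of t, or, when j = l, the central segment
  -- [2n+1−j, j] supplied by the diagonal condition.
  rcases le_or_gt l n with hl | hl
  · rcases le_or_gt j n with hj | hj
    · omega
    · have hD := hF.diagonal _ hs hj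
      simp only at hD
      have h1 : 2 * n + 1 - j ≤ k := by
        by_contra hc
        have := hF.nested _ ht _ hD (by simp only; omega) (by simp only; omega)
        simp only at this; omega
      exact Or.inr (hright _ _ (by omega) (by omega))
  · have hD := hF.diagonal _ ht hl
    simp only at hD
    rcases le_or_gt (2 * n + 1 - l) i with h1 | h1
    · rcases le_or_gt j (2 * n + 1 - k) with h2 | h2
      · exact Or.inl (hleft _ _ (by omega) (by omega))
      · have hj : n < j := by omega
        have hD' := hF.diagonal _ hs hj
        simp only at hD'
        have h3 := hF.nested _ ht _ hD'
        simp only at h3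
        rcases lt_or_ge k (2 * n + 1 - j) with h4 | h4
        · omega
        · have h5 := hF.nested _ hs _ ht
          simp only at h5
          rcases lt_or_ge i k with h6 | h6
          · have := h5 h6 (by omega)
            exact Or.inr (hright _ _ (by omega) (by omega))
          · omega
    · have h2 := hF.nested _ hs _ hD
      simp only at h2
      have hlj := h2 h1 (by omega)
      have hj : n < j := by omega
      have hD' := hF.diagonal _ hs hj
      simp only at hD'
      rcases lt_or_ge k (2 * n + 1 - j) with h4 | h4
      · have h3 := hF.nested _ ht _ hD'
        simp only at h3
        have := h3 h4 (by omega)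
        obtain rfl : l = j := by omega
        left
        rw [max_eq_right (by omega), min_eq_left (by omega)]
        exact hD
      · exact Or.inr (hright _ _ (by omega) (by omega))

theorem symmetrization_mem_simpleSetsC (hF : IsAdmissible n F) :
    symmetrization n F ∈ simpleSetsC n := by
  have hsub := hF.subset
  have hsymm := isSymmetric_symmetrization hsub
  refine ⟨⟨fun p hp => ?_, fun s hs t ht h => ?_⟩, hsymm, fun s hs t ht h1 h2 => ?_⟩
  · rw [mem_pairsA]
    rcases (mem_symmetrization hsub).1 hp with h | h
    · have := mem_pairsC.1 (hsub h); omega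
    · exact ⟨h.1, h.2.1, h.2.2.1⟩
  · rcases (mem_symmetrization hsub).1 hs with hs | ⟨hs1, hs2, hs3, hs⟩ <;>
      rcases (mem_symmetrization hsub).1 ht with ht | ⟨ht1, ht2, ht3, ht⟩
    · exact (mem_symmetrization hsub).2 (Or.inl (hF.inter_mem hs ht h))
    · have e1 : 2 * n + 1 - (2 * n + 1 - t.1) = t.1 := by omega
      have e2 : 2 * n + 1 - (2 * n + 1 - t.2) = t.2 := by omega
      have := hF.inter_reflection_mem hs ht
      simp only [e1, e2] at this
      exact this h
    · have e1 : 2 * n + 1 - (2 * n + 1 - s.1) = s.1 := by omega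
      have e2 : 2 * n + 1 - (2 * n + 1 - s.2) = s.2 := by omega
      have := hF.inter_reflection_mem ht hs
      simp only [e1, e2] at this
      rw [max_comm, min_comm] at h ⊢
      exact this h
    · have h1 := hF.inter_mem hs ht (by simp only; omega)
      refine (mem_symmetrization hsub).2 (Or.inr ⟨by simp only; omega, ?_, by simp only; omega, ?_⟩)
      · have := mem_pairsC.1 (hsub h1)
        simp only at this ⊢; omega
      · have e : (2 * n + 1 - min s.2 t.2, 2 * n + 1 - max s.1 t.1) =
            (max (2 * n + 1 - s.2) (2 * n + 1 - t.2), min (2 * n + 1 - s.1) (2 * n + 1 - t.1)) := by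
          ext <;> simp only <;> omega
        simp only
        rw [e]; exact h1
  · have hs' : s ∈ F := by
      rw [← lowerHalf_symmetrization hsub, mem_lowerHalf]; exact ⟨hs, h1⟩
    have ht' : t ∈ F := by
      rw [← lowerHalf_symmetrization hsub, mem_lowerHalf]; exact ⟨ht, h2⟩
    have n1 := hF.nested s hs' t ht'
    have n2 := hF.nested t ht' s hs'
    rcases lt_or_ge s.2 t.1 with g | g
    · left
      rw [Finset.disjoint_left]
      intro z hz hz'
      rw [Finset.mem_Icc] at hz hz'; omega
    rcases lt_or_ge t.2 s.1 with g' | g'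
    · left
      rw [Finset.disjoint_left]
      intro z hz hz'
      rw [Finset.mem_Icc] at hz hz'; omega
    right
    rcases lt_trichotomy s.1 t.1 with g2 | g2 | g2
    · exact Or.inr (Finset.Icc_subset_Icc g2.le (n1 g2 g))
    · rcases le_total s.2 t.2 with g3 | g3
      · exact Or.inl (Finset.Icc_subset_Icc g2.ge g3)
      · exact Or.inr (Finset.Icc_subset_Icc g2.le g3)
    · exact Or.inl (Finset.Icc_subset_Icc g2.le (n2 g2 g'))

/-- The coordinates of `φ(x)`, extended to all pairs. -/
noncomputable def phiCoord {n : ℕ} (x : pairsC n → ℝ) (p : ℕ × ℕ) : ℝ :=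
  if p.1 + p.2 < 2 * n + 1 then coord x p
  else if p.1 + p.2 = 2 * n + 1 then 2 * coord x p
  else coord x (2 * n + 1 - p.2, 2 * n + 1 - p.1)

theorem phi_apply {n : ℕ} (x : pairsC n → ℝ) (p : pairsA (2 * n)) :
    phi n x p = phiCoord x p.1 := by
  have hp := mem_pairsA.1 p.2
  unfold phi phiCoord
  split_ifs with h1 h2
  · rw [coord_of_mem]
  · rw [coord_of_mem]
  · rw [coord_of_mem]

theorem phiCoord_reflection {n : ℕ} (x : pairsC n → ℝ) {k l : ℕ} (hk : k ≤ 2 * n)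
    (hl : l ≤ 2 * n) :
    phiCoord x (2 * n + 1 - l, 2 * n + 1 - k) = phiCoord x (k, l) := by
  have e1 : 2 * n + 1 - (2 * n + 1 - k) = k := by omega
  have e2 : 2 * n + 1 - (2 * n + 1 - l) = l := by omega
  simp only [phiCoord, e1, e2]
  rcases lt_trichotomy (k + l) (2 * n + 1) with h | h | h
  · rw [if_neg (by omega), if_neg (by omega), if_pos h]
  · rw [if_neg (by omega), if_pos (by omega), if_neg (by omega), if_pos h,
      show 2 * n + 1 - l = k by omega, show 2 * n + 1 - k = l by omega]
  · rw [if_pos (by omega), if_neg (by omega), if_neg (by omega)]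

/-- The sum of the coordinates of `φ(x)` along the hook with corner `(i, j)`. -/
noncomputable def phiHook {n : ℕ} (x : pairsC n → ℝ) (i j : ℕ) : ℝ :=
  ∑ l ∈ Finset.Ioc i j, phiCoord x (i, l) + ∑ k ∈ Finset.Ioo i j, phiCoord x (k, j)

theorem pathSum_phi {n : ℕ} (x : pairsC n → ℝ) {p : ℕ × ℕ} (hp : p ∈ pairsA (2 * n)) :
    pathSum (phi n x) (hook p.1 p.2) = phiHook x p.1 p.2 := by
  obtain ⟨i, j⟩ := p
  have hpA := mem_pairsA.1 hp
  simp only at hpA ⊢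
  have h1 : pathSum (phi n x) (hook i j) =
      ∑ q ∈ pairsA (2 * n), if q ∈ hook i j then phiCoord x q else 0 := by
    rw [pathSum, ← Finset.sum_coe_sort (pairsA (2 * n))]
    exact Finset.sum_congr rfl fun q _ => by rw [phi_apply]
  have h2 : (pairsA (2 * n)).filter (fun q => q ∈ hook i j) =
      (Finset.Ioc i j).image (fun l => (i, l)) ∪ (Finset.Ioo i j).image (fun k => (k, j)) := by
    ext ⟨k, l⟩
    simp only [Finset.mem_filter, mem_hook hpA.2.1, mem_pairsA, Finset.mem_union,
      Finset.mem_image, Finset.mem_Ioc, Finset.mem_Ioo, Prod.mk.injEq]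
    constructor
    · rintro ⟨-, h | h⟩
      · exact Or.inl ⟨l, h.2, h.1.symm, rfl⟩
      · exact Or.inr ⟨k, h.2, rfl, h.1.symm⟩
    · rintro (⟨_, h, rfl, rfl⟩ | ⟨_, h, rfl, rfl⟩)
      · exact ⟨by omega, Or.inl ⟨rfl, h⟩⟩
      · exact ⟨by omega, Or.inr ⟨rfl, h⟩⟩
  rw [h1, ← Finset.sum_filter, h2, Finset.sum_union, Finset.sum_image, Finset.sum_image, phiHook]
  · intro _ _ _ _ h; simpa using h
  · intro _ _ _ _ h; simpa using h
  · rw [Finset.disjoint_left]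
    intro q hq hq'
    obtain ⟨l, hl, rfl⟩ := Finset.mem_image.1 hq
    obtain ⟨k, hk, h⟩ := Finset.mem_image.1 hq'
    rw [Finset.mem_Ioo] at hk
    rw [Prod.mk.injEq] at h
    omega

theorem sum_reflection {M : Type*} [AddCommMonoid M] (f : ℕ → M) {s t : Finset ℕ} {N : ℕ}
    (h : ∀ k, k ∈ s → k ≤ N ∧ N - k ∈ t) (h' : ∀ k, k ∈ t → k ≤ N ∧ N - k ∈ s) :
    ∑ k ∈ s, f (N - k) = ∑ k ∈ t, f k :=
  Finset.sum_nbij' (fun k => N - k) (fun k => N - k) (fun k hk => (h k hk).2)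
    (fun k hk => (h' k hk).2) (fun k hk => by have := (h k hk).1; omega)
    (fun k hk => by have := (h' k hk).1; omega) (fun _ _ => rfl)

theorem phiHook_reflection {n : ℕ} (x : pairsC n → ℝ) {i j : ℕ} (hij : i < j)
    (hj : j ≤ 2 * n) : phiHook x (2 * n + 1 - j) (2 * n + 1 - i) = phiHook x i j := by
  have h1 : ∑ l ∈ Finset.Ioo (2 * n + 1 - j) (2 * n + 1 - i), phiCoord x (2 * n + 1 - j, l) =
      ∑ k ∈ Finset.Ioo i j, phiCoord x (k, j) := by
    rw [← sum_reflection (fun l => phiCoord x (2 * n + 1 - j, l)) (s := Finset.Ioo i j)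
      (N := 2 * n + 1)]
    · refine Finset.sum_congr rfl fun k hk => ?_
      rw [Finset.mem_Ioo] at hk
      exact phiCoord_reflection x (by omega) hj
    · intro k hk; rw [Finset.mem_Ioo] at hk ⊢; omega
    · intro k hk; rw [Finset.mem_Ioo] at hk ⊢; omega
  have h2 : ∑ k ∈ Finset.Ioo (2 * n + 1 - j) (2 * n + 1 - i), phiCoord x (k, 2 * n + 1 - i) =
      ∑ l ∈ Finset.Ioo i j, phiCoord x (i, l) := by
    rw [← sum_reflection (fun k => phiCoord x (k, 2 * n + 1 - i)) (s := Finset.Ioo i j)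
      (N := 2 * n + 1)]
    · refine Finset.sum_congr rfl fun k hk => ?_
      rw [Finset.mem_Ioo] at hk
      exact phiCoord_reflection x (by omega) (by omega)
    · intro k hk; rw [Finset.mem_Ioo] at hk ⊢; omega
    · intro k hk; rw [Finset.mem_Ioo] at hk ⊢; omega
  rw [phiHook, phiHook, ← Finset.Ioo_insert_right hij,
    ← Finset.Ioo_insert_right (show 2 * n + 1 - j < 2 * n + 1 - i by omega),
    Finset.sum_insert (by simp), Finset.sum_insert (by simp), h1, h2,
    phiCoord_reflection x (by omega) hj]
  ring

theorem phiHook_eq_of_le {n : ℕ} (x : pairsC n → ℝ) {i j : ℕ} (hij : i < j) (hj : j ≤ n) :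
    phiHook x i j = rowSum x i j + colSum x i j := by
  rw [phiHook, rowSum, colSum]
  congr 1
  · refine Finset.sum_congr rfl fun l hl => ?_
    rw [Finset.mem_Ioc] at hl
    rw [phiCoord, if_pos (by simp only; omega)]
  · refine Finset.sum_congr rfl fun l hl => ?_
    rw [Finset.mem_Ioo] at hl
    rw [phiCoord, if_pos (by simp only; omega)]

/-- The part of column j below the diagonal i + j = 2n+1 is, under φ, a reflected copy of row
2n+1−j. The factor 2 on the diagonal lets the entry (2n+1−j, j) count once in the type C hook and
once in this row. -/
theorem phiHook_eq_of_gt {n : ℕ} (x : pairsC n → ℝ) {i j : ℕ} (hi : 1 ≤ i) (hij : i < j)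
    (hj : n < j) (hs : i + j ≤ 2 * n + 1) :
    phiHook x i j = rowSum x i j + colSum x i j + rowSum x (2 * n + 1 - j) j := by
  have hrow : rowSum x (2 * n + 1 - j) j =
      ∑ k ∈ Finset.Ico (2 * n + 1 - j) j, coord x (2 * n + 1 - j, 2 * n + 1 - k) := by
    rw [rowSum, sum_reflection (fun l => coord x (2 * n + 1 - j, l))]
    · intro k hk; rw [Finset.mem_Ico] at hk; rw [Finset.mem_Ioc]; omega
    · intro k hk; rw [Finset.mem_Ioc] at hk; rw [Finset.mem_Ico]; omega
  have hterm : ∀ k ∈ Finset.Ioo i j, phiCoord x (k, j) = coord x (k, j) +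
      if 2 * n + 1 - j ≤ k then coord x (2 * n + 1 - j, 2 * n + 1 - k) else 0 := by
    intro k hk
    rw [Finset.mem_Ioo] at hk
    rcases lt_trichotomy (k + j) (2 * n + 1) with h | h | h
    · rw [phiCoord, if_pos h, if_neg (by omega), add_zero]
    · rw [phiCoord, if_neg (by simp only; omega), if_pos h, if_pos (by omega),
        show 2 * n + 1 - j = k by omega, show 2 * n + 1 - k = j by omega]
      ring
    · rw [phiCoord, if_neg (by simp only; omega), if_neg (by simp only; omega), if_pos (by omega),
        coord_of_notMem x (p := (k, j)) (by rw [mem_pairsC]; simp only; omega), zero_add]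
  rw [phiHook, Finset.sum_congr rfl hterm, Finset.sum_add_distrib, ← Finset.sum_filter, hrow,
    colSum]
  rcases hs.eq_or_lt with h | h
  · have e : 2 * n + 1 - j = i := by omega
    have e' : 2 * n + 1 - i = j := by omega
    have h1 : (Finset.Ioo i j).filter (fun k => 2 * n + 1 - j ≤ k) = Finset.Ioo i j := by
      refine Finset.filter_true_of_mem fun k hk => ?_
      rw [Finset.mem_Ioo] at hk; omega
    have h2 : ∑ l ∈ Finset.Ioo i j, phiCoord x (i, l) = ∑ l ∈ Finset.Ioo i j, coord x (i, l) := by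
      refine Finset.sum_congr rfl fun l hl => ?_
      rw [Finset.mem_Ioo] at hl
      rw [phiCoord, if_pos (by simp only; omega)]
    have h3 : phiCoord x (i, j) = 2 * coord x (i, j) := by
      rw [phiCoord, if_neg (by simp only; omega), if_pos h]
    rw [h1, e, rowSum, ← Finset.Ioo_insert_right hij, Finset.sum_insert (by simp),
      Finset.sum_insert (by simp), h2, h3, ← Finset.Ioo_insert_left hij,
      Finset.sum_insert (by simp), e']
    ring
  · have h1 : (Finset.Ioo i j).filter (fun k => 2 * n + 1 - j ≤ k) =
        Finset.Ico (2 * n + 1 - j) j := by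
      ext k; rw [Finset.mem_filter, Finset.mem_Ioo, Finset.mem_Ico]; omega
    have h2 : ∑ l ∈ Finset.Ioc i j, phiCoord x (i, l) = rowSum x i j := by
      refine Finset.sum_congr rfl fun l hl => ?_
      rw [Finset.mem_Ioc] at hl
      rw [phiCoord, if_pos (by simp only; omega)]
    rw [h1, h2]
    ring

theorem sum_barWeight_of_le {i j : ℕ} (hij : i ≤ j) (hj : j ≤ n) :
    ∑ k ∈ Finset.Ico i j, (barWeight n a k : ℝ) = lam n a i - lam n a j := by
  rw [lam_sub_lam a hij (by omega)]
  refine Finset.sum_congr rfl fun k hk => ?_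
  rw [Finset.mem_Ico] at hk
  rw [barWeight, if_pos (by omega)]

theorem sum_barWeight_of_gt {i j : ℕ} (hi : i ≤ n) (hj : n < j) (hj' : j ≤ 2 * n) :
    ∑ k ∈ Finset.Ico i j, (barWeight n a k : ℝ) = lam n a i + lam n a (2 * n + 1 - j) := by
  induction j, hj using Nat.le_induction with
  | base =>
    rw [Finset.sum_Ico_succ_top hi, sum_barWeight_of_le hi le_rfl, barWeight,
      if_neg (lt_irrefl n), if_pos rfl, show 2 * n + 1 - n.succ = n by omega,
      lam_succ a (le_refl n), lam_eq_zero a (Nat.lt_succ_self n)]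
    push_cast; ring
  | succ j hj ih =>
    have hj1 : n < j := hj
    rw [Finset.sum_Ico_succ_top (by omega), ih (by omega), barWeight, if_neg (by omega),
      if_neg (by omega), show 2 * n + 1 - (j + 1) = 2 * n - j by omega,
      lam_succ a (show 2 * n - j ≤ n by omega), show 2 * n - j + 1 = 2 * n + 1 - j by omega]
    ring

theorem sum_barWeight_reflection {i j : ℕ} (hi : 1 ≤ i) (hij : i < j) (hj : j ≤ 2 * n) :
    ∑ k ∈ Finset.Ico (2 * n + 1 - j) (2 * n + 1 - i), (barWeight n a k : ℝ) =
      ∑ k ∈ Finset.Ico i j, (barWeight n a k : ℝ) := by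
  rw [← sum_reflection (fun k => (barWeight n a k : ℝ)) (s := Finset.Ico i j) (N := 2 * n)]
  · refine Finset.sum_congr rfl fun k hk => ?_
    rw [Finset.mem_Ico] at hk
    congr 1
    unfold barWeight
    rcases lt_trichotomy k n with h | h | h
    · rw [if_neg (by omega), if_neg (by omega), if_pos h, show 2 * n - (2 * n - k) = k by omega]
    · rw [if_neg (by omega), if_pos (by omega), if_neg (by omega), if_pos h]
    · rw [if_pos (by omega), if_neg (by omega), if_neg (by omega)]
  · intro k hk; rw [Finset.mem_Ico] at hk ⊢; omega
  · intro k hk; rw [Finset.mem_Ico] at hk ⊢; omega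

/-- For j > n the extra row is the whole hook of the diagonal pair (2n+1−j, j), as its column part
lies outside the type C range. The two hook equations add up to Λ_i + Λ_{2n+1−j}, the doubled a_n
being counted once in each. -/
theorem IsHookPoint.phiHook_eq {x : pairsC n → ℝ} (hF : IsAdmissible n F)
    (hx : IsHookPoint n a F x) {p : ℕ × ℕ} (hp : p ∈ F) :
    phiHook x p.1 p.2 = ∑ k ∈ Finset.Ico p.1 p.2, (barWeight n a k : ℝ) := by
  have hpC := mem_pairsC.1 (hF.subset hp)
  have h1 := hx.hook p hp
  rcases le_or_gt p.2 n with hn | hn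
  · rw [phiHook_eq_of_le x hpC.2.1 hn, h1, sum_barWeight_of_le hpC.2.1.le hn]
  · have h2 := hx.hook _ (hF.diagonal p hp hn)
    have h3 : colSum x (2 * n + 1 - p.2) p.2 = 0 := by
      refine Finset.sum_eq_zero fun k hk => coord_of_notMem x ?_
      rw [Finset.mem_Ioo] at hk
      rw [mem_pairsC]; simp only; omega
    simp only [h3, add_zero] at h2
    rw [phiHook_eq_of_gt x hpC.1 hpC.2.1 hn hpC.2.2, h1, h2,
      sum_barWeight_of_gt (by omega) hn (by omega), lam_eq_zero a hn]
    ring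

theorem IsHookPoint.isSegmentPoint {x : pairsC n → ℝ} (hE : IsSymmetric n E)
    (hF : IsAdmissible n (lowerHalf n E)) (hx : IsHookPoint n a (lowerHalf n E) x) :
    IsSegmentPoint (2 * n) (barWeight n a) E (phi n x) := by
  constructor
  · intro p hp
    have hpA := mem_pairsA.1 p.2
    rw [phi_apply, phiCoord]
    split_ifs with h1 h2
    · exact hx.zero _ fun h => hp (mem_lowerHalf.1 h).1
    · rw [hx.zero _ fun h => hp (mem_lowerHalf.1 h).1, mul_zero]
    · refine hx.zero _ fun h => hp ?_
      have h3 := hE _ (mem_lowerHalf.1 h).1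
      simp only at h3
      rwa [show 2 * n + 1 - (2 * n + 1 - p.1.1) = p.1.1 by omega,
        show 2 * n + 1 - (2 * n + 1 - p.1.2) = p.1.2 by omega] at h3
  · intro p hp
    have hpA := mem_pairsA.1 p.2
    rw [pathSum_phi x p.2]
    rcases le_or_gt (p.1.1 + p.1.2) (2 * n + 1) with h | h
    · exact hx.phiHook_eq hF (mem_lowerHalf.2 ⟨hp, h⟩)
    · rw [← phiHook_reflection x hpA.2.1 hpA.2.2,
        ← sum_barWeight_reflection hpA.1 hpA.2.1 hpA.2.2]
      exact hx.phiHook_eq hF (mem_lowerHalf.2 ⟨hE _ hp, by simp only; omega⟩)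

theorem IsHookPoint.phi_eq_segmentPoint {x : pairsC n → ℝ} (hE : IsSymmetric n E)
    (hF : IsAdmissible n (lowerHalf n E)) (hx : IsHookPoint n a (lowerHalf n E) x) :
    phi n x = segmentPoint (2 * n) (barWeight n a) E :=
  (existsUnique_isSegmentPoint _ _ _).unique (hx.isSegmentPoint hE hF) (segmentPoint_spec _ _ _)

end FFLV

theorem mainTheorem9 (n : ℕ) (hn : 1 ≤ n) (a : ℕ → ℕ)
    (hreg : ∀ i, 1 ≤ i → i ≤ n → 0 < a i) :
    (∀ E ∈ FFLV.simpleSetsC n, ∃ v ∈ (FFLV.polytopeC n a).extremePoints ℝ,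
      FFLV.phi n v = FFLV.segmentPoint (2 * n) (FFLV.barWeight n a) E) ∧
    ∀ v ∈ (FFLV.polytopeC n a).extremePoints ℝ,
      (FFLV.IsSimpleVertex (FFLV.polytopeC n a) v ↔
        ∃ E ∈ FFLV.simpleSetsC n,
          FFLV.phi n v = FFLV.segmentPoint (2 * n) (FFLV.barWeight n a) E) := by
  have hex : ∀ E ∈ FFLV.simpleSetsC n, ∃ v, FFLV.IsSimpleVertex (FFLV.polytopeC n a) v ∧
      FFLV.phi n v = FFLV.segmentPoint (2 * n) (FFLV.barWeight n a) E := by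
    intro E hE
    have hF := FFLV.isAdmissible_lowerHalf hE
    obtain ⟨v, hv⟩ := FFLV.exists_isHookPoint a hF.subset
    exact ⟨v, hv.isSimpleVertex hreg hF, hv.phi_eq_segmentPoint hE.2.1 hF⟩
  refine ⟨fun E hE => ?_, fun v _ => ⟨fun hs => ?_, ?_⟩⟩
  · obtain ⟨v, hv, hphi⟩ := hex E hE
    exact ⟨v, hv.1, hphi⟩
  · have hF := FFLV.isAdmissible_support hreg hs
    have hx := FFLV.isHookPoint_support hreg hs
    rw [← FFLV.lowerHalf_symmetrization hF.subset] at hx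
    refine ⟨_, FFLV.symmetrization_mem_simpleSetsC hF,
      hx.phi_eq_segmentPoint (FFLV.isSymmetric_symmetrization hF.subset) ?_⟩
    rwa [FFLV.lowerHalf_symmetrization hF.subset]
  · rintro ⟨E, hE, hphi⟩
    obtain ⟨w, hw, hphi'⟩ := hex E hE
    rwa [FFLV.phi_injective n (hphi.trans hphi'.symm)]
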